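/- Let $m\in\mathbb N$ be squarefree, $\mathbb K=\mathbb Q(\sqrt{-m})\subset\mathbb C$ with ring of integers $\mathcal O$, and let $\omega=(1+\sqrt{-m})/2$ if $m\equiv 3 \pmod 4$, $\omega=\sqrt{-m}$ otherwise. Let $SU(2,2;\mathbb C)$ be the group of $M=\begin{pmatrix}A&B\\C&D\end{pmatrix}\in SL_4(\mathbb C)$ (with $2\times2$ blocks) satisfying $\overline M^{tr}JM=J$, $J=\begin{pmatrix}0&-I\\I&0\end{pmatrix}$. Let $\mathcal I(L)$ be the ideal of $\mathcal O$ generated by the entries of $L\in\mathcal O^{4\times4}$ and put \[\Gamma_2(\mathcal O)=SU(2,2;\mathbb C)\cap\mathcal O^{4\times 4},\qquad \mathcal G_{\mathbb K}=\{\tfrac1{\sqrt k}L\in SU(2,2;\mathbb C):\ k\in\mathbb N,\ k\ge 1,\ L\in\mathcal O^{4\times4}\},\] \[\Delta^*_{2,\mathbb K}=\{\tfrac1uL\in SU(2,2;\mathbb C):\ L\in\mathcal O^{4\times4},\ 0\ne u\in\mathbb C,\ u^2\in\mathcal O,\ u^2\mathcal O=\mathcal I(L)^2\}.\] Let \[S=\begin{pmatrix}2&2\operatorname{Re}\omega\\2\operatorname{Re}\omega&2\omega\overline\omega\end{pmatrix},\quad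 S_0=\begin{pmatrix}0&0&1\\0&-S&0\\1&0&0\end{pmatrix},\quad S_1=\begin{pmatrix}0&0&1\\0&S_0&0\\1&0&0\end{pmatrix},\] let $SO_0(S_1;\mathbb R)$ be the connected component of the identity in $SO(S_1;\mathbb R)=\{N\in SL_6(\mathbb R): N^{tr}S_1N=S_1\}$, let $SO_0(S_1;\mathbb Q)$ and $\Sigma^*_{\mathbb K}=SO_0(S_1;\mathbb Z)$ be its subsets of rational and of integral matrices, and let $\Sigma_{\mathbb K}=\{N\in SO_0(S_1;\mathbb R): N\in I+\mathbb Z^{6\times6}S_1\}$ be the discriminant kernel. Let $\varphi:\mathbb C^{2\times2}\to\mathbb C^4$ be the linear bijection $\begin{pmatrix}\alpha&\beta+\gamma\omega\\\beta+\gamma\overline\omega&\delta\end{pmatrix}\mapsto(\alpha,\beta,\gamma,\delta)^{tr}$ and let $X^\sharp$ denote the adjugate of a $2\times 2$ matrix $X$. For $M\in SU(2,2;\mathbb C)$ put \[\widetilde M=\begin{pmatrix}\alpha&a^{tr}S_0&\beta\\b&K&c\\\gamma&d^{tr}S_0&\delta\end{pmatrix},\] where $\alpha=\det A$, $\beta=-\det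 B$, $\gamma=-\det C$, $\delta=\det D$, $a=-\varphi(A^\sharp B)$, $b=-\varphi(AC^\sharp)$, $c=\varphi(BD^\sharp)$, $d=\varphi(C^\sharp D)$ and $K\varphi(Z)=\varphi(AZD^\sharp+BZ^\sharp C^\sharp)$ for $Z\in\mathbb C^{2\times2}$. Then $\phi: M\mapsto\widetilde M$ is a well-defined surjective homomorphism of groups $SU(2,2;\mathbb C)\to SO_0(S_1;\mathbb R)$ with kernel $\{\pm I\}$. For all $M\in SU(2,2;\mathbb C)$ and all $Z\in\mathbb C^{2\times 2}$ with $\tfrac1{2i}(Z-\overline Z^{tr})$ positive definite, with $z=\varphi(Z)$, it satisfies $\det(CZ+D)\neq0$ and \[\det(CZ+D)=\widetilde M\{z\},\qquad \varphi\bigl((AZ+B)(CZ+D)^{-1}\bigr)=\frac1{\widetilde M\{z\}}\Bigl(-\tfrac12S_0[z]\,b+Kz+c\Bigr),\] where $S_0[z]=z^{tr}S_0z$ and $\widetilde M\{z\}=-\tfrac\gamma2S_0[z]+d^{tr}S_0z+\delta$. Moreover \[\phi(\mathcal G_{\mathbb K})=SO_0(S_1;\mathbb Q),\qquad \phi(\Delta^*_{2,\mathbb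 K})=\Sigma^*_{\mathbb K},\qquad \phi(\Gamma_2(\mathcal O))=\Sigma_{\mathbb K}.\] -/

import Mathlib

open scoped Matrix ComplexOrder NumberField

noncomputable section

namespace HermMod

/-- The index set of `4 × 4` matrices written in `2 × 2` blocks `(A B; C D)`. -/
abbrev I4 : Type := Fin 2 ⊕ Fin 2

/-! ### The unitary side -/

/-- `SU(2,2;ℂ)`: the matrices `M ∈ SL₄(ℂ)` with `M̄ᵗʳ J M = J`, where `J = (0 -I; I 0)`. -/
def SU22 : Subgroup (Matrix.SpecialLinearGroup I4 ℂ) where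
  carrier := {M | (M : Matrix I4 I4 ℂ)ᴴ * Matrix.J (Fin 2) ℂ * (M : Matrix I4 I4 ℂ)
    = Matrix.J (Fin 2) ℂ}
  one_mem' := by simp
  mul_mem' := by
    intro M N hM hN
    simp only [Set.mem_ofPred_eq, Matrix.SpecialLinearGroup.coe_mul,
      Matrix.conjTranspose_mul] at *
    calc _ = (N : Matrix I4 I4 ℂ)ᴴ * ((M : Matrix I4 I4 ℂ)ᴴ * Matrix.J (Fin 2) ℂ *
            (M : Matrix I4 I4 ℂ)) * (N : Matrix I4 I4 ℂ) := by simp only [Matrix.mul_assoc]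
      _ = _ := by rw [hM, hN]
  inv_mem' := by
    intro M hM
    simp only [Set.mem_ofPred_eq] at *
    have h1 : (M : Matrix I4 I4 ℂ) * ((M⁻¹ : Matrix.SpecialLinearGroup I4 ℂ) : Matrix I4 I4 ℂ)
        = 1 := by
      rw [← Matrix.SpecialLinearGroup.coe_mul, mul_inv_cancel, Matrix.SpecialLinearGroup.coe_one]
    have h2 := congrArg Matrix.conjTranspose h1
    rw [Matrix.conjTranspose_mul, Matrix.conjTranspose_one] at h2
    generalize ((M⁻¹ : Matrix.SpecialLinearGroup I4 ℂ) : Matrix I4 I4 ℂ) = N at *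
    calc Nᴴ * Matrix.J (Fin 2) ℂ * N
        = Nᴴ * ((M : Matrix I4 I4 ℂ)ᴴ * Matrix.J (Fin 2) ℂ * (M : Matrix I4 I4 ℂ)) * N := by
          rw [hM]
      _ = (Nᴴ * (M : Matrix I4 I4 ℂ)ᴴ) * Matrix.J (Fin 2) ℂ * ((M : Matrix I4 I4 ℂ) * N) := by
          simp only [Matrix.mul_assoc]
      _ = Matrix.J (Fin 2) ℂ := by rw [h1, h2, Matrix.one_mul, Matrix.mul_one]

/-- The underlying `4 × 4` matrix. -/
def mat4 (M : SU22) : Matrix I4 I4 ℂ := (M.1 : Matrix I4 I4 ℂ)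

/-- The block `A` of `M = (A B; C D)`. -/
def blkA (M : SU22) : Matrix (Fin 2) (Fin 2) ℂ := (mat4 M).toBlocks₁₁

/-- The block `B` of `M = (A B; C D)`. -/
def blkB (M : SU22) : Matrix (Fin 2) (Fin 2) ℂ := (mat4 M).toBlocks₁₂

/-- The block `C` of `M = (A B; C D)`. -/
def blkC (M : SU22) : Matrix (Fin 2) (Fin 2) ℂ := (mat4 M).toBlocks₂₁

/-- The block `D` of `M = (A B; C D)`. -/
def blkD (M : SU22) : Matrix (Fin 2) (Fin 2) ℂ := (mat4 M).toBlocks₂₂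

/-- The Hermitian half-space of degree two. -/
def H2 : Set (Matrix (Fin 2) (Fin 2) ℂ) :=
  {Z | ((1 / (2 * Complex.I)) • (Z - Zᴴ)).PosDef}

/-- The action `M⟨Z⟩ = (AZ + B)(CZ + D)⁻¹` on the Hermitian half-space. -/
def actH (M : SU22) (Z : Matrix (Fin 2) (Fin 2) ℂ) : Matrix (Fin 2) (Fin 2) ℂ :=
  (blkA M * Z + blkB M) * (blkC M * Z + blkD M)⁻¹

/-! ### The imaginary-quadratic field -/

/-- `√(-m) = i √m`. -/
def sqrtNeg (m : ℕ) : ℂ := Complex.I * (Real.sqrt m : ℂ)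

/-- The field `ℚ(√-m) ⊂ ℂ`. -/
abbrev K (m : ℕ) : IntermediateField ℚ ℂ := IntermediateField.adjoin ℚ {sqrtNeg m}

/-- The inclusion of the ring of integers of `ℚ(√-m)` into `ℂ`. -/
def intEmb (m : ℕ) : 𝓞 (K m) →+* ℂ :=
  (algebraMap (K m) ℂ).comp (algebraMap (𝓞 (K m)) (K m))

/-- `ω = (1 + √-m)/2` if `m ≡ 3 mod 4` and `ω = √-m` otherwise. -/
def omega (m : ℕ) : ℂ := if m % 4 = 3 then (1 + sqrtNeg m) / 2 else sqrtNeg m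

/-- The Hermitian modular group of degree two: integral matrices in `SU(2,2;ℂ)`. -/
def Gamma2 (m : ℕ) : Set SU22 :=
  {M | ∃ L : Matrix I4 I4 (𝓞 (K m)), mat4 M = L.map (intEmb m)}

/-- The ideal generated by the entries of an integral matrix. -/
def entryIdeal {m : ℕ} (L : Matrix I4 I4 (𝓞 (K m))) : Ideal (𝓞 (K m)) :=
  Ideal.span {x | ∃ i j, x = L i j}

/-- The extended Hermitian modular group of degree two: all `(1/u) L ∈ SU(2,2;ℂ)` with `L`
integral, `u² ∈ 𝓞` and `u² 𝓞 = I(L)²`. -/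
def DeltaStar (m : ℕ) : Set SU22 :=
  {M | ∃ (u : ℂ) (L : Matrix I4 I4 (𝓞 (K m))) (w : 𝓞 (K m)), u ≠ 0 ∧
    mat4 M = u⁻¹ • L.map (intEmb m) ∧ intEmb m w = u ^ 2 ∧
    Ideal.span {w} = entryIdeal L ^ 2}

/-- All `(1/√k) L ∈ SU(2,2;ℂ)` with `L` integral and `k` a positive integer. -/
def GK (m : ℕ) : Set SU22 :=
  {M | ∃ (k : ℕ) (L : Matrix I4 I4 (𝓞 (K m))), 0 < k ∧
    mat4 M = ((Real.sqrt k : ℝ) : ℂ)⁻¹ • L.map (intEmb m)}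

/-! ### The orthogonal side -/

/-- `S = (2, 2 Re ω; 2 Re ω, 2 ω ω̄)`. -/
def S (m : ℕ) : Matrix (Fin 2) (Fin 2) ℝ :=
  !![2, 2 * (omega m).re; 2 * (omega m).re, 2 * Complex.normSq (omega m)]

/-- `S₀ = (0 0 1; 0 -S 0; 1 0 0)`. -/
def S0 (m : ℕ) : Matrix (Fin 4) (Fin 4) ℝ :=
  !![0, 0, 0, 1;
     0, -S m 0 0, -S m 0 1, 0;
     0, -S m 1 0, -S m 1 1, 0;
     1, 0, 0, 0]

/-- The `6 × 6` matrix `(α rᵗʳ β; b k c; γ sᵗʳ δ)` with blocks of sizes `1, 4, 1`. -/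
def block6 {R : Type*} (α : R) (r : Fin 4 → R) (β : R)
    (b : Fin 4 → R) (k : Matrix (Fin 4) (Fin 4) R) (c : Fin 4 → R)
    (γ : R) (s : Fin 4 → R) (δ : R) : Matrix (Fin 6) (Fin 6) R :=
  !![α, r 0, r 1, r 2, r 3, β;
     b 0, k 0 0, k 0 1, k 0 2, k 0 3, c 0;
     b 1, k 1 0, k 1 1, k 1 2, k 1 3, c 1;
     b 2, k 2 0, k 2 1, k 2 2, k 2 3, c 2;
     b 3, k 3 0, k 3 1, k 3 2, k 3 3, c 3;
     γ, s 0, s 1, s 2, s 3, δ]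

/-- `S₁ = (0 0 1; 0 S₀ 0; 1 0 0)`. -/
def S1 (m : ℕ) : Matrix (Fin 6) (Fin 6) ℝ := block6 0 0 1 0 (S0 m) 0 1 0 0

/-- `SO(S₁;ℝ)`: the matrices `N ∈ SL₆(ℝ)` with `Nᵗʳ S₁ N = S₁`. -/
def SO (m : ℕ) : Subgroup (Matrix.SpecialLinearGroup (Fin 6) ℝ) where
  carrier := {N | (N : Matrix (Fin 6) (Fin 6) ℝ)ᵀ * S1 m * (N : Matrix (Fin 6) (Fin 6) ℝ) = S1 m}
  one_mem' := by simp
  mul_mem' := by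
    intro M N hM hN
    simp only [Set.mem_ofPred_eq, Matrix.SpecialLinearGroup.coe_mul,
      Matrix.transpose_mul] at *
    calc _ = (N : Matrix (Fin 6) (Fin 6) ℝ)ᵀ * ((M : Matrix (Fin 6) (Fin 6) ℝ)ᵀ * S1 m *
            (M : Matrix (Fin 6) (Fin 6) ℝ)) * (N : Matrix (Fin 6) (Fin 6) ℝ) := by
            simp only [Matrix.mul_assoc]
      _ = _ := by rw [hM, hN]
  inv_mem' := by
    intro M hM
    simp only [Set.mem_ofPred_eq] at *
    have h1 : (M : Matrix (Fin 6) (Fin 6) ℝ) *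
        ((M⁻¹ : Matrix.SpecialLinearGroup (Fin 6) ℝ) : Matrix (Fin 6) (Fin 6) ℝ) = 1 := by
      rw [← Matrix.SpecialLinearGroup.coe_mul, mul_inv_cancel, Matrix.SpecialLinearGroup.coe_one]
    have h2 := congrArg Matrix.transpose h1
    rw [Matrix.transpose_mul, Matrix.transpose_one] at h2
    generalize ((M⁻¹ : Matrix.SpecialLinearGroup (Fin 6) ℝ) : Matrix (Fin 6) (Fin 6) ℝ) = N at *
    calc Nᵀ * S1 m * N
        = Nᵀ * ((M : Matrix (Fin 6) (Fin 6) ℝ)ᵀ * S1 m * (M : Matrix (Fin 6) (Fin 6) ℝ)) * N := by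
          rw [hM]
      _ = (Nᵀ * (M : Matrix (Fin 6) (Fin 6) ℝ)ᵀ) * S1 m *
            ((M : Matrix (Fin 6) (Fin 6) ℝ) * N) := by
          simp only [Matrix.mul_assoc]
      _ = S1 m := by rw [h1, h2, Matrix.one_mul, Matrix.mul_one]

/-- `SO₀(S₁;ℝ)`: the connected component of the identity in `SO(S₁;ℝ)`. -/
def SO0 (m : ℕ) : Subgroup (SO m) := Subgroup.connectedComponentOfOne (SO m)

/-- The underlying real `6 × 6` matrix. -/
def mat6 {m : ℕ} (N : SO0 m) : Matrix (Fin 6) (Fin 6) ℝ := (N.1.1 : Matrix (Fin 6) (Fin 6) ℝ)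

/-- `SO₀(S₁;ℚ)`: the rational matrices in `SO₀(S₁;ℝ)`. -/
def SO0Q (m : ℕ) : Set (SO0 m) :=
  {N | ∃ P : Matrix (Fin 6) (Fin 6) ℚ, mat6 N = P.map (fun q : ℚ => (q : ℝ))}

/-- `SO₀(S₁;ℤ)`: the integral matrices in `SO₀(S₁;ℝ)`. -/
def SigmaStar (m : ℕ) : Set (SO0 m) :=
  {N | ∃ P : Matrix (Fin 6) (Fin 6) ℤ, mat6 N = P.map (fun a : ℤ => (a : ℝ))}

/-- The discriminant kernel: the matrices of `SO₀(S₁;ℝ)` in `I + ℤ⁶ˣ⁶ S₁`. -/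
def Sigma (m : ℕ) : Set (SO0 m) :=
  {N | ∃ P : Matrix (Fin 6) (Fin 6) ℤ, mat6 N = 1 + P.map (fun a : ℤ => (a : ℝ)) * S1 m}

/-- The complexification of `S₀`. -/
def S0C (m : ℕ) : Matrix (Fin 4) (Fin 4) ℂ := (S0 m).map (fun x : ℝ => (x : ℂ))

/-- `S₀[z] = zᵗʳ S₀ z` for complex `z`. -/
def quad (m : ℕ) (z : Fin 4 → ℂ) : ℂ := z ⬝ᵥ (S0C m *ᵥ z)

/-- The indices of the middle block. -/
def mid (j : Fin 4) : Fin 6 := j.castSucc.succ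

/-- The factor of automorphy `N{z} = -(γ/2) S₀[z] + dᵗʳ S₀ z + δ`, where `(γ, dᵗʳ S₀, δ)` is the
last row of `N`. -/
def factorO {m : ℕ} (N : SO0 m) (z : Fin 4 → ℂ) : ℂ :=
  -((mat6 N 5 0 : ℝ) : ℂ) / 2 * quad m z + (∑ j, ((mat6 N 5 (mid j) : ℝ) : ℂ) * z j)
    + ((mat6 N 5 5 : ℝ) : ℂ)

/-- The action `N⟨z⟩ = N{z}⁻¹ (-(1/2) S₀[z] b + K z + c)`, where `(b, K, c)` are the four middle
rows of `N`. -/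
def actO {m : ℕ} (N : SO0 m) (z : Fin 4 → ℂ) : Fin 4 → ℂ := fun i =>
  (factorO N z)⁻¹ * (-(1 / 2) * quad m z * ((mat6 N (mid i) 0 : ℝ) : ℂ)
    + (∑ j, ((mat6 N (mid i) (mid j) : ℝ) : ℂ) * z j) + ((mat6 N (mid i) 5 : ℝ) : ℂ))

/-! ### The explicit map -/

/-- The matrix `(α, β + γω; β + γω̄, δ)` attached to `(α, β, γ, δ)`. -/
def ofCoord (m : ℕ) (z : Fin 4 → ℂ) : Matrix (Fin 2) (Fin 2) ℂ :=
  !![z 0, z 1 + z 2 * omega m; z 1 + z 2 * (starRingEnd ℂ) (omega m), z 3]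

/-- The coordinates `(α, β, γ, δ)` of the matrix `(α, β + γω; β + γω̄, δ)`. -/
def coord (m : ℕ) (Z : Matrix (Fin 2) (Fin 2) ℂ) : Fin 4 → ℂ :=
  let g := (Z 0 1 - Z 1 0) / (omega m - (starRingEnd ℂ) (omega m))
  ![Z 0 0, Z 0 1 - g * omega m, g, Z 1 1]

/-- The explicit matrix `M̃ = (α, aᵗʳ S₀, β; b, K, c; γ, dᵗʳ S₀, δ)` with `α = det A`,
`β = -det B`, `γ = -det C`, `δ = det D`, `a = -φ(A♯ B)`, `b = -φ(A C♯)`, `c = φ(B D♯)`,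
`d = φ(C♯ D)` and `K φ(Z) = φ(A Z D♯ + B Z♯ C♯)`, where `φ` denotes the coordinates and `♯` the
adjugate matrix. It is written with complex entries; they turn out to be real. -/
def tilde (m : ℕ) (M : SU22) : Matrix (Fin 6) (Fin 6) ℂ :=
  block6
    (blkA M).det ((-coord m ((blkA M).adjugate * blkB M)) ᵥ* S0C m) (-(blkB M).det)
    (-coord m (blkA M * (blkC M).adjugate))
    (Matrix.of fun i j =>
      coord m (blkA M * ofCoord m (Pi.single j 1) * (blkD M).adjugate
        + blkB M * (ofCoord m (Pi.single j 1)).adjugate * (blkC M).adjugate) i)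
    (coord m (blkB M * (blkD M).adjugate))
    (-(blkC M).det) (coord m ((blkC M).adjugate * blkD M) ᵥ* S0C m) (blkD M).det

end HermMod

end

/-! The homomorphism is the exceptional isogeny coming from the exterior square of the standard
representation. A matrix `M` acts on alternating `4 × 4` matrices by `X ↦ M X Mᵗʳ`. In the six
coordinates given by `alt` this action is `M̃` (`altBlock_congr`, `mat4_mul_alt_mul`), so
multiplicativity is immediate. Since `det M = 1`, the wedge pairing `Λ² × Λ² → Λ⁴` is preserved, and
in these coordinates it is `S₁` (`transpose_mul_hodge_mul`, `trace_hodge_mul`). Unitarity makes the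
action commute with the antilinear involution "Hodge dual, conjugate, transport by `J`", whose fixed
points come from the real vectors; hence `M̃` is real (`altBlock_conj`). Unipotent block matrices
generate `SU(2,2)` (`eq_top_of_unipotent_mem`), so the group is connected and the image lies in the
identity component with determinant one.

Surjectivity: a real orthogonal matrix near the identity can be reduced to `1` by images of scaling,
unipotent and Levi elements, one basis vector at a time (`inImage_of_pos`). The image is thus an
open subgroup, hence closed, and contains the component. An element of the kernel has the same `2 ×
2` minors as the identity, so it is `±1`. The formulas on the half-space follow by applying `M̃` to
the isotropic lift `(-det Z, z, 1)`.

Arithmetic: real vectors are integral or rational exactly when their alternating matrices have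
entries in `𝓞` or `K` (`alt_mem_OO_iff`, `alt_mem_KK_iff`), which makes the images of `GK` and
`DeltaStar` easy to locate. The columns of `S₁⁻¹` correspond to elementary bivectors and `J / (ω -
ω̄)`, up to integral changes, and this describes the discriminant kernel (`toSO0_mem_Sigma_iff`).

For the converses, suppose `M̃` is integral. It normalises the discriminant kernel, so conjugates by
`M` of integral transvections act integrally. Being `1 + E` with `E` of rank one and square zero,
they are themselves integral, and the ring generated by the matrices `E` gives `M_{ij} M̄_{kl} ∈ 𝓞`
(`mul_conj_mem_of_fixedMod`); the rational case is the same with `K` for `𝓞`. From there `M = L /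
√k` (`mem_GK_of_mem_SO0Q`). In the integral case `I(L) I(L̄) = (k)`, and `det L = k²` forces `I(L) =
I(L̄)`, so `I(L)² = (k)` (`exists_entryIdeal_sq_eq`). In the discriminant kernel the condition on `J
/ (ω - ω̄)` makes `I(L)` generated by a rational integer `r`; then `k = r²` and `M = ± L / r` is
integral (`mem_Gamma2_of_mem_Sigma`). -/

noncomputable section

namespace HermMod

/-! ### The action on alternating matrices in coordinates -/

/-- The alternating matrix `(-x ε, Z ε; ε Zᵗʳ, y ε)` with `ε = (0 1; -1 0)`. -/
def altBlock (x : ℂ) (Z : Matrix (Fin 2) (Fin 2) ℂ) (y : ℂ) : Matrix I4 I4 ℂ :=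
  Matrix.fromBlocks !![0, -x; x, 0] !![-Z 0 1, Z 0 0; -Z 1 1, Z 1 0]
    !![Z 0 1, Z 1 1; -Z 0 0, -Z 1 0] !![0, y; -y, 0]

/-- The alternating `4 × 4` matrix attached to a vector of length six. -/
def alt (m : ℕ) (v : Fin 6 → ℂ) : Matrix I4 I4 ℂ :=
  altBlock (v 0) (ofCoord m fun j => v (mid j)) (v 5)

/-- Source of the explicit formulas for `M̃`. With `ε = (0 1; -1 0)` one has `A ε Aᵗʳ = (det A) ε`
and `ε Aᵗʳ = A♯ ε`, so each block of the product is a determinant or an adjugate product times `ε`.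
-/
lemma altBlock_congr (A B C D Z : Matrix (Fin 2) (Fin 2) ℂ) (x y : ℂ) :
    Matrix.fromBlocks A B C D * altBlock x Z y * (Matrix.fromBlocks A B C D)ᵀ =
      altBlock (A.det * x - ((A.adjugate * B).adjugate * Z).trace - B.det * y)
        (-x • (A * C.adjugate) + (A * Z * D.adjugate + B * Z.adjugate * C.adjugate)
          + y • (B * D.adjugate))
        (-C.det * x + ((C.adjugate * D).adjugate * Z).trace + D.det * y) := by
  rw [altBlock, altBlock, Matrix.fromBlocks_transpose, Matrix.fromBlocks_multiply,
    Matrix.fromBlocks_multiply]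
  congr 1 <;> ext i j <;> fin_cases i <;> fin_cases j <;>
    simp [Matrix.mul_apply, Fin.sum_univ_two, Matrix.det_fin_two, Matrix.adjugate_fin_two,
      Matrix.trace_fin_two, Matrix.vecMul, dotProduct] <;> ring

lemma sqrtNeg_mul_self (m : ℕ) : sqrtNeg m * sqrtNeg m = -(m : ℂ) := by
  rw [sqrtNeg, mul_mul_mul_comm, Complex.I_mul_I, ← Complex.ofReal_mul,
    Real.mul_self_sqrt (Nat.cast_nonneg m)]
  simp

lemma conj_sqrtNeg (m : ℕ) : (starRingEnd ℂ) (sqrtNeg m) = -sqrtNeg m := by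
  simp [sqrtNeg]

lemma sqrtNeg_ne_zero {m : ℕ} (hm : m ≠ 0) : sqrtNeg m ≠ 0 := by
  intro h
  have := sqrtNeg_mul_self m
  rw [h] at this
  simp_all

/-- The different `ω - ω̄`. -/
def diffOmega (m : ℕ) : ℂ := omega m - (starRingEnd ℂ) (omega m)

lemma diffOmega_eq (m : ℕ) :
    diffOmega m = if m % 4 = 3 then sqrtNeg m else 2 * sqrtNeg m := by
  unfold diffOmega omega
  split_ifs
  · simp only [map_div₀, map_add, map_one, conj_sqrtNeg, map_ofNat]; ring
  · rw [conj_sqrtNeg]; ring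

lemma diffOmega_ne_zero {m : ℕ} (hm : m ≠ 0) : diffOmega m ≠ 0 := by
  rw [diffOmega_eq]
  split_ifs
  · exact sqrtNeg_ne_zero hm
  · exact mul_ne_zero two_ne_zero (sqrtNeg_ne_zero hm)

lemma ofCoord_coord {m : ℕ} (hm : m ≠ 0) (Z : Matrix (Fin 2) (Fin 2) ℂ) :
    ofCoord m (coord m Z) = Z := by
  have h := diffOmega_ne_zero hm
  unfold diffOmega at h
  ext i j
  fin_cases i <;> fin_cases j <;> simp [ofCoord, coord]
  field_simp
  ring

lemma coord_ofCoord {m : ℕ} (hm : m ≠ 0) (z : Fin 4 → ℂ) :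
    coord m (ofCoord m z) = z := by
  have h := diffOmega_ne_zero hm
  unfold diffOmega at h
  have e : (z 2 * omega m - z 2 * (starRingEnd ℂ) (omega m)) /
      (omega m - (starRingEnd ℂ) (omega m)) = z 2 := by
    field_simp
  ext i
  fin_cases i <;> simp [ofCoord, coord, e]

lemma ofCoord_injective {m : ℕ} (hm : m ≠ 0) : Function.Injective (ofCoord m) :=
  Function.LeftInverse.injective (coord_ofCoord hm)

lemma ofCoord_add (m : ℕ) (z w : Fin 4 → ℂ) : ofCoord m (z + w) = ofCoord m z + ofCoord m w := by
  ext i j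
  fin_cases i <;> fin_cases j <;> simp [ofCoord] <;> ring

lemma ofCoord_smul (m : ℕ) (c : ℂ) (z : Fin 4 → ℂ) : ofCoord m (c • z) = c • ofCoord m z := by
  ext i j
  fin_cases i <;> fin_cases j <;> simp [ofCoord] <;> ring

lemma ofCoord_eq_sum (m : ℕ) (z : Fin 4 → ℂ) :
    ofCoord m z = ∑ j, z j • ofCoord m (Pi.single j 1) := by
  ext i j
  fin_cases i <;> fin_cases j <;> simp [ofCoord, Fin.sum_univ_four, Pi.single_apply]

lemma coord_add (m : ℕ) (Z W : Matrix (Fin 2) (Fin 2) ℂ) :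
    coord m (Z + W) = coord m Z + coord m W := by
  ext i
  fin_cases i <;> simp [coord] <;> ring

lemma coord_smul (m : ℕ) (c : ℂ) (Z : Matrix (Fin 2) (Fin 2) ℂ) :
    coord m (c • Z) = c • coord m Z := by
  ext i
  fin_cases i <;> simp [coord] <;> ring

lemma coord_neg (m : ℕ) (Z : Matrix (Fin 2) (Fin 2) ℂ) : coord m (-Z) = -coord m Z := by
  simpa using coord_smul m (-1) Z

lemma two_re_omega (m : ℕ) :
    (2 * ((omega m).re : ℂ)) = omega m + (starRingEnd ℂ) (omega m) := by
  rw [Complex.add_conj]; push_cast; ring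

/-- In these coordinates `S₀` is the polarisation of the determinant: `tr (W♯ Z) = det (W + Z) - det
W - det Z`. This turns the rows `aᵗʳ S₀` and `dᵗʳ S₀` of `M̃` into traces. -/
lemma vecMul_S0C_dotProduct (m : ℕ) (w z : Fin 4 → ℂ) :
    (w ᵥ* S0C m) ⬝ᵥ z = ((ofCoord m w).adjugate * ofCoord m z).trace := by
  simp only [dotProduct, Matrix.vecMul, S0C, S0, S, ofCoord, Fin.sum_univ_four,
    Matrix.trace_fin_two, Matrix.mul_apply, Fin.sum_univ_two, Matrix.adjugate_fin_two]
  simp [two_re_omega, Complex.normSq_eq_conj_mul_self]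
  ring

lemma coord_apply_sum (m : ℕ) (f : Matrix (Fin 2) (Fin 2) ℂ →ₗ[ℂ] Matrix (Fin 2) (Fin 2) ℂ)
    (z : Fin 4 → ℂ) :
    (Matrix.of fun i j => coord m (f (ofCoord m (Pi.single j 1))) i) *ᵥ z
      = coord m (f (ofCoord m z)) := by
  rw [ofCoord_eq_sum m z, map_sum, Fin.sum_univ_four]
  simp only [map_smul, coord_add, coord_smul]
  ext i
  simp [Matrix.mulVec, dotProduct, Fin.sum_univ_four, mul_comm]

/-- The linear map `Z ↦ A Z D♯ + B Z♯ C♯`. -/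
def middleMap (A B C D : Matrix (Fin 2) (Fin 2) ℂ) :
    Matrix (Fin 2) (Fin 2) ℂ →ₗ[ℂ] Matrix (Fin 2) (Fin 2) ℂ where
  toFun Z := A * Z * D.adjugate + B * Z.adjugate * C.adjugate
  map_add' Z W := by
    have : (Z + W).adjugate = Z.adjugate + W.adjugate := by
      ext i j
      fin_cases i <;> fin_cases j <;> simp [Matrix.adjugate_fin_two] <;> ring
    rw [this]
    simp only [Matrix.mul_add, Matrix.add_mul]
    abel
  map_smul' c Z := by
    have : (c • Z).adjugate = c • Z.adjugate := by
      ext i j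
      fin_cases i <;> fin_cases j <;> simp [Matrix.adjugate_fin_two]
    rw [this]
    simp

lemma block6_mulVec {R : Type*} [CommRing R] (α : R) (r : Fin 4 → R) (β : R)
    (b : Fin 4 → R) (k : Matrix (Fin 4) (Fin 4) R) (c : Fin 4 → R)
    (γ : R) (s : Fin 4 → R) (δ : R) (v : Fin 6 → R) :
    (block6 α r β b k c γ s δ *ᵥ v) 0 = α * v 0 + r ⬝ᵥ (fun j => v (mid j)) + β * v 5 ∧
    (fun i => (block6 α r β b k c γ s δ *ᵥ v) (mid i)) =
      v 0 • b + k *ᵥ (fun j => v (mid j)) + v 5 • c ∧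
    (block6 α r β b k c γ s δ *ᵥ v) 5 = γ * v 0 + s ⬝ᵥ (fun j => v (mid j)) + δ * v 5 := by
  refine ⟨?_, ?_, ?_⟩
  · simp [block6, Matrix.mulVec, dotProduct, Fin.sum_univ_succ, mid]; ring
  · ext i
    fin_cases i <;> simp [block6, Matrix.mulVec, dotProduct, Fin.sum_univ_succ, mid] <;> ring
  · simp [block6, Matrix.mulVec, dotProduct, Fin.sum_univ_succ, mid]; ring

lemma mat4_eq_fromBlocks (M : SU22) :
    mat4 M = Matrix.fromBlocks (blkA M) (blkB M) (blkC M) (blkD M) :=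
  (Matrix.fromBlocks_toBlocks _).symm

/-- The action of `M` on alternating matrices is given by `M̃`. -/
lemma mat4_mul_alt_mul {m : ℕ} (hm : m ≠ 0) (M : SU22) (v : Fin 6 → ℂ) :
    mat4 M * alt m v * (mat4 M)ᵀ = alt m (tilde m M *ᵥ v) := by
  rw [mat4_eq_fromBlocks, alt, altBlock_congr, alt]
  obtain ⟨h0, h1, h2⟩ := block6_mulVec (blkA M).det
    ((-coord m ((blkA M).adjugate * blkB M)) ᵥ* S0C m) (-(blkB M).det)
    (-coord m (blkA M * (blkC M).adjugate))
    (Matrix.of fun i j => coord m (middleMap (blkA M) (blkB M) (blkC M) (blkD M)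
      (ofCoord m (Pi.single j 1))) i)
    (coord m (blkB M * (blkD M).adjugate))
    (-(blkC M).det) (coord m ((blkC M).adjugate * blkD M) ᵥ* S0C m) (blkD M).det v
  change (tilde m M *ᵥ v) 0 = _ at h0
  change (fun i => (tilde m M *ᵥ v) (mid i)) = _ at h1
  change (tilde m M *ᵥ v) 5 = _ at h2
  rw [h0, h1, h2, vecMul_S0C_dotProduct, vecMul_S0C_dotProduct, coord_apply_sum, ← coord_neg,
    ← coord_neg, ofCoord_add, ofCoord_add, ofCoord_smul, ofCoord_smul, ofCoord_coord hm,
    ofCoord_coord hm, ofCoord_coord hm, ofCoord_coord hm, ofCoord_coord hm]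
  congr 1
  · have : (-((blkA M).adjugate * blkB M)).adjugate = -((blkA M).adjugate * blkB M).adjugate := by
      ext i j
      fin_cases i <;> fin_cases j <;> simp [Matrix.adjugate_fin_two]
    rw [this, Matrix.neg_mul, Matrix.trace_neg]
    ring
  · rw [smul_neg, neg_smul]; rfl

lemma alt_injective {m : ℕ} (hm : m ≠ 0) : Function.Injective (alt m) := by
  intro v w h
  have e := fun i j => congrFun (congrFun h i) j
  have h0 : v 0 = w 0 := by simpa [alt, altBlock] using e (.inl 1) (.inl 0)
  have h5 : v 5 = w 5 := by simpa [alt, altBlock] using e (.inr 0) (.inr 1)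
  have hz : (fun j => v (mid j)) = fun j => w (mid j) := by
    apply ofCoord_injective hm
    ext i j
    fin_cases i <;> fin_cases j
    · simpa [alt, altBlock] using e (.inl 0) (.inr 1)
    · simpa [alt, altBlock] using e (.inr 0) (.inl 0)
    · simpa [alt, altBlock] using e (.inl 1) (.inr 1)
    · simpa [alt, altBlock] using e (.inr 0) (.inl 1)
  ext i
  fin_cases i
  · exact h0
  · exact congrFun hz 0
  · exact congrFun hz 1
  · exact congrFun hz 2
  · exact congrFun hz 3
  · exact h5

lemma tilde_one {m : ℕ} (hm : m ≠ 0) : tilde m 1 = 1 := by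
  apply Matrix.ext_of_mulVec_single
  intro j
  apply alt_injective hm
  rw [← mat4_mul_alt_mul hm, Matrix.one_mulVec]
  simp [mat4]

lemma mat4_mul (M N : SU22) : mat4 (M * N) = mat4 M * mat4 N := rfl

lemma mat4_one : mat4 1 = 1 := rfl

lemma tilde_mul {m : ℕ} (hm : m ≠ 0) (M N : SU22) :
    tilde m (M * N) = tilde m M * tilde m N := by
  apply Matrix.ext_of_mulVec_single
  intro j
  apply alt_injective hm
  rw [← Matrix.mulVec_mulVec, ← mat4_mul_alt_mul hm, ← mat4_mul_alt_mul hm,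
    ← mat4_mul_alt_mul hm, mat4_mul, Matrix.transpose_mul]
  simp only [Matrix.mul_assoc]

/-! ### Hodge duality, the real structure and the invariant form -/

/-- The dual of an alternating `4 × 4` matrix. -/
def hodge (X : Matrix I4 I4 ℂ) : Matrix I4 I4 ℂ :=
  Matrix.fromBlocks !![0, X (.inr 0) (.inr 1); -X (.inr 0) (.inr 1), 0]
    !![-X (.inl 1) (.inr 1), X (.inl 1) (.inr 0); X (.inl 0) (.inr 1), -X (.inl 0) (.inr 0)]
    !![X (.inl 1) (.inr 1), -X (.inl 0) (.inr 1); -X (.inl 1) (.inr 0), X (.inl 0) (.inr 0)]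
    !![0, X (.inl 0) (.inl 1); -X (.inl 0) (.inl 1), 0]

/-- Laplace expansion along the first two rows, by complementary `2 × 2` minors. -/
lemma det_I4 (M : Matrix I4 I4 ℂ) : M.det =
    (M (.inl 0) (.inl 0) * M (.inl 1) (.inl 1) - M (.inl 0) (.inl 1) * M (.inl 1) (.inl 0)) *
      (M (.inr 0) (.inr 0) * M (.inr 1) (.inr 1) - M (.inr 0) (.inr 1) * M (.inr 1) (.inr 0)) -
    (M (.inl 0) (.inl 0) * M (.inl 1) (.inr 0) - M (.inl 0) (.inr 0) * M (.inl 1) (.inl 0)) *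
      (M (.inr 0) (.inl 1) * M (.inr 1) (.inr 1) - M (.inr 0) (.inr 1) * M (.inr 1) (.inl 1)) +
    (M (.inl 0) (.inl 0) * M (.inl 1) (.inr 1) - M (.inl 0) (.inr 1) * M (.inl 1) (.inl 0)) *
      (M (.inr 0) (.inl 1) * M (.inr 1) (.inr 0) - M (.inr 0) (.inr 0) * M (.inr 1) (.inl 1)) +
    (M (.inl 0) (.inl 1) * M (.inl 1) (.inr 0) - M (.inl 0) (.inr 0) * M (.inl 1) (.inl 1)) *
      (M (.inr 0) (.inl 0) * M (.inr 1) (.inr 1) - M (.inr 0) (.inr 1) * M (.inr 1) (.inl 0)) -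
    (M (.inl 0) (.inl 1) * M (.inl 1) (.inr 1) - M (.inl 0) (.inr 1) * M (.inl 1) (.inl 1)) *
      (M (.inr 0) (.inl 0) * M (.inr 1) (.inr 0) - M (.inr 0) (.inr 0) * M (.inr 1) (.inl 0)) +
    (M (.inl 0) (.inr 0) * M (.inl 1) (.inr 1) - M (.inl 0) (.inr 1) * M (.inl 1) (.inr 0)) *
      (M (.inr 0) (.inl 0) * M (.inr 1) (.inl 1) - M (.inr 0) (.inl 1) * M (.inr 1) (.inl 0)) := by
  rw [← Matrix.det_submatrix_equiv_self finSumFinEquiv.symm, Matrix.det_succ_row_zero]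
  have e0 : (finSumFinEquiv (m := 2) (n := 2)).symm 0 = .inl 0 := rfl
  have e1 : (finSumFinEquiv (m := 2) (n := 2)).symm 1 = .inl 1 := rfl
  have e2 : (finSumFinEquiv (m := 2) (n := 2)).symm 2 = .inr 0 := rfl
  have e3 : (finSumFinEquiv (m := 2) (n := 2)).symm 3 = .inr 1 := rfl
  simp [Fin.sum_univ_succ, Matrix.det_fin_three, Fin.succAbove, e0, e1, e2, e3]
  ring

lemma hodge_altBlock (x y : ℂ) (Z : Matrix (Fin 2) (Fin 2) ℂ) :
    hodge (altBlock x Z y) = altBlock (-y) !![-Z 1 1, Z 1 0; Z 0 1, -Z 0 0] (-x) := by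
  unfold hodge altBlock
  congr 1 <;> ext i j <;> fin_cases i <;> fin_cases j <;> simp

set_option maxHeartbeats 4000000 in
-- The wedge pairing takes values in `Λ⁴`, on which `M` acts by `det M`; therefore the dual
-- transforms contragrediently up to that factor. Clearing inverses makes it a polynomial identity
-- valid for every `M`.
lemma transpose_mul_hodge_mul (M : Matrix I4 I4 ℂ) (x y : ℂ) (Z : Matrix (Fin 2) (Fin 2) ℂ) :
    Mᵀ * hodge (M * altBlock x Z y * Mᵀ) * M = M.det • hodge (altBlock x Z y) := by
  rw [det_I4]
  ext i j
  rcases i with i | i <;> rcases j with j | j <;> fin_cases i <;> fin_cases j <;>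
    simp [hodge, altBlock, Matrix.mul_apply, Fintype.sum_sum_type, Fin.sum_univ_two] <;> ring

lemma mat4_unitary (M : SU22) :
    (mat4 M)ᴴ * Matrix.J (Fin 2) ℂ * mat4 M = Matrix.J (Fin 2) ℂ := M.2

lemma mat4_det (M : SU22) : (mat4 M).det = 1 := M.1.2

lemma J_mul_J : Matrix.J (Fin 2) ℂ * Matrix.J (Fin 2) ℂ = -1 := by
  simpa using Matrix.J_squared (Fin 2) ℂ

lemma J_transpose : (Matrix.J (Fin 2) ℂ)ᵀ = -Matrix.J (Fin 2) ℂ := Matrix.J_transpose (Fin 2) ℂ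

lemma left_inverse_mat4 (M : SU22) :
    -(Matrix.J (Fin 2) ℂ * (mat4 M)ᴴ * Matrix.J (Fin 2) ℂ) * mat4 M = 1 := by
  have : Matrix.J (Fin 2) ℂ * (mat4 M)ᴴ * Matrix.J (Fin 2) ℂ * mat4 M
      = Matrix.J (Fin 2) ℂ * ((mat4 M)ᴴ * Matrix.J (Fin 2) ℂ * mat4 M) := by
    simp only [Matrix.mul_assoc]
  rw [Matrix.neg_mul, this, mat4_unitary, J_mul_J, neg_neg]

lemma right_inverse_mat4 (M : SU22) :
    mat4 M * -(Matrix.J (Fin 2) ℂ * (mat4 M)ᴴ * Matrix.J (Fin 2) ℂ) = 1 :=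
  mul_eq_one_comm.mp (left_inverse_mat4 M)

lemma mat4_unitary' (M : SU22) :
    mat4 M * Matrix.J (Fin 2) ℂ * (mat4 M)ᴴ = Matrix.J (Fin 2) ℂ := by
  have h := congrArg (· * Matrix.J (Fin 2) ℂ) (right_inverse_mat4 M)
  simp only [Matrix.one_mul, Matrix.mul_neg, Matrix.neg_mul, Matrix.mul_assoc, J_mul_J] at h
  simpa [Matrix.mul_assoc] using h

lemma mat4_inv (M : SU22) :
    mat4 M⁻¹ = -(Matrix.J (Fin 2) ℂ * (mat4 M)ᴴ * Matrix.J (Fin 2) ℂ) := by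
  have h : mat4 M⁻¹ * mat4 M = 1 := by rw [← mat4_mul, inv_mul_cancel, mat4_one]
  calc mat4 M⁻¹ = mat4 M⁻¹ * (mat4 M * -(Matrix.J (Fin 2) ℂ * (mat4 M)ᴴ * Matrix.J (Fin 2) ℂ)) := by
        rw [right_inverse_mat4, Matrix.mul_one]
    _ = _ := by rw [← Matrix.mul_assoc, h, Matrix.one_mul]

lemma J_mul_altBlock_mul (x y : ℂ) (Z : Matrix (Fin 2) (Fin 2) ℂ) :
    Matrix.J (Fin 2) ℂ * altBlock x Z y * (Matrix.J (Fin 2) ℂ)ᵀ =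
      altBlock (-y) !![-Z 1 1, Z 0 1; Z 1 0, -Z 0 0] (-x) := by
  rw [J_transpose, altBlock, altBlock, Matrix.J, Matrix.fromBlocks_multiply,
    Matrix.fromBlocks_neg, Matrix.fromBlocks_multiply]
  congr 1 <;> ext i j <;> fin_cases i <;> fin_cases j <;> simp

lemma altBlock_map_conj (x y : ℂ) (Z : Matrix (Fin 2) (Fin 2) ℂ) :
    (altBlock x Z y).map (starRingEnd ℂ) =
      altBlock (starRingEnd ℂ x) (Z.map (starRingEnd ℂ)) (starRingEnd ℂ y) := by
  rw [altBlock, altBlock, Matrix.fromBlocks_map]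
  congr 1 <;> ext i j <;> fin_cases i <;> fin_cases j <;> simp

/-- The antilinear map `X ↦ J (hodge X)‾ Jᵗʳ` sends the coordinates `(x, Z, y)` to `(x̄, Zᴴ, ȳ)`.
Dualising replaces `M` by its contragredient, and conjugation together with `M J Mᴴ = J` turns this
back into `M`, so the map commutes with the action. -/
lemma altBlock_conj {M : SU22} {x y x' y' : ℂ} {Z Z' : Matrix (Fin 2) (Fin 2) ℂ}
    (h : mat4 M * altBlock x Z y * (mat4 M)ᵀ = altBlock x' Z' y') :
    mat4 M * altBlock (starRingEnd ℂ x) Zᴴ (starRingEnd ℂ y) * (mat4 M)ᵀ =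
      altBlock (starRingEnd ℂ x') Z'ᴴ (starRingEnd ℂ y') := by
  have key : ∀ (x y : ℂ) (Z : Matrix (Fin 2) (Fin 2) ℂ),
      altBlock (starRingEnd ℂ x) Zᴴ (starRingEnd ℂ y) =
      Matrix.J (Fin 2) ℂ * (hodge (altBlock x Z y)).map (starRingEnd ℂ) *
        (Matrix.J (Fin 2) ℂ)ᵀ := by
    intro x y Z
    rw [hodge_altBlock, altBlock_map_conj, J_mul_altBlock_mul]
    congr 1
    · simp
    · ext i j; fin_cases i <;> fin_cases j <;> simp
    · simp
  have h1 := transpose_mul_hodge_mul (mat4 M) x y Z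
  rw [h, mat4_det, one_smul] at h1
  rw [key, key, ← h1, Matrix.map_mul, Matrix.map_mul]
  have hM : (mat4 M)ᵀ.map (starRingEnd ℂ) = (mat4 M)ᴴ := rfl
  have hM' : (mat4 M).map (starRingEnd ℂ) * (Matrix.J (Fin 2) ℂ)ᵀ * (mat4 M)ᵀ
      = (Matrix.J (Fin 2) ℂ)ᵀ := by
    have := congrArg Matrix.transpose (mat4_unitary' M)
    simp only [Matrix.transpose_mul, Matrix.conjTranspose, Matrix.transpose_map,
      Matrix.transpose_transpose] at this
    rw [Matrix.mul_assoc]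
    exact this
  rw [hM]
  calc _ = (mat4 M * Matrix.J (Fin 2) ℂ * (mat4 M)ᴴ) *
        (hodge (altBlock x' Z' y')).map (starRingEnd ℂ) *
        ((mat4 M).map (starRingEnd ℂ) * (Matrix.J (Fin 2) ℂ)ᵀ * (mat4 M)ᵀ) := by
        simp only [Matrix.mul_assoc]
    _ = _ := by rw [mat4_unitary', hM']

lemma ofCoord_conj (m : ℕ) (z : Fin 4 → ℂ) :
    ofCoord m (fun j => starRingEnd ℂ (z j)) = (ofCoord m z)ᴴ := by
  ext i j
  fin_cases i <;> fin_cases j <;> simp [ofCoord]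

lemma alt_conj (m : ℕ) (v : Fin 6 → ℂ) :
    alt m (fun j => starRingEnd ℂ (v j)) =
      altBlock (starRingEnd ℂ (v 0)) (ofCoord m fun j => v (mid j))ᴴ (starRingEnd ℂ (v 5)) := by
  rw [alt, ofCoord_conj]

/-- The real `6 × 6` matrix of real parts of `M̃`. -/
def tildeRe (m : ℕ) (M : SU22) : Matrix (Fin 6) (Fin 6) ℝ := (tilde m M).map Complex.re

lemma tilde_mulVec_conj {m : ℕ} (hm : m ≠ 0) (M : SU22) (v : Fin 6 → ℂ) :
    tilde m M *ᵥ (fun j => starRingEnd ℂ (v j)) =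
      fun j => starRingEnd ℂ ((tilde m M *ᵥ v) j) := by
  apply alt_injective hm
  rw [← mat4_mul_alt_mul hm, alt_conj, alt_conj]
  exact altBlock_conj (mat4_mul_alt_mul hm M v)

lemma map_tildeRe {m : ℕ} (hm : m ≠ 0) (M : SU22) :
    (tildeRe m M).map (fun x : ℝ => (x : ℂ)) = tilde m M := by
  ext i j
  have h := congrFun (tilde_mulVec_conj hm M (Pi.single j 1)) i
  have e : (fun k => starRingEnd ℂ ((Pi.single j 1 : Fin 6 → ℂ) k)) = Pi.single j 1 := by
    ext k
    rcases eq_or_ne k j with rfl | hk <;> simp [*]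
  rw [e, Matrix.mulVec_single_one] at h
  exact Complex.conj_eq_iff_re.mp h.symm

lemma tildeRe_one {m : ℕ} (hm : m ≠ 0) : tildeRe m 1 = 1 := by
  rw [tildeRe, tilde_one hm]
  ext i j
  rcases eq_or_ne i j with rfl | h <;> simp [*]

lemma ofReal_map_injective {n : Type*} :
    Function.Injective fun N : Matrix n n ℝ => N.map (fun x : ℝ => (x : ℂ)) :=
  Matrix.map_injective Complex.ofReal_injective

lemma tildeRe_mul {m : ℕ} (hm : m ≠ 0) (M N : SU22) :
    tildeRe m (M * N) = tildeRe m M * tildeRe m N := by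
  apply ofReal_map_injective
  change _ = (tildeRe m M * tildeRe m N).map Complex.ofRealHom
  rw [Matrix.map_mul]
  change _ = (tildeRe m M).map (fun x : ℝ => (x : ℂ)) * (tildeRe m N).map (fun x : ℝ => (x : ℂ))
  simp only [map_tildeRe hm, tilde_mul hm]

/-- The action of `M` on the alternating matrices of real vectors. -/
lemma mat4_mul_alt_ofReal_mul {m : ℕ} (hm : m ≠ 0) (M : SU22) (v : Fin 6 → ℝ) :
    mat4 M * alt m (fun j => (v j : ℂ)) * (mat4 M)ᵀ =
      alt m (fun j => ((tildeRe m M *ᵥ v) j : ℂ)) := by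
  rw [mat4_mul_alt_mul hm, ← map_tildeRe hm]
  congr 1
  ext i
  simp [Matrix.mulVec, dotProduct]

/-- The complexification of `S₁`. -/
def S1C (m : ℕ) : Matrix (Fin 6) (Fin 6) ℂ := (S1 m).map Complex.ofRealHom

/-- Identifies the wedge pairing with twice the bilinear form `S₁`; orthogonality of `M̃` follows
from the behaviour of `hodge`. -/
lemma trace_hodge_mul (m : ℕ) (v w : Fin 6 → ℂ) :
    (hodge (alt m v) * alt m w).trace = 2 * (v ⬝ᵥ (S1C m *ᵥ w)) := by
  rw [alt, hodge_altBlock, alt]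
  simp only [altBlock, Matrix.fromBlocks_multiply, Matrix.trace, Fintype.sum_sum_type,
    Fin.sum_univ_two, Matrix.diag_apply, Matrix.fromBlocks_apply₁₁, Matrix.fromBlocks_apply₂₂]
  simp [S1C, S1, block6, S0, S, Matrix.mulVec, dotProduct, Fin.sum_univ_succ, mid, ofCoord,
    two_re_omega, Complex.normSq_eq_conj_mul_self]
  ring

lemma tilde_preserves {m : ℕ} (hm : m ≠ 0) (M : SU22) :
    (tilde m M)ᵀ * S1C m * tilde m M = S1C m := by
  have key : ∀ v w : Fin 6 → ℂ,
      (tilde m M *ᵥ v) ⬝ᵥ (S1C m *ᵥ (tilde m M *ᵥ w)) = v ⬝ᵥ (S1C m *ᵥ w) := by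
    intro v w
    have h : (2 : ℂ) ≠ 0 := two_ne_zero
    apply mul_left_cancel₀ h
    rw [← trace_hodge_mul, ← trace_hodge_mul, ← mat4_mul_alt_mul hm, ← mat4_mul_alt_mul hm]
    have e := transpose_mul_hodge_mul (mat4 M) (v 0) (v 5) (ofCoord m fun j => v (mid j))
    rw [mat4_det, one_smul] at e
    change (mat4 M)ᵀ * hodge (mat4 M * alt m v * (mat4 M)ᵀ) * mat4 M = hodge (alt m v) at e
    rw [← e, ← Matrix.mul_assoc, Matrix.trace_mul_comm]
    simp only [Matrix.mul_assoc]
  ext i j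
  have := key (Pi.single i 1) (Pi.single j 1)
  rw [Matrix.mulVec_mulVec, Matrix.mulVec_single_one, Matrix.mulVec_single_one,
    Matrix.mulVec_single_one] at this
  rw [single_one_dotProduct] at this
  rw [Matrix.mul_assoc]
  exact this

lemma tildeRe_preserves {m : ℕ} (hm : m ≠ 0) (M : SU22) :
    (tildeRe m M)ᵀ * S1 m * tildeRe m M = S1 m := by
  apply Matrix.map_injective (f := Complex.ofRealHom) Complex.ofReal_injective
  simp only [Matrix.map_mul]
  have h := map_tildeRe hm M
  change (tildeRe m M).map Complex.ofRealHom = _ at h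
  rw [Matrix.transpose_map, h]
  exact tilde_preserves hm M

lemma altBlock_inj {x y x' y' : ℂ} {Z Z' : Matrix (Fin 2) (Fin 2) ℂ}
    (h : altBlock x Z y = altBlock x' Z' y') : x = x' ∧ Z = Z' ∧ y = y' := by
  have e := fun i j => congrFun (congrFun h i) j
  refine ⟨by simpa [altBlock] using e (.inl 1) (.inl 0), ?_,
    by simpa [altBlock] using e (.inr 0) (.inr 1)⟩
  ext i j
  fin_cases i <;> fin_cases j
  · simpa [altBlock] using e (.inl 0) (.inr 1)
  · simpa [altBlock] using e (.inr 0) (.inl 0)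
  · simpa [altBlock] using e (.inl 1) (.inr 1)
  · simpa [altBlock] using e (.inr 0) (.inl 1)

lemma tilde_mulVec {m : ℕ} (hm : m ≠ 0) (M : SU22) (v : Fin 6 → ℂ) :
    (tilde m M *ᵥ v) 0 = (blkA M).det * v 0
      - (((blkA M).adjugate * blkB M).adjugate * ofCoord m fun j => v (mid j)).trace
      - (blkB M).det * v 5 ∧
    ofCoord m (fun j => (tilde m M *ᵥ v) (mid j)) = -v 0 • (blkA M * (blkC M).adjugate)
      + (blkA M * ofCoord m (fun j => v (mid j)) * (blkD M).adjugate
        + blkB M * (ofCoord m fun j => v (mid j)).adjugate * (blkC M).adjugate)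
      + v 5 • (blkB M * (blkD M).adjugate) ∧
    (tilde m M *ᵥ v) 5 = -(blkC M).det * v 0
      + (((blkC M).adjugate * blkD M).adjugate * ofCoord m fun j => v (mid j)).trace
      + (blkD M).det * v 5 := by
  have h := mat4_mul_alt_mul hm M v
  rw [mat4_eq_fromBlocks, alt, altBlock_congr, alt] at h
  obtain ⟨h0, h1, h2⟩ := altBlock_inj h
  exact ⟨h0.symm, h1.symm, h2.symm⟩

/-! ### Block relations and the half-space -/

lemma quad_eq (m : ℕ) (z : Fin 4 → ℂ) : quad m z = 2 * (ofCoord m z).det := by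
  rw [quad, Matrix.dotProduct_mulVec, vecMul_S0C_dotProduct, Matrix.adjugate_mul]
  rw [Matrix.trace_smul, Matrix.trace_one, smul_eq_mul, mul_comm]
  simp

lemma blocks_unitary (M : SU22) :
    (blkA M)ᴴ * blkC M = (blkC M)ᴴ * blkA M ∧ (blkB M)ᴴ * blkD M = (blkD M)ᴴ * blkB M ∧
    (blkA M)ᴴ * blkD M - (blkC M)ᴴ * blkB M = 1 := by
  have h := mat4_unitary M
  rw [mat4_eq_fromBlocks, Matrix.fromBlocks_conjTranspose, Matrix.J, Matrix.fromBlocks_multiply,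
    Matrix.fromBlocks_multiply, Matrix.fromBlocks_inj] at h
  simp only [Matrix.mul_zero, Matrix.mul_one, zero_add, add_zero, Matrix.mul_neg,
    Matrix.neg_mul] at h
  obtain ⟨h1, h2, -, h4⟩ := h
  refine ⟨?_, ?_, ?_⟩
  · rw [← sub_eq_add_neg, sub_eq_zero] at h1; exact h1.symm
  · rw [← sub_eq_add_neg, sub_eq_zero] at h4; exact h4.symm
  · rw [← neg_inj, ← h2]; abel

lemma blocks_unitary' (M : SU22) : blkC M * (blkD M)ᴴ = blkD M * (blkC M)ᴴ := by
  have h := mat4_unitary' M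
  rw [mat4_eq_fromBlocks, Matrix.fromBlocks_conjTranspose, Matrix.J, Matrix.fromBlocks_multiply,
    Matrix.fromBlocks_multiply, Matrix.fromBlocks_inj] at h
  simp only [Matrix.mul_zero, Matrix.mul_one, zero_add, add_zero, Matrix.mul_neg,
    Matrix.neg_mul] at h
  obtain ⟨-, -, -, h4⟩ := h
  rw [← sub_eq_add_neg, sub_eq_zero] at h4; exact h4.symm

/-- The unitary relations give `(AZ+B)ᴴ(CZ+D) - (CZ+D)ᴴ(AZ+B) = Zᴴ - Z`. Evaluated at a null vector
`w` of `CZ+D` the left side vanishes, contradicting positivity of the imaginary part of `Z`. -/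
lemma det_ne_zero_of_mem_H2 (M : SU22) {Z : Matrix (Fin 2) (Fin 2) ℂ} (hZ : Z ∈ H2) :
    (blkC M * Z + blkD M).det ≠ 0 := by
  intro h
  obtain ⟨w, hw, h0⟩ := Matrix.exists_mulVec_eq_zero_iff.mpr h
  obtain ⟨h1, h2, h3⟩ := blocks_unitary M
  have key : (blkA M * Z + blkB M)ᴴ * (blkC M * Z + blkD M)
      - (blkC M * Z + blkD M)ᴴ * (blkA M * Z + blkB M) = Zᴴ - Z := by
    have h3' : (blkD M)ᴴ * blkA M - (blkB M)ᴴ * blkC M = 1 := by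
      have := congrArg Matrix.conjTranspose h3
      simpa using this
    calc _ = Zᴴ * ((blkA M)ᴴ * blkC M - (blkC M)ᴴ * blkA M) * Z
          + ((blkB M)ᴴ * blkD M - (blkD M)ᴴ * blkB M)
          + Zᴴ * ((blkA M)ᴴ * blkD M - (blkC M)ᴴ * blkB M)
          - ((blkD M)ᴴ * blkA M - (blkB M)ᴴ * blkC M) * Z := by
            simp only [Matrix.conjTranspose_add, Matrix.conjTranspose_mul]
            noncomm_ring
      _ = _ := by rw [h1, h2, h3, h3', sub_self, sub_self]; simp
  have h4 : star w ⬝ᵥ ((Zᴴ - Z) *ᵥ w) = 0 := by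
    rw [← key, Matrix.sub_mulVec, ← Matrix.mulVec_mulVec, ← Matrix.mulVec_mulVec, h0,
      Matrix.mulVec_zero, zero_sub, dotProduct_neg, Matrix.dotProduct_mulVec, ← Matrix.star_mulVec,
      h0]
    simp
  have h5 := hZ.dotProduct_mulVec_pos hw
  rw [Matrix.smul_mulVec, ← neg_sub, Matrix.neg_mulVec, dotProduct_smul, dotProduct_neg, h4] at h5
  simp at h5

/-! ### Generation of `SU(2,2)` by unipotent elements -/

/-- The matrix `(1 X; 0 1)` for Hermitian `X`. -/
def upper (X : Matrix (Fin 2) (Fin 2) ℂ) (hX : Xᴴ = X) : SU22 :=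
  ⟨⟨Matrix.fromBlocks 1 X 0 1, by simp⟩, by
    change (Matrix.fromBlocks 1 X 0 1)ᴴ * _ * Matrix.fromBlocks 1 X 0 1 = _
    rw [Matrix.fromBlocks_conjTranspose, Matrix.J, Matrix.fromBlocks_multiply,
      Matrix.fromBlocks_multiply]
    simp [hX]⟩

/-- The matrix `(1 0; X 1)` for Hermitian `X`. -/
def lower (X : Matrix (Fin 2) (Fin 2) ℂ) (hX : Xᴴ = X) : SU22 :=
  ⟨⟨Matrix.fromBlocks 1 0 X 1, by simp⟩, by
    change (Matrix.fromBlocks 1 0 X 1)ᴴ * _ * Matrix.fromBlocks 1 0 X 1 = _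
    rw [Matrix.fromBlocks_conjTranspose, Matrix.J, Matrix.fromBlocks_multiply,
      Matrix.fromBlocks_multiply]
    simp [hX]⟩

lemma mat4_upper (X : Matrix (Fin 2) (Fin 2) ℂ) (hX : Xᴴ = X) :
    mat4 (upper X hX) = Matrix.fromBlocks 1 X 0 1 := rfl

lemma mat4_lower (X : Matrix (Fin 2) (Fin 2) ℂ) (hX : Xᴴ = X) :
    mat4 (lower X hX) = Matrix.fromBlocks 1 0 X 1 := rfl

lemma mat4_injective : Function.Injective mat4 := fun _ _ h => Subtype.ext (Subtype.ext h)

section generation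

/-- The subgroup contains all unipotent block triangular matrices. -/
structure HasUnipotents (G : Subgroup SU22) : Prop where
  upper_mem : ∀ X hX, upper X hX ∈ G
  lower_mem : ∀ X hX, lower X hX ∈ G

variable (G : Subgroup SU22)

/-- `U` occurs as the upper left block of a block diagonal element of `G`. -/
def IsLevi (U : Matrix (Fin 2) (Fin 2) ℂ) : Prop :=
  ∃ V, Uᴴ * V = 1 ∧ ∃ M ∈ G, mat4 M = Matrix.fromBlocks U 0 0 V

variable {G}

lemma IsLevi.mul {U U' : Matrix (Fin 2) (Fin 2) ℂ} (h : IsLevi G U) (h' : IsLevi G U') :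
    IsLevi G (U * U') := by
  obtain ⟨V, hV, M, hM, e⟩ := h
  obtain ⟨V', hV', M', hM', e'⟩ := h'
  refine ⟨V * V', ?_, M * M', G.mul_mem hM hM', ?_⟩
  · rw [Matrix.conjTranspose_mul, Matrix.mul_assoc, ← Matrix.mul_assoc _ V, hV, Matrix.one_mul, hV']
  · rw [mat4_mul, e, e', Matrix.fromBlocks_multiply]
    simp

/-- The `SL₂` identity expressing a Weyl element as upper, lower, upper, here with the Hermitian
matrices `X`, `-X⁻¹`, `X`. -/
lemma exists_weyl (hG : HasUnipotents G) {X Y : Matrix (Fin 2) (Fin 2) ℂ}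
    (hX : Xᴴ = X) (hY : Yᴴ = Y) (h : X * Y = 1) :
    ∃ M ∈ G, mat4 M = Matrix.fromBlocks 0 X (-Y) 0 := by
  refine ⟨upper X hX * lower (-Y) (by simp [hY]) * upper X hX,
    G.mul_mem (G.mul_mem (hG.upper_mem _ _) (hG.lower_mem _ _)) (hG.upper_mem _ _), ?_⟩
  rw [mat4_mul, mat4_mul, mat4_upper, mat4_lower, Matrix.fromBlocks_multiply,
    Matrix.fromBlocks_multiply]
  simp [h, mul_eq_one_comm.mp h]

/-- A product of two Weyl elements is block diagonal. Quotients of invertible Hermitian matrices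
thereby become the building blocks of the Levi part. -/
lemma isLevi_mul_of_hermitian (hG : HasUnipotents G) {X Y X' Y' : Matrix (Fin 2) (Fin 2) ℂ}
    (hX : Xᴴ = X) (hY : Yᴴ = Y)
    (h : X * Y = 1) (hX' : X'ᴴ = X') (hY' : Y'ᴴ = Y') (h' : X' * Y' = 1) :
    IsLevi G (X * Y') := by
  obtain ⟨M, hM, e⟩ := exists_weyl hG hX hY h
  obtain ⟨M', hM', e'⟩ := exists_weyl hG (X := -X') (Y := -Y') (by simp [hX']) (by simp [hY'])
    (by simp [h'])
  refine ⟨Y * X', ?_, M * M', G.mul_mem hM hM', ?_⟩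
  · rw [Matrix.conjTranspose_mul, hX, hY', Matrix.mul_assoc, ← Matrix.mul_assoc X, h,
      Matrix.one_mul, mul_eq_one_comm.mp h']
  · rw [mat4_mul, e, e', Matrix.fromBlocks_multiply]
    simp

lemma isLevi_one (hG : HasUnipotents G) : IsLevi G 1 := by
  simpa using isLevi_mul_of_hermitian hG (X := 1) (Y := 1) (X' := 1) (Y' := 1)
    (by simp) (by simp) (by simp) (by simp) (by simp) (by simp)

lemma isLevi_upper (hG : HasUnipotents G) (x : ℂ) : IsLevi G !![1, x; 0, 1] := by
  rcases eq_or_ne x 0 with rfl | hx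
  · rw [← Matrix.one_fin_two]; exact isLevi_one hG
  have hx' : (starRingEnd ℂ) x ≠ 0 := by simpa using hx
  -- The unipotent is written as a quotient of Hermitian matrices: `(1 x; 0 1) (0 x; x̄ 0) = (x x̄,
  -- x; x̄, 0)`.
  have := isLevi_mul_of_hermitian hG (X := !![x * starRingEnd ℂ x, x; starRingEnd ℂ x, 0])
    (Y := !![0, (starRingEnd ℂ x)⁻¹; x⁻¹, -1]) (X' := !![0, x; starRingEnd ℂ x, 0])
    (Y' := !![0, (starRingEnd ℂ x)⁻¹; x⁻¹, 0])
    (by ext i j; fin_cases i <;> fin_cases j <;> simp [mul_comm])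
    (by ext i j; fin_cases i <;> fin_cases j <;> simp)
    (by ext i j; fin_cases i <;> fin_cases j <;> simp [hx, hx'])
    (by ext i j; fin_cases i <;> fin_cases j <;> simp)
    (by ext i j; fin_cases i <;> fin_cases j <;> simp)
    (by ext i j; fin_cases i <;> fin_cases j <;> simp [hx, hx'])
  convert this using 1
  ext i j; fin_cases i <;> fin_cases j <;> simp [hx, hx']

lemma isLevi_lower (hG : HasUnipotents G) (x : ℂ) : IsLevi G !![1, 0; x, 1] := by
  rcases eq_or_ne x 0 with rfl | hx
  · rw [← Matrix.one_fin_two]; exact isLevi_one hG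
  have hx' : (starRingEnd ℂ) x ≠ 0 := by simpa using hx
  have := isLevi_mul_of_hermitian hG (X := !![0, starRingEnd ℂ x; x, x * starRingEnd ℂ x])
    (Y := !![-1, x⁻¹; (starRingEnd ℂ x)⁻¹, 0]) (X' := !![0, starRingEnd ℂ x; x, 0])
    (Y' := !![0, x⁻¹; (starRingEnd ℂ x)⁻¹, 0])
    (by ext i j; fin_cases i <;> fin_cases j <;> simp [mul_comm])
    (by ext i j; fin_cases i <;> fin_cases j <;> simp)
    (by ext i j; fin_cases i <;> fin_cases j <;> simp [hx, hx'])
    (by ext i j; fin_cases i <;> fin_cases j <;> simp)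
    (by ext i j; fin_cases i <;> fin_cases j <;> simp)
    (by ext i j; fin_cases i <;> fin_cases j <;> simp [hx, hx'])
  convert this using 1
  ext i j; fin_cases i <;> fin_cases j <;> simp [hx, hx']

lemma isLevi_diagonal (hG : HasUnipotents G) {d : ℂ} (hd : d ≠ 0) (hr : starRingEnd ℂ d = d) :
    IsLevi G !![1, 0; 0, d] := by
  have := isLevi_mul_of_hermitian hG (X := !![1, 0; 0, d]) (Y := !![1, 0; 0, d⁻¹])
    (X' := 1) (Y' := 1)
    (by ext i j; fin_cases i <;> fin_cases j <;> simp [hr])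
    (by ext i j; fin_cases i <;> fin_cases j <;> simp [hr])
    (by ext i j; fin_cases i <;> fin_cases j <;> simp [hd])
    (by simp) (by simp) (by simp)
  simpa using this

/-- Gaussian elimination: if `U 1 0 ≠ 0`, then `U` is upper times lower times upper unipotent times
`diag(1, det U)`. If `U 1 0 = 0`, adding the first row to the second reduces to that case. -/
lemma isLevi_of_det (hG : HasUnipotents G) {U : Matrix (Fin 2) (Fin 2) ℂ} (hd : U.det ≠ 0)
    (hr : starRingEnd ℂ U.det = U.det) : IsLevi G U := by
  have main : ∀ U : Matrix (Fin 2) (Fin 2) ℂ, U.det ≠ 0 → starRingEnd ℂ U.det = U.det →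
      U 1 0 ≠ 0 → IsLevi G U := by
    intro U hd hr h
    have := (((isLevi_upper hG ((U 0 0 - 1) / U 1 0)).mul (isLevi_lower hG (U 1 0))).mul
      (isLevi_upper hG ((U 1 1 - U.det) / U 1 0 / U.det))).mul (isLevi_diagonal hG hd hr)
    convert this using 1
    have e := Matrix.det_fin_two U
    generalize U.det = d at *
    ext i j
    fin_cases i <;> fin_cases j <;> simp <;> field_simp <;>
      first | ring1 | linear_combination e
  by_cases h : U 1 0 = 0
  · have h1 : U 0 0 ≠ 0 := by
      intro h0
      simp [Matrix.det_fin_two, h, h0] at hd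
    have e : (!![1, 0; 1, 1] * U).det = U.det := by rw [Matrix.det_mul]; simp [Matrix.det_fin_two]
    have := (isLevi_lower hG (-1)).mul (main (!![1, 0; 1, 1] * U) (by rwa [e]) (by rwa [e])
      (by simpa [Matrix.mul_apply, h] using h1))
    convert this using 1
    ext i j
    fin_cases i <;> fin_cases j <;> simp [Matrix.vecMul, dotProduct]
  · exact main U hd hr h

/-- The matrices `B D⁻¹` and `D⁻¹ C` are Hermitian, so unipotents clear `B` and `C` and leave
`diag(A', D)`. Then `A'ᴴ D = 1` and `det A' · det D = 1` force `det A'` to be real, which is what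
the Levi part requires. -/
lemma mem_of_blkD_invertible (hG : HasUnipotents G) {M : SU22} (hD : (blkD M).det ≠ 0) : M ∈ G := by
  obtain ⟨E, hE⟩ : ∃ E, blkD M * E = 1 :=
    ⟨(blkD M)⁻¹, Matrix.mul_nonsing_inv _ (isUnit_iff_ne_zero.mpr hD)⟩
  have hE' := mul_eq_one_comm.mp hE
  have hEc : Eᴴ * (blkD M)ᴴ = 1 := by rw [← Matrix.conjTranspose_mul, hE, Matrix.conjTranspose_one]
  have hEc' := mul_eq_one_comm.mp hEc
  have hX : (-(blkB M * E))ᴴ = -(blkB M * E) := by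
    rw [Matrix.conjTranspose_neg, Matrix.conjTranspose_mul, neg_inj]
    calc Eᴴ * (blkB M)ᴴ = Eᴴ * ((blkB M)ᴴ * blkD M) * E := by
          rw [← Matrix.mul_assoc, Matrix.mul_assoc _ _ E, hE, Matrix.mul_one]
      _ = blkB M * E := by
          rw [(blocks_unitary M).2.1, ← Matrix.mul_assoc, hEc, Matrix.one_mul]
  have hY : (-(E * blkC M))ᴴ = -(E * blkC M) := by
    rw [Matrix.conjTranspose_neg, Matrix.conjTranspose_mul, neg_inj]
    calc (blkC M)ᴴ * Eᴴ = E * (blkD M * (blkC M)ᴴ) * Eᴴ := by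
          rw [← Matrix.mul_assoc E, hE', Matrix.one_mul]
      _ = E * blkC M := by
          rw [← blocks_unitary' M, Matrix.mul_assoc, Matrix.mul_assoc, hEc', Matrix.mul_one]
  set N := upper _ hX * M * lower _ hY with hN
  have e : mat4 N = Matrix.fromBlocks (blkA M - blkB M * E * blkC M) 0 0 (blkD M) := by
    rw [hN, mat4_mul, mat4_mul, mat4_upper, mat4_lower, mat4_eq_fromBlocks M,
      Matrix.fromBlocks_multiply, Matrix.fromBlocks_multiply]
    simp [Matrix.mul_assoc, hE', hE, ← Matrix.mul_assoc (blkD M), sub_eq_add_neg]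
  have hdet := mat4_det N
  rw [e, Matrix.det_fromBlocks_zero₂₁] at hdet
  have hun := (blocks_unitary N).2.2
  simp only [blkA, blkB, blkC, blkD, e, Matrix.toBlocks_fromBlocks₁₁, Matrix.toBlocks_fromBlocks₁₂,
    Matrix.toBlocks_fromBlocks₂₁, Matrix.toBlocks_fromBlocks₂₂, Matrix.mul_zero, sub_zero] at hun
  change (blkA M - blkB M * E * blkC M)ᴴ * blkD M = 1 at hun
  have hr := congrArg Matrix.det hun
  rw [Matrix.det_mul, Matrix.det_conjTranspose, Matrix.det_one, ← hdet] at hr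
  have hr' := mul_right_cancel₀ hD hr
  have hA : (blkA M - blkB M * E * blkC M).det ≠ 0 := left_ne_zero_of_mul_eq_one hdet
  obtain ⟨V, hV, M', hM', e'⟩ := isLevi_of_det hG hA hr'
  have hVD : V = blkD M := by
    rw [← Matrix.one_mul V, ← mul_eq_one_comm.mp hun, Matrix.mul_assoc, hV, Matrix.mul_one]
  have : N = M' := mat4_injective (by rw [e, e', hVD])
  have hNG : N ∈ G := this ▸ hM'
  rwa [hN, G.mul_mem_cancel_right (hG.lower_mem _ _),
    G.mul_mem_cancel_left (hG.upper_mem _ _)] at hNG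

lemma I_smul_one_mem_H2 : (Complex.I • (1 : Matrix (Fin 2) (Fin 2) ℂ)) ∈ H2 := by
  have : (1 / (2 * Complex.I)) • (Complex.I • (1 : Matrix (Fin 2) (Fin 2) ℂ) -
      (Complex.I • (1 : Matrix (Fin 2) (Fin 2) ℂ))ᴴ) = 1 := by
    rw [Matrix.conjTranspose_smul, Matrix.conjTranspose_one, ← sub_smul, smul_smul]
    have : 1 / (2 * Complex.I) * (Complex.I - star Complex.I) = 1 := by
      have := Complex.I_ne_zero
      simp
      field_simp
      norm_num
    rw [this, one_smul]
  change Matrix.PosDef _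
  rw [this]
  exact Matrix.PosDef.one

/-- `SU(2,2)` is generated by the upper and the lower unipotent block matrices. -/
theorem eq_top_of_unipotent_mem (hG : HasUnipotents G) : G = ⊤ := by
  rw [eq_top_iff]
  intro M _
  have h := det_ne_zero_of_mem_H2 M I_smul_one_mem_H2
  -- `det (tC + D)` is a polynomial in `t` of degree at most two, nonzero at `t = i` because `i · 1`
  -- lies in the half-space; hence it is nonzero at some real `t`.
  have ht : ∃ t : ℝ, (((t : ℂ) • blkC M) + blkD M).det ≠ 0 := by
    by_contra! hc
    apply h
    have h0 := hc 0
    have h1 := hc 1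
    have h2 := hc (-1)
    simp only [Matrix.det_fin_two, Matrix.add_apply, Matrix.smul_apply, smul_eq_mul,
      Matrix.mul_smul, Matrix.mul_one] at *
    push_cast at *
    -- Lagrange interpolation at the nodes `0, 1, -1`, evaluated at `i`.
    linear_combination (1 + Complex.I / 2 * 0 - Complex.I ^ 2) * h0
      + (Complex.I + Complex.I ^ 2) / 2 * h1 + (-Complex.I + Complex.I ^ 2) / 2 * h2
  obtain ⟨t, ht⟩ := ht
  have hX : ((t : ℂ) • (1 : Matrix (Fin 2) (Fin 2) ℂ))ᴴ = (t : ℂ) • 1 := by simp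
  have hD : blkD (M * upper _ hX) = ((t : ℂ) • blkC M) + blkD M := by
    rw [blkD, mat4_mul, mat4_upper, mat4_eq_fromBlocks M, Matrix.fromBlocks_multiply]
    simp
  have := mem_of_blkD_invertible hG (M := M * upper _ hX) (by rwa [hD])
  rwa [G.mul_mem_cancel_right (hG.upper_mem _ _)] at this

end generation

/-! ### Continuity, connectedness and the map into the identity component -/

lemma continuous_mat4 : Continuous mat4 :=
  continuous_subtype_val.comp continuous_subtype_val

lemma continuous_blkA : Continuous blkA :=
  continuous_matrix fun i j => continuous_mat4.matrix_elem (.inl i) (.inl j)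

lemma continuous_blkB : Continuous blkB :=
  continuous_matrix fun i j => continuous_mat4.matrix_elem (.inl i) (.inr j)

lemma continuous_blkC : Continuous blkC :=
  continuous_matrix fun i j => continuous_mat4.matrix_elem (.inr i) (.inl j)

lemma continuous_blkD : Continuous blkD :=
  continuous_matrix fun i j => continuous_mat4.matrix_elem (.inr i) (.inr j)

lemma continuous_coord (m : ℕ) : Continuous (coord m) := by
  refine continuous_pi fun i => ?_
  fin_cases i <;> simp [coord] <;> fun_prop

lemma continuous_tilde {m : ℕ} (hm : m ≠ 0) : Continuous (tilde m) := by
  have hA := continuous_blkA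
  have hB := continuous_blkB
  have hC := continuous_blkC
  have hD := continuous_blkD
  refine continuous_matrix fun i j => ?_
  have e : ∀ M, tilde m M i j = (tilde m M *ᵥ Pi.single j 1) i := by
    intro M; rw [Matrix.mulVec_single_one]; rfl
  simp_rw [e]
  have hmid : ∀ k, Continuous fun M => (tilde m M *ᵥ Pi.single j 1) (mid k) := by
    intro k
    have h : ∀ M, (tilde m M *ᵥ Pi.single j 1) (mid k) = coord m
        (ofCoord m fun l => (tilde m M *ᵥ Pi.single j 1) (mid l)) k := by
      intro M; rw [coord_ofCoord hm]
    simp_rw [h, (tilde_mulVec hm _ _).2.1]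
    refine (continuous_apply k).comp ((continuous_coord m).comp ?_)
    have hD' := hD.matrix_adjugate
    have hC' := hC.matrix_adjugate
    fun_prop
  have h0 : Continuous fun M => (tilde m M *ᵥ Pi.single j 1) 0 := by
    simp_rw [(tilde_mulVec hm _ _).1]
    have h1 := (hA.matrix_adjugate.mul hB).matrix_adjugate
    have h2 := hA.matrix_det
    have h3 := hB.matrix_det
    have h4 := (h1.mul (continuous_const
      (y := ofCoord m fun k => (Pi.single j 1 : Fin 6 → ℂ) (mid k)))).matrix_trace
    fun_prop
  have h5 : Continuous fun M => (tilde m M *ᵥ Pi.single j 1) 5 := by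
    simp_rw [(tilde_mulVec hm _ _).2.2]
    have h1 := (hC.matrix_adjugate.mul hD).matrix_adjugate
    have h2 := hC.matrix_det
    have h3 := hD.matrix_det
    have h4 := (h1.mul (continuous_const
      (y := ofCoord m fun k => (Pi.single j 1 : Fin 6 → ℂ) (mid k)))).matrix_trace
    fun_prop
  fin_cases i
  exacts [h0, hmid 0, hmid 1, hmid 2, hmid 3, h5]

lemma continuous_tildeRe {m : ℕ} (hm : m ≠ 0) : Continuous (tildeRe m) :=
  (continuous_tilde hm).matrix_map Complex.continuous_re

lemma mem_connectedComponentOfOne_of_path {G : Type*} [TopologicalSpace G] [Group G]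
    [IsTopologicalGroup G] (γ : ℝ → G) (hγ : Continuous γ) (h0 : γ 0 = 1) (t : ℝ) :
    γ t ∈ Subgroup.connectedComponentOfOne G := by
  have h : IsPreconnected (Set.range γ) := isPreconnected_range hγ
  exact h.subset_connectedComponent ⟨0, h0⟩ ⟨t, rfl⟩

/-- Each unipotent generator is joined to the identity by scaling its Hermitian block. -/
lemma connectedComponentOfOne_SU22 : Subgroup.connectedComponentOfOne SU22 = ⊤ := by
  have hs : ∀ (X : Matrix (Fin 2) (Fin 2) ℂ), Xᴴ = X → ∀ t : ℝ, ((t : ℂ) • X)ᴴ = (t : ℂ) • X := by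
    intro X hX t; simp [hX]
  refine eq_top_of_unipotent_mem ⟨fun X hX => ?_, fun X hX => ?_⟩
  · have h := mem_connectedComponentOfOne_of_path (fun t : ℝ => upper ((t : ℂ) • X) (hs X hX t))
      (by
        refine Continuous.subtype_mk (Continuous.subtype_mk ?_ _) _
        exact Continuous.matrix_fromBlocks continuous_const (by fun_prop) continuous_const
          continuous_const)
      (mat4_injective (by simp [mat4_upper, mat4_one])) 1
    simpa using h
  · have h := mem_connectedComponentOfOne_of_path (fun t : ℝ => lower ((t : ℂ) • X) (hs X hX t))
      (by
        refine Continuous.subtype_mk (Continuous.subtype_mk ?_ _) _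
        exact Continuous.matrix_fromBlocks continuous_const continuous_const (by fun_prop)
          continuous_const)
      (mat4_injective (by simp [mat4_lower, mat4_one])) 1
    simpa using h

instance preconnectedSpace_SU22 : PreconnectedSpace SU22 := by
  have h : connectedComponent (1 : SU22) = Set.univ := by
    have := congrArg (fun G : Subgroup SU22 => (G : Set SU22)) connectedComponentOfOne_SU22
    exact this
  exact ⟨h ▸ isPreconnected_connectedComponent⟩

lemma det_S1 (m : ℕ) : (S1 m).det = (S m).det := by
  simp [S1, block6, S0, Matrix.det_succ_row_zero, Fin.sum_univ_succ, Fin.succAbove]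
  ring

lemma normSq_omega_sub (m : ℕ) :
    4 * Complex.normSq (omega m) - (2 * (omega m).re) ^ 2 = (2 * (omega m).im) ^ 2 := by
  rw [Complex.normSq_apply]; ring

lemma omega_im_ne_zero {m : ℕ} (hm : m ≠ 0) : (omega m).im ≠ 0 := by
  intro h
  apply diffOmega_ne_zero hm
  rw [diffOmega, Complex.sub_conj, h]
  simp

lemma det_S1_ne_zero {m : ℕ} (hm : m ≠ 0) : (S1 m).det ≠ 0 := by
  rw [det_S1, Matrix.det_fin_two]
  have h := normSq_omega_sub m
  have h' := omega_im_ne_zero hm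
  have : S m 0 0 * S m 1 1 - S m 0 1 * S m 1 0 = (2 * (omega m).im) ^ 2 := by
    rw [← h]; simp [S]; ring
  rw [this]
  positivity

lemma det_sq_eq_one {m : ℕ} (hm : m ≠ 0) {N : Matrix (Fin 6) (Fin 6) ℝ}
    (h : Nᵀ * S1 m * N = S1 m) : N.det ^ 2 = 1 := by
  have e := congrArg Matrix.det h
  rw [Matrix.det_mul, Matrix.det_mul, Matrix.det_transpose] at e
  apply mul_right_cancel₀ (det_S1_ne_zero hm)
  linear_combination e

/-- The determinant is continuous on a connected group, takes only the values `±1`, and is `1` at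
the identity; a value `-1` would force a zero in between. -/
lemma det_tildeRe {m : ℕ} (hm : m ≠ 0) (M : SU22) : (tildeRe m M).det = 1 := by
  have hsq := fun M => det_sq_eq_one hm (tildeRe_preserves hm M)
  rcases mul_self_eq_one_iff.mp ((sq _).symm.trans (hsq M)) with h | h
  · exact h
  · exfalso
    obtain ⟨N, hN⟩ := mem_range_of_exists_le_of_exists_ge
      (f := fun M => (tildeRe m M).det) (continuous_tildeRe hm).matrix_det (c := 0)
      ⟨M, by simp [h]⟩ ⟨1, by simp [tildeRe_one hm]⟩
    have := hsq N
    simp_all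

/-- The homomorphism `M ↦ M̃` into `SO(S₁;ℝ)`. -/
def toSO {m : ℕ} (hm : m ≠ 0) : SU22 →* SO m where
  toFun M := ⟨⟨tildeRe m M, det_tildeRe hm M⟩, tildeRe_preserves hm M⟩
  map_one' := Subtype.ext (Subtype.ext (tildeRe_one hm))
  map_mul' M N := Subtype.ext (Subtype.ext (tildeRe_mul hm M N))

lemma continuous_toSO {m : ℕ} (hm : m ≠ 0) : Continuous (toSO hm) :=
  Continuous.subtype_mk (Continuous.subtype_mk (continuous_tildeRe hm) _) _

lemma toSO_mem_SO0 {m : ℕ} (hm : m ≠ 0) (M : SU22) : toSO hm M ∈ SO0 m := by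
  have h : IsPreconnected (Set.range (toSO hm)) := isPreconnected_range (continuous_toSO hm)
  exact h.subset_connectedComponent ⟨1, map_one _⟩ ⟨M, rfl⟩

/-- The homomorphism `M ↦ M̃` into `SO₀(S₁;ℝ)`. -/
def toSO0 {m : ℕ} (hm : m ≠ 0) : SU22 →* SO0 m :=
  (toSO hm).codRestrict (SO0 m) (toSO_mem_SO0 hm)

lemma mat6_toSO0 {m : ℕ} (hm : m ≠ 0) (M : SU22) : mat6 (toSO0 hm M) = tildeRe m M := rfl

lemma map_mat6_toSO0 {m : ℕ} (hm : m ≠ 0) (M : SU22) :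
    (mat6 (toSO0 hm M)).map (fun x : ℝ => (x : ℂ)) = tilde m M := map_tildeRe hm M

/-! ### The action on the half-space -/

/-- The image of a point of the half-space under the embedding into the quadric. -/
def quadricPoint (m : ℕ) (z : Fin 4 → ℂ) : Fin 6 → ℂ :=
  ![-(ofCoord m z).det, z 0, z 1, z 2, z 3, 1]

/-- Since `S₀[z] = 2 det Z`, the automorphy factor is the last coordinate of the image of the lift
`(-det Z, z, 1)`. -/
lemma factorO_eq {m : ℕ} (hm : m ≠ 0) (M : SU22) (z : Fin 4 → ℂ) :
    factorO (toSO0 hm M) z = (tilde m M *ᵥ quadricPoint m z) 5 := by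
  have e : ∀ i j, ((mat6 (toSO0 hm M) i j : ℝ) : ℂ) = tilde m M i j := by
    intro i j; rw [← map_mat6_toSO0 hm]; rfl
  rw [factorO, quad_eq]
  simp only [e, Matrix.mulVec, dotProduct, Fin.sum_univ_succ, quadricPoint, mid]
  simp
  ring

lemma actO_eq {m : ℕ} (hm : m ≠ 0) (M : SU22) (z : Fin 4 → ℂ) :
    actO (toSO0 hm M) z = (factorO (toSO0 hm M) z)⁻¹ •
      fun i => (tilde m M *ᵥ quadricPoint m z) (mid i) := by
  have e : ∀ i j, ((mat6 (toSO0 hm M) i j : ℝ) : ℂ) = tilde m M i j := by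
    intro i j; rw [← map_mat6_toSO0 hm]; rfl
  ext i
  rw [actO, Pi.smul_apply, smul_eq_mul, quad_eq]
  congr 1
  simp only [e, Matrix.mulVec, dotProduct, Fin.sum_univ_succ, quadricPoint, mid]
  simp
  ring

lemma factorO_toSO0 {m : ℕ} (hm : m ≠ 0) (M : SU22) (Z : Matrix (Fin 2) (Fin 2) ℂ) :
    (blkC M * Z + blkD M).det = factorO (toSO0 hm M) (coord m Z) := by
  rw [factorO_eq, (tilde_mulVec hm _ _).2.2]
  change _ = -(blkC M).det * -(ofCoord m (coord m Z)).det +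
    (((blkC M).adjugate * blkD M).adjugate * ofCoord m (coord m Z)).trace + (blkD M).det * 1
  rw [ofCoord_coord hm]
  simp [Matrix.det_fin_two, Matrix.mul_apply, Matrix.adjugate_fin_two, Matrix.trace_fin_two,
    Matrix.vecMul, dotProduct]
  ring

/-- With `(CZ+D)⁻¹ = det(CZ+D)⁻¹ (CZ+D)♯`, expand `(AZ+B)(Z♯C♯ + D♯)` and use `Z Z♯ = det Z`; the
terms are the middle coordinates of the image of the lift. -/
lemma coord_actH {m : ℕ} (hm : m ≠ 0) (M : SU22) (Z : Matrix (Fin 2) (Fin 2) ℂ) :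
    coord m (actH M Z) = actO (toSO0 hm M) (coord m Z) := by
  apply ofCoord_injective hm
  rw [actO_eq, ofCoord_smul, (tilde_mulVec hm _ _).2.1, ← factorO_toSO0, ofCoord_coord hm]
  change _ = _ • (-(-(ofCoord m (coord m Z)).det) • _ + (_ * ofCoord m (coord m Z) * _ +
    _ * (ofCoord m (coord m Z)).adjugate * _) + (1 : ℂ) • _)
  rw [ofCoord_coord hm, actH, Matrix.inv_def, Ring.inverse_eq_inv', Matrix.mul_smul]
  congr 1
  ext i j
  fin_cases i <;> fin_cases j <;> simp [Matrix.det_fin_two, Matrix.mul_apply,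
    Matrix.adjugate_fin_two] <;> ring

/-! ### Images of Levi, scaling and unipotent elements -/

/-- The Hermitian matrix attached to the middle coordinates of a real vector. -/
def herm (m : ℕ) (v : Fin 6 → ℝ) : Matrix (Fin 2) (Fin 2) ℂ :=
  ofCoord m fun j => (v (mid j) : ℂ)

lemma herm_conjTranspose (m : ℕ) (v : Fin 6 → ℝ) : (herm m v)ᴴ = herm m v := by
  rw [herm, ← ofCoord_conj]
  simp

lemma vec_ext {m : ℕ} (hm : m ≠ 0) {v w : Fin 6 → ℝ} (h0 : v 0 = w 0) (h5 : v 5 = w 5)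
    (h : herm m v = herm m w) : v = w := by
  have e := ofCoord_injective hm h
  have e' : ∀ j, v (mid j) = w (mid j) := fun j => by exact_mod_cast congrFun e j
  ext i
  fin_cases i
  exacts [h0, e' 0, e' 1, e' 2, e' 3, h5]

lemma tildeRe_mulVec {m : ℕ} (hm : m ≠ 0) (M : SU22) (v : Fin 6 → ℝ) :
    (((tildeRe m M *ᵥ v) 0 : ℝ) : ℂ) = (blkA M).det * v 0
      - (((blkA M).adjugate * blkB M).adjugate * herm m v).trace - (blkB M).det * v 5 ∧
    herm m (tildeRe m M *ᵥ v) = -(v 0 : ℂ) • (blkA M * (blkC M).adjugate)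
      + (blkA M * herm m v * (blkD M).adjugate + blkB M * (herm m v).adjugate * (blkC M).adjugate)
      + (v 5 : ℂ) • (blkB M * (blkD M).adjugate) ∧
    (((tildeRe m M *ᵥ v) 5 : ℝ) : ℂ) = -(blkC M).det * v 0
      + (((blkC M).adjugate * blkD M).adjugate * herm m v).trace + (blkD M).det * v 5 := by
  have e : ∀ i, (((tildeRe m M *ᵥ v) i : ℝ) : ℂ) = (tilde m M *ᵥ fun j => (v j : ℂ)) i := by
    intro i
    rw [← map_tildeRe hm]
    simp [Matrix.mulVec, dotProduct]
  unfold herm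
  simp only [e]
  exact tilde_mulVec hm M _

/-- The block diagonal matrix with upper left block `U ∈ SL₂(ℂ)`. -/
def levi (U : Matrix (Fin 2) (Fin 2) ℂ) (hU : U.det = 1) : SU22 :=
  ⟨⟨Matrix.fromBlocks U 0 0 Uᴴ.adjugate, by
      rw [Matrix.det_fromBlocks_zero₂₁, Matrix.det_adjugate, Matrix.det_conjTranspose]
      simp [hU]⟩, by
    have h1 : Uᴴ * Uᴴ.adjugate = 1 := by
      rw [Matrix.mul_adjugate, Matrix.det_conjTranspose, hU]; simp
    have h2 : U.adjugate * U = 1 := by rw [Matrix.adjugate_mul, hU]; simp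
    change (Matrix.fromBlocks U 0 0 Uᴴ.adjugate)ᴴ * _ * Matrix.fromBlocks U 0 0 Uᴴ.adjugate = _
    rw [Matrix.fromBlocks_conjTranspose, Matrix.J, Matrix.fromBlocks_multiply,
      Matrix.fromBlocks_multiply, Matrix.adjugate_conjTranspose]
    simp [h1, h2]⟩

/-- The block diagonal matrix `(s 0; 0 s⁻¹)` for a nonzero real number `s`. -/
def scaling (s : ℂ) (hs : s ≠ 0) (hr : star s = s) : SU22 :=
  ⟨⟨Matrix.fromBlocks (s • 1) 0 0 (s⁻¹ • 1), by
      rw [Matrix.det_fromBlocks_zero₂₁, ← Matrix.det_mul]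
      simp [smul_smul, hs]⟩, by
    change (Matrix.fromBlocks (s • 1) 0 0 (s⁻¹ • 1))ᴴ * _ *
      Matrix.fromBlocks (s • 1) 0 0 (s⁻¹ • 1) = _
    rw [Matrix.fromBlocks_conjTranspose, Matrix.J, Matrix.fromBlocks_multiply,
      Matrix.fromBlocks_multiply]
    simp only [Matrix.conjTranspose_smul, Matrix.conjTranspose_one, star_inv₀, hr]
    simp [smul_smul, hs]⟩

lemma adjugate_adjugate_two (A : Matrix (Fin 2) (Fin 2) ℂ) : A.adjugate.adjugate = A := by
  ext i j
  fin_cases i <;> fin_cases j <;> simp [Matrix.adjugate_fin_two]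

lemma conjTranspose_two (a b c d : ℂ) : (!![a, b; c, d] : Matrix (Fin 2) (Fin 2) ℂ)ᴴ =
    !![starRingEnd ℂ a, starRingEnd ℂ c; starRingEnd ℂ b, starRingEnd ℂ d] := by
  ext i j
  fin_cases i <;> fin_cases j <;> rfl

lemma tildeRe_levi_mulVec {m : ℕ} (hm : m ≠ 0) (U : Matrix (Fin 2) (Fin 2) ℂ) (hU : U.det = 1)
    (v : Fin 6 → ℝ) : (tildeRe m (levi U hU) *ᵥ v) 0 = v 0 ∧
      herm m (tildeRe m (levi U hU) *ᵥ v) = U * herm m v * Uᴴ ∧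
      (tildeRe m (levi U hU) *ᵥ v) 5 = v 5 := by
  obtain ⟨h0, h1, h2⟩ := tildeRe_mulVec hm (levi U hU) v
  have hA : blkA (levi U hU) = U := rfl
  have hB : blkB (levi U hU) = 0 := rfl
  have hC : blkC (levi U hU) = 0 := rfl
  have hD : blkD (levi U hU) = Uᴴ.adjugate := rfl
  have ha : (Uᴴ.adjugate).adjugate = Uᴴ := adjugate_adjugate_two _
  have hd : (Uᴴ.adjugate).det = 1 := by
    rw [Matrix.det_adjugate, Matrix.det_conjTranspose]; simp [hU]
  rw [hA, hB] at h0
  rw [hA, hB, hC, hD, ha] at h1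
  rw [hC, hD, hd] at h2
  refine ⟨?_, ?_, ?_⟩
  · have : (((tildeRe m (levi U hU) *ᵥ v) 0 : ℝ) : ℂ) = v 0 := by simpa [hU] using h0
    exact_mod_cast this
  · simpa using h1
  · have : (((tildeRe m (levi U hU) *ᵥ v) 5 : ℝ) : ℂ) = v 5 := by simpa using h2
    exact_mod_cast this

lemma tildeRe_scaling_mulVec {m : ℕ} (hm : m ≠ 0) (s : ℝ) (hs : (s : ℂ) ≠ 0)
    (hr : star (s : ℂ) = s) (v : Fin 6 → ℝ) :
    (∀ j, (tildeRe m (scaling s hs hr) *ᵥ v) (mid j) = v (mid j)) ∧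
      (tildeRe m (scaling s hs hr) *ᵥ v) 5 = (s ^ 2)⁻¹ * v 5 := by
  obtain ⟨-, h1, h2⟩ := tildeRe_mulVec hm (scaling s hs hr) v
  have hA : blkA (scaling s hs hr) = (s : ℂ) • 1 := rfl
  have hB : blkB (scaling s hs hr) = 0 := rfl
  have hC : blkC (scaling s hs hr) = 0 := rfl
  have hD : blkD (scaling s hs hr) = (s : ℂ)⁻¹ • 1 := rfl
  rw [hA, hB, hC, hD] at h1
  rw [hC, hD, Matrix.det_smul, Fintype.card_fin, Matrix.det_one] at h2
  refine ⟨?_, ?_⟩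
  · have : herm m (tildeRe m (scaling s hs hr) *ᵥ v) = herm m v := by
      rw [h1, Matrix.adjugate_smul, Fintype.card_fin]
      clear h1 h2 hA hB hC hD hr
      generalize (s : ℂ) = t at hs
      simp [smul_smul, hs]
    intro j
    exact_mod_cast congrFun (ofCoord_injective hm this) j
  · have : (((tildeRe m (scaling s hs hr) *ᵥ v) 5 : ℝ) : ℂ) = ((s ^ 2)⁻¹ * v 5 : ℝ) := by
      rw [h2]
      simp
    exact_mod_cast this

lemma tildeRe_upper_mulVec {m : ℕ} (hm : m ≠ 0) (w v : Fin 6 → ℝ) :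
    (∀ j, (tildeRe m (upper (herm m w) (herm_conjTranspose m w)) *ᵥ v) (mid j) =
      v (mid j) + v 5 * w (mid j)) ∧
      (tildeRe m (upper (herm m w) (herm_conjTranspose m w)) *ᵥ v) 5 = v 5 := by
  set M := upper (herm m w) (herm_conjTranspose m w)
  obtain ⟨-, h1, h2⟩ := tildeRe_mulVec hm M v
  have hA : blkA M = 1 := rfl
  have hB : blkB M = herm m w := rfl
  have hC : blkC M = 0 := rfl
  have hD : blkD M = 1 := rfl
  rw [hA, hB, hC, hD] at h1
  rw [hC, hD] at h2
  refine ⟨?_, ?_⟩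
  · have : herm m (tildeRe m M *ᵥ v) = herm m v + (v 5 : ℂ) • herm m w := by simpa using h1
    rw [herm, herm, herm, ← ofCoord_smul, ← ofCoord_add] at this
    intro j
    have e := congrFun (ofCoord_injective hm this) j
    simp only [Pi.add_apply, Pi.smul_apply, smul_eq_mul] at e
    exact_mod_cast e
  · have : (((tildeRe m M *ᵥ v) 5 : ℝ) : ℂ) = v 5 := by simpa using h2
    exact_mod_cast this

lemma herm_adjugate_conjTranspose (m : ℕ) (v : Fin 6 → ℝ) :
    ((herm m v).adjugate)ᴴ = (herm m v).adjugate := by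
  rw [Matrix.adjugate_conjTranspose, herm_conjTranspose]

/-- The block is taken as an adjugate because the first column of `M̃` involves `A C♯` and `♯` is an
involution; the translation is then by `w` itself. -/
lemma tildeRe_lower_mulVec {m : ℕ} (hm : m ≠ 0) (w v : Fin 6 → ℝ) :
    (tildeRe m (lower (herm m w).adjugate (herm_adjugate_conjTranspose m w)) *ᵥ v) 0 = v 0 ∧
    (∀ j, (tildeRe m (lower (herm m w).adjugate (herm_adjugate_conjTranspose m w)) *ᵥ v) (mid j) =
      v (mid j) - v 0 * w (mid j)) := by
  set M := lower (herm m w).adjugate (herm_adjugate_conjTranspose m w)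
  obtain ⟨h0, h1, -⟩ := tildeRe_mulVec hm M v
  have hA : blkA M = 1 := rfl
  have hB : blkB M = 0 := rfl
  have hC : blkC M = (herm m w).adjugate := rfl
  have hD : blkD M = 1 := rfl
  have ha : ((herm m w).adjugate).adjugate = herm m w := adjugate_adjugate_two _
  rw [hA, hB] at h0
  rw [hA, hB, hC, hD, ha] at h1
  refine ⟨?_, ?_⟩
  · have : (((tildeRe m M *ᵥ v) 0 : ℝ) : ℂ) = v 0 := by simpa using h0
    exact_mod_cast this
  · have : herm m (tildeRe m M *ᵥ v) = (-(v 0 : ℂ)) • herm m w + herm m v := by simpa using h1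
    rw [herm, herm, herm, ← ofCoord_smul, ← ofCoord_add] at this
    intro j
    have e := congrFun (ofCoord_injective hm this) j
    simp only [Pi.add_apply, Pi.smul_apply, smul_eq_mul] at e
    have e' : (tildeRe m M *ᵥ v) (mid j) = -v 0 * w (mid j) + v (mid j) := by exact_mod_cast e
    rw [e']
    ring

lemma dotProduct_S1_mulVec (m : ℕ) (v w : Fin 6 → ℝ) : v ⬝ᵥ (S1 m *ᵥ w) =
    v 0 * w 5 + v 5 * w 0 + v 1 * w 4 + v 4 * w 1 - 2 * v 2 * w 2
      - 2 * (omega m).re * (v 2 * w 3 + v 3 * w 2)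
      - 2 * Complex.normSq (omega m) * (v 3 * w 3) := by
  simp [S1, block6, S0, S, Matrix.mulVec, dotProduct, Fin.sum_univ_succ]
  ring

lemma form_mulVec {m : ℕ} {N : Matrix (Fin 6) (Fin 6) ℝ} (h : Nᵀ * S1 m * N = S1 m)
    (v w : Fin 6 → ℝ) : (N *ᵥ v) ⬝ᵥ (S1 m *ᵥ (N *ᵥ w)) = v ⬝ᵥ (S1 m *ᵥ w) := by
  conv_rhs => rw [← h]
  rw [← Matrix.mulVec_mulVec, ← Matrix.mulVec_mulVec, Matrix.dotProduct_mulVec v,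
    Matrix.vecMul_transpose]

lemma preserves_mul {m : ℕ} {N P : Matrix (Fin 6) (Fin 6) ℝ} (hN : Nᵀ * S1 m * N = S1 m)
    (hP : Pᵀ * S1 m * P = S1 m) : (N * P)ᵀ * S1 m * (N * P) = S1 m := by
  calc _ = Pᵀ * (Nᵀ * S1 m * N) * P := by simp only [Matrix.transpose_mul, Matrix.mul_assoc]
    _ = _ := by rw [hN, hP]

/-- A real matrix lies in the image of `M ↦ M̃`. -/
def InImage (m : ℕ) (N : Matrix (Fin 6) (Fin 6) ℝ) : Prop := ∃ M, tildeRe m M = N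

lemma InImage.of_mul {m : ℕ} (hm : m ≠ 0) (M : SU22) {N : Matrix (Fin 6) (Fin 6) ℝ}
    (h : InImage m (tildeRe m M * N)) : InImage m N := by
  obtain ⟨M', e⟩ := h
  refine ⟨M⁻¹ * M', ?_⟩
  rw [tildeRe_mul hm, e, ← Matrix.mul_assoc, ← tildeRe_mul hm, inv_mul_cancel, tildeRe_one hm,
    Matrix.one_mul]

/-- The standard basis vector. -/
def e6 (j i : Fin 6) : ℝ := if i = j then 1 else 0

lemma e6_eq (j : Fin 6) : e6 j = Pi.single j 1 := by
  ext i
  rw [e6, Pi.single_apply]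

lemma mulVec_e6 (N : Matrix (Fin 6) (Fin 6) ℝ) (i j : Fin 6) : (N *ᵥ e6 j) i = N i j := by
  rw [e6_eq, Matrix.mulVec_single_one]; rfl

/-! ### Reduction to the identity through successive stabilisers -/

section stabilizer

variable {m : ℕ} {N : Matrix (Fin 6) (Fin 6) ℝ}

lemma apply_zero_of_fix (hN : Nᵀ * S1 m * N = S1 m) (h : N *ᵥ e6 5 = e6 5) (v : Fin 6 → ℝ) :
    (N *ᵥ v) 0 = v 0 := by
  have := form_mulVec hN v (e6 5)
  rw [h, dotProduct_S1_mulVec, dotProduct_S1_mulVec] at this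
  simpa [e6] using this

lemma apply_five_of_fix (hN : Nᵀ * S1 m * N = S1 m) (h : N *ᵥ e6 0 = e6 0) (v : Fin 6 → ℝ) :
    (N *ᵥ v) 5 = v 5 := by
  have := form_mulVec hN v (e6 0)
  rw [h, dotProduct_S1_mulVec, dotProduct_S1_mulVec] at this
  simpa [e6] using this

lemma apply_one_of_fix (hN : Nᵀ * S1 m * N = S1 m) (h : N *ᵥ e6 4 = e6 4) (v : Fin 6 → ℝ) :
    (N *ᵥ v) 1 = v 1 := by
  have := form_mulVec hN v (e6 4)
  rw [h, dotProduct_S1_mulVec, dotProduct_S1_mulVec] at this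
  simpa [e6] using this

lemma apply_four_of_fix (hN : Nᵀ * S1 m * N = S1 m) (h : N *ᵥ e6 1 = e6 1) (v : Fin 6 → ℝ) :
    (N *ᵥ v) 4 = v 4 := by
  have := form_mulVec hN v (e6 1)
  rw [h, dotProduct_S1_mulVec, dotProduct_S1_mulVec] at this
  simpa [e6] using this

/-- Pairing with the fixed isotropic vectors confines the remaining column to the plane of the third
and fourth basis vectors. The determinant fixes its diagonal entry, and pairing with `e6 2` kills
the other one. -/
lemma eq_one_of_fix (hN : Nᵀ * S1 m * N = S1 m) (hd : N.det = 1) (h0 : N *ᵥ e6 0 = e6 0)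
    (h5 : N *ᵥ e6 5 = e6 5) (h1 : N *ᵥ e6 1 = e6 1) (h4 : N *ᵥ e6 4 = e6 4)
    (h2 : N *ᵥ e6 2 = e6 2) : N = 1 := by
  have e0 := fun i => mulVec_e6 N i 0
  have e1 := fun i => mulVec_e6 N i 1
  have e2 := fun i => mulVec_e6 N i 2
  have e4 := fun i => mulVec_e6 N i 4
  have e5 := fun i => mulVec_e6 N i 5
  simp only [h0, h1, h2, h4, h5] at e0 e1 e2 e4 e5
  have r0 := mulVec_e6 N 0 3
  have r1 := mulVec_e6 N 1 3
  have r4 := mulVec_e6 N 4 3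
  have r5 := mulVec_e6 N 5 3
  rw [apply_zero_of_fix hN h5] at r0
  rw [apply_one_of_fix hN h4] at r1
  rw [apply_four_of_fix hN h1] at r4
  rw [apply_five_of_fix hN h0] at r5
  have hNe : N = !![1, 0, 0, 0, 0, 0; 0, 1, 0, 0, 0, 0; 0, 0, 1, N 2 3, 0, 0;
      0, 0, 0, N 3 3, 0, 0; 0, 0, 0, 0, 1, 0; 0, 0, 0, 0, 0, 1] := by
    ext i j
    fin_cases j
    · fin_cases i <;> simp [← e0, e6]
    · fin_cases i <;> simp [← e1, e6]
    · fin_cases i <;> simp [← e2, e6]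
    · fin_cases i <;> simp [← r0, ← r1, ← r4, ← r5, e6]
    · fin_cases i <;> simp [← e4, e6]
    · fin_cases i <;> simp [← e5, e6]
  have h33 : N 3 3 = 1 := by
    rw [hNe] at hd
    simpa [Matrix.det_succ_row_zero, Fin.sum_univ_succ, Fin.succAbove] using hd
  have h23 : N 2 3 = 0 := by
    have := form_mulVec hN (e6 3) (e6 2)
    rw [h2, dotProduct_S1_mulVec, dotProduct_S1_mulVec] at this
    simp only [mulVec_e6, h33] at this
    simpa [e6] using this
  rw [hNe, h33, h23]
  ext i j
  fin_cases i <;> fin_cases j <;> rfl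

lemma herm_e6 (m : ℕ) : herm m (e6 0) = 0 ∧ herm m (e6 5) = 0 ∧ herm m (e6 1) = !![1, 0; 0, 0] ∧
    herm m (e6 4) = !![0, 0; 0, 1] ∧ herm m (e6 2) = !![0, 1; 1, 0] := by
  refine ⟨?_, ?_, ?_, ?_, ?_⟩ <;> ext i j <;> fin_cases i <;> fin_cases j <;>
    simp [herm, ofCoord, mid, e6]

lemma det_herm (m : ℕ) (v : Fin 6 → ℝ) : ((v ⬝ᵥ (S1 m *ᵥ v) : ℝ) : ℂ) =
    2 * (v 0 * v 5 + (herm m v).det) := by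
  rw [dotProduct_S1_mulVec]
  push_cast
  rw [Complex.normSq_eq_conj_mul_self, two_re_omega]
  simp [herm, ofCoord, mid, Matrix.det_fin_two]
  ring

/-- What is left is a rotation of a definite plane. The image of `e6 2` is an off-diagonal Hermitian
matrix of determinant `-1`, given by some `t` with `|t| = 1`. -/
lemma inImage_of_fix_four (hm : m ≠ 0) (hN : Nᵀ * S1 m * N = S1 m) (hd : N.det = 1)
    (h0 : N *ᵥ e6 0 = e6 0) (h5 : N *ᵥ e6 5 = e6 5) (h1 : N *ᵥ e6 1 = e6 1)
    (h4 : N *ᵥ e6 4 = e6 4) : InImage m N := by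
  set v := N *ᵥ e6 2 with hv
  have v0 : v 0 = 0 := by simp [hv, apply_zero_of_fix hN h5, e6]
  have v1 : v 1 = 0 := by simp [hv, apply_one_of_fix hN h4, e6]
  have v4 : v 4 = 0 := by simp [hv, apply_four_of_fix hN h1, e6]
  have v5 : v 5 = 0 := by simp [hv, apply_five_of_fix hN h0, e6]
  have hdet : (herm m v).det = -1 := by
    have h := form_mulVec hN (e6 2) (e6 2)
    rw [← hv] at h
    have e := det_herm m v
    rw [h, dotProduct_S1_mulVec, v0] at e
    simp [e6] at e
    linear_combination -e / 2
  set t := herm m v 0 1 with ht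
  have hherm : herm m v = !![0, t; starRingEnd ℂ t, 0] := by
    ext i j
    fin_cases i <;> fin_cases j <;> simp [ht, herm, ofCoord, mid, v1, v4]
  rw [hherm] at hdet
  have htt : t * starRingEnd ℂ t = 1 := by
    simpa [Matrix.det_fin_two] using hdet
  -- The Levi element `diag(μ̄, μ)` multiplies the off-diagonal entry by `μ̄²`, so a square root of
  -- `t` is needed.
  obtain ⟨μ, hμ⟩ := IsAlgClosed.exists_pow_nat_eq t (n := 2) two_pos
  have hμn : μ * starRingEnd ℂ μ = 1 := by
    have h : (Complex.normSq μ) ^ 2 = 1 := by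
      have := htt
      rw [← hμ, map_pow, ← mul_pow, Complex.mul_conj] at this
      exact_mod_cast this
    rw [Complex.mul_conj]
    rcases mul_self_eq_one_iff.mp ((sq _).symm.trans h) with h | h
    · rw [h]; simp
    · have := Complex.normSq_nonneg μ
      linarith
  have hU : (!![starRingEnd ℂ μ, 0; 0, μ] : Matrix (Fin 2) (Fin 2) ℂ).det = 1 := by
    simp [Matrix.det_fin_two, mul_comm, hμn]
  obtain ⟨f0, f5, f1, f4, f2⟩ := herm_e6 m
  apply InImage.of_mul hm (levi _ hU)
  have hact := fun v => tildeRe_levi_mulVec hm _ hU v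
  have hone : tildeRe m (levi _ hU) * N = 1 := by
    apply eq_one_of_fix (m := m) (preserves_mul (tildeRe_preserves hm _) hN)
      (by rw [Matrix.det_mul, hd, det_tildeRe hm, mul_one])
    · rw [← Matrix.mulVec_mulVec, h0]
      exact vec_ext hm (hact _).1 (hact _).2.2 (by rw [(hact _).2.1, f0]; simp)
    · rw [← Matrix.mulVec_mulVec, h5]
      exact vec_ext hm (hact _).1 (hact _).2.2 (by rw [(hact _).2.1, f5]; simp)
    · rw [← Matrix.mulVec_mulVec, h1]
      refine vec_ext hm (hact _).1 (hact _).2.2 ?_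
      rw [(hact _).2.1, f1, conjTranspose_two]
      ext i j
      fin_cases i <;> fin_cases j <;> simp [mul_comm, hμn]
    · rw [← Matrix.mulVec_mulVec, h4]
      refine vec_ext hm (hact _).1 (hact _).2.2 ?_
      rw [(hact _).2.1, f4, conjTranspose_two]
      ext i j
      fin_cases i <;> fin_cases j <;> simp [mul_comm, hμn]
    · rw [← Matrix.mulVec_mulVec, ← hv]
      refine vec_ext hm ((hact _).1.trans (by simp [v0, e6]))
        ((hact _).2.2.trans (by simp [v5, e6])) ?_
      rw [(hact _).2.1, f2, hherm, ← hμ, conjTranspose_two]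
      ext i j
      fin_cases i <;> fin_cases j <;> simp
      · linear_combination (μ * starRingEnd ℂ μ + 1) * hμn
      · linear_combination (μ * starRingEnd ℂ μ + 1) * hμn
  exact hone ▸ ⟨1, tildeRe_one hm⟩

/-- The image of `e6 1` is the rank one Hermitian matrix of the column `(1, t̄)`. A lower unipotent
Levi element moves this column to `(1, 0)` and fixes `e6 4`. -/
lemma inImage_of_fix_three (hm : m ≠ 0) (hN : Nᵀ * S1 m * N = S1 m) (hd : N.det = 1)
    (h0 : N *ᵥ e6 0 = e6 0) (h5 : N *ᵥ e6 5 = e6 5) (h4 : N *ᵥ e6 4 = e6 4) : InImage m N := by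
  set v := N *ᵥ e6 1 with hv
  have v0 : v 0 = 0 := by simp [hv, apply_zero_of_fix hN h5, e6]
  have v1 : v 1 = 1 := by simp [hv, apply_one_of_fix hN h4, e6]
  have v5 : v 5 = 0 := by simp [hv, apply_five_of_fix hN h0, e6]
  have hdet : (herm m v).det = 0 := by
    have h := form_mulVec hN (e6 1) (e6 1)
    rw [← hv] at h
    have e := det_herm m v
    rw [h, dotProduct_S1_mulVec, v0] at e
    simpa [e6] using e
  set t := herm m v 0 1 with ht
  have hherm : herm m v = !![1, t; starRingEnd ℂ t, v 4] := by
    ext i j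
    fin_cases i <;> fin_cases j <;> simp [ht, herm, ofCoord, mid, v1]
  rw [hherm] at hdet
  have htt : (v 4 : ℂ) = t * starRingEnd ℂ t := by
    rw [Matrix.det_fin_two] at hdet
    simp at hdet
    linear_combination hdet
  rw [htt] at hherm
  have hU : (!![1, 0; -starRingEnd ℂ t, 1] : Matrix (Fin 2) (Fin 2) ℂ).det = 1 := by
    simp [Matrix.det_fin_two]
  obtain ⟨f0, f5, f1, f4, -⟩ := herm_e6 m
  apply InImage.of_mul hm (levi _ hU)
  have hact := fun v => tildeRe_levi_mulVec hm _ hU v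
  apply inImage_of_fix_four hm (preserves_mul (tildeRe_preserves hm _) hN)
      (by rw [Matrix.det_mul, hd, det_tildeRe hm, mul_one])
  · rw [← Matrix.mulVec_mulVec, h0]
    exact vec_ext hm (hact _).1 (hact _).2.2 (by rw [(hact _).2.1, f0]; simp)
  · rw [← Matrix.mulVec_mulVec, h5]
    exact vec_ext hm (hact _).1 (hact _).2.2 (by rw [(hact _).2.1, f5]; simp)
  · rw [← Matrix.mulVec_mulVec, ← hv]
    refine vec_ext hm ((hact _).1.trans (by simp [v0, e6]))
      ((hact _).2.2.trans (by simp [v5, e6])) ?_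
    rw [(hact _).2.1, f1, hherm, conjTranspose_two]
    ext i j
    fin_cases i <;> fin_cases j <;> simp
    ring
  · rw [← Matrix.mulVec_mulVec, h4]
    refine vec_ext hm (hact _).1 (hact _).2.2 ?_
    rw [(hact _).2.1, f4, conjTranspose_two]
    ext i j
    fin_cases i <;> fin_cases j <;> simp

/-- The image of `e6 4` is a Hermitian matrix of determinant zero with positive lower right entry,
hence semidefinite of rank one. The sign is essential: `H ↦ U H Uᴴ` cannot exchange the two halves
of the light cone. -/
lemma inImage_of_fix_two (hm : m ≠ 0) (hN : Nᵀ * S1 m * N = S1 m) (hd : N.det = 1)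
    (h0 : N *ᵥ e6 0 = e6 0) (h5 : N *ᵥ e6 5 = e6 5) (h44 : 0 < N 4 4) : InImage m N := by
  set v := N *ᵥ e6 4 with hv
  have v0 : v 0 = 0 := by simp [hv, apply_zero_of_fix hN h5, e6]
  have v5 : v 5 = 0 := by simp [hv, apply_five_of_fix hN h0, e6]
  have v4 : 0 < v 4 := by rw [hv, mulVec_e6]; exact h44
  have hdet : (herm m v).det = 0 := by
    have h := form_mulVec hN (e6 4) (e6 4)
    rw [← hv] at h
    have e := det_herm m v
    rw [h, dotProduct_S1_mulVec, v0] at e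
    simpa [e6] using e
  set t := herm m v 0 1 with ht
  have hherm : herm m v = !![(v 1 : ℂ), t; starRingEnd ℂ t, v 4] := by
    ext i j
    fin_cases i <;> fin_cases j <;> simp [ht, herm, ofCoord, mid]
  rw [hherm] at hdet
  have htt : (v 1 : ℂ) * v 4 = t * starRingEnd ℂ t := by
    rw [Matrix.det_fin_two] at hdet
    simp at hdet
    linear_combination hdet
  set w := Real.sqrt (v 4) with hw
  have hw0 : (w : ℂ) ≠ 0 := by
    exact_mod_cast (Real.sqrt_pos.mpr v4).ne'
  have hww : (w : ℂ) * w = v 4 := by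
    exact_mod_cast Real.mul_self_sqrt v4.le
  -- The image is `y yᴴ` for the column `y = (t / w, w)` with `w² = v 4`; this `U` sends `y` to `(0,
  -- 1)`.
  have hU : (!![(w : ℂ), -(t / w); 0, (w : ℂ)⁻¹] : Matrix (Fin 2) (Fin 2) ℂ).det = 1 := by
    simp [Matrix.det_fin_two, hw0]
  obtain ⟨f0, f5, -, f4, -⟩ := herm_e6 m
  apply InImage.of_mul hm (levi _ hU)
  have hact := fun v => tildeRe_levi_mulVec hm _ hU v
  apply inImage_of_fix_three hm (preserves_mul (tildeRe_preserves hm _) hN)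
      (by rw [Matrix.det_mul, hd, det_tildeRe hm, mul_one])
  · rw [← Matrix.mulVec_mulVec, h0]
    exact vec_ext hm (hact _).1 (hact _).2.2 (by rw [(hact _).2.1, f0]; simp)
  · rw [← Matrix.mulVec_mulVec, h5]
    exact vec_ext hm (hact _).1 (hact _).2.2 (by rw [(hact _).2.1, f5]; simp)
  · rw [← Matrix.mulVec_mulVec, ← hv]
    refine vec_ext hm ((hact _).1.trans (by simp [v0, e6]))
      ((hact _).2.2.trans (by simp [v5, e6])) ?_
    rw [(hact _).2.1, f4, hherm, conjTranspose_two]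
    rw [← hww] at htt ⊢
    have h1 : (v 1 : ℂ) = t * starRingEnd ℂ t / (w * w) := by
      rw [← htt]; field_simp
    rw [h1]
    have hw1 : w ≠ 0 := by exact_mod_cast hw0
    ext i j
    fin_cases i <;> fin_cases j <;> simp [hw1] <;> field_simp <;> ring

lemma dotProduct_of_mid_eq_zero {v w : Fin 6 → ℝ} (hw : ∀ j, w (mid j) = 0) :
    v ⬝ᵥ (S1 m *ᵥ w) = v 0 * w 5 + v 5 * w 0 := by
  have a1 : w 1 = 0 := hw 0
  have a2 : w 2 = 0 := hw 1
  have a3 : w 3 = 0 := hw 2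
  have a4 : w 4 = 0 := hw 3
  rw [dotProduct_S1_mulVec, a1, a2, a3, a4]
  ring

lemma eq_of_mid_eq_zero {v : Fin 6 → ℝ} (h0 : v 0 = 1) (h5 : v 5 = 0)
    (hv : ∀ j, v (mid j) = 0) : v = e6 0 := by
  ext i
  fin_cases i
  exacts [h0, hv 0, hv 1, hv 2, hv 3, h5]

lemma inImage_of_fix_one (hm : m ≠ 0) (hN : Nᵀ * S1 m * N = S1 m) (hd : N.det = 1)
    (h5 : N *ᵥ e6 5 = e6 5) (h44 : 0 < N 4 4) : InImage m N := by
  set v := N *ᵥ e6 0 with hv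
  have v0 : v 0 = 1 := by simp [hv, apply_zero_of_fix hN h5, e6]
  set M := lower (herm m v).adjugate (herm_adjugate_conjTranspose m v)
  apply InImage.of_mul hm M
  have hact := fun u => tildeRe_lower_mulVec hm v u
  have hpres := preserves_mul (tildeRe_preserves hm M) hN
  have hmid : ∀ j, ((tildeRe m M * N) *ᵥ e6 0) (mid j) = 0 := by
    intro j
    rw [← Matrix.mulVec_mulVec, ← hv, (hact v).2, v0]
    ring
  have hzero : ((tildeRe m M * N) *ᵥ e6 0) 0 = 1 := by
    rw [← Matrix.mulVec_mulVec, ← hv, (hact v).1, v0]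
  have h1 : ∀ j, (tildeRe m M *ᵥ e6 5) (mid j) = 0 := by
    intro j
    rw [(hact _).2]
    fin_cases j <;> simp [mid, e6]
  have h2 : (tildeRe m M *ᵥ e6 5) 0 = 0 := by rw [(hact _).1]; simp [e6]
  have h3 : (tildeRe m M *ᵥ e6 5) 5 = 1 := by
    have e := form_mulVec (tildeRe_preserves hm M) (e6 0) (e6 5)
    rw [dotProduct_of_mid_eq_zero h1, (hact _).1, h2] at e
    simpa [dotProduct_S1_mulVec, e6] using e
  apply inImage_of_fix_two hm hpres (by rw [Matrix.det_mul, hd, det_tildeRe hm, mul_one])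
  · apply eq_of_mid_eq_zero hzero _ hmid
    have e := form_mulVec hpres (e6 0) (e6 0)
    rw [dotProduct_of_mid_eq_zero hmid, hzero] at e
    simpa [dotProduct_S1_mulVec, e6] using e
  · rw [← Matrix.mulVec_mulVec, h5]
    ext i
    fin_cases i
    exacts [h2, h1 0, h1 1, h1 2, h1 3, h3]
  · have e : (tildeRe m M * N) 4 4 = N 4 4 := by
      rw [← mulVec_e6 (_ * _), ← Matrix.mulVec_mulVec]
      refine ((hact _).2 3).trans ?_
      -- The lower unipotent changes middle coordinates only by a multiple of the zeroth one, which
      -- vanishes on `N *ᵥ e6 4`.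
      rw [apply_zero_of_fix hN h5]
      rw [show e6 4 0 = 0 by simp [e6], zero_mul, sub_zero]
      exact mulVec_e6 N 4 4
    rwa [e]

lemma inImage_of_apply_five_eq_one (hm : m ≠ 0) (hN : Nᵀ * S1 m * N = S1 m) (hd : N.det = 1)
    (h55 : N 5 5 = 1) (h : 0 < N 4 4 * N 5 5 - N 4 5 * N 5 4) : InImage m N := by
  set v := N *ᵥ e6 5 with hv
  have v5 : v 5 = 1 := by rw [hv, mulVec_e6, h55]
  set M := upper (herm m (-v)) (herm_conjTranspose m (-v))
  apply InImage.of_mul hm M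
  have hact := fun u => tildeRe_upper_mulVec hm (-v) u
  have hpres := preserves_mul (tildeRe_preserves hm M) hN
  have hmid : ∀ j, ((tildeRe m M * N) *ᵥ e6 5) (mid j) = 0 := by
    intro j
    rw [← Matrix.mulVec_mulVec, ← hv, (hact v).1, v5]
    simp
  have hfive : ((tildeRe m M * N) *ᵥ e6 5) 5 = 1 := by
    rw [← Matrix.mulVec_mulVec, ← hv, (hact v).2, v5]
  apply inImage_of_fix_one hm hpres (by rw [Matrix.det_mul, hd, det_tildeRe hm, mul_one])
  · have e := form_mulVec hpres (e6 5) (e6 5)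
    rw [dotProduct_of_mid_eq_zero hmid, hfive] at e
    simp [dotProduct_S1_mulVec, e6] at e
    ext i
    fin_cases i
    exacts [e,
      hmid 0, hmid 1, hmid 2, hmid 3, hfive]
  · have e : (tildeRe m M * N) 4 4 = N 4 4 * N 5 5 - N 4 5 * N 5 4 := by
      rw [← mulVec_e6 (_ * _), ← Matrix.mulVec_mulVec]
      refine ((hact _).1 3).trans ?_
      change (N *ᵥ e6 4) 4 + (N *ᵥ e6 4) 5 * (-(N *ᵥ e6 5) 4) = _
      rw [mulVec_e6, mulVec_e6, mulVec_e6, h55]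
      ring
    rwa [e]

/-- Both inequalities hold at the identity and are open. Scaling makes the corner entry `1`,
multiplying the minor by a positive factor; translating `N *ᵥ e6 5` back to `e6 5` then turns the
minor into the `4, 4` entry, whose sign the Levi reduction needs. -/
lemma inImage_of_pos (hm : m ≠ 0) (hN : Nᵀ * S1 m * N = S1 m) (hd : N.det = 1)
    (h55 : 0 < N 5 5) (h : 0 < N 4 4 * N 5 5 - N 4 5 * N 5 4) : InImage m N := by
  have hs : (Real.sqrt (N 5 5) : ℂ) ≠ 0 := by exact_mod_cast (Real.sqrt_pos.mpr h55).ne'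
  have hr : star (Real.sqrt (N 5 5) : ℂ) = Real.sqrt (N 5 5) := Complex.conj_ofReal _
  have hs2 := Real.sq_sqrt h55.le
  set s := Real.sqrt (N 5 5)
  apply InImage.of_mul hm (scaling s hs hr)
  have hact := fun u => tildeRe_scaling_mulVec hm s hs hr u
  have r4 : ∀ j, (tildeRe m (scaling s hs hr) * N) 4 j = N 4 j := by
    intro j
    rw [← mulVec_e6 (_ * _), ← Matrix.mulVec_mulVec]
    exact ((hact _).1 3).trans (mulVec_e6 N 4 j)
  have r5 : ∀ j, (tildeRe m (scaling s hs hr) * N) 5 j = (N 5 5)⁻¹ * N 5 j := by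
    intro j
    rw [← mulVec_e6 (_ * _), ← Matrix.mulVec_mulVec, (hact _).2, hs2, mulVec_e6]
  apply inImage_of_apply_five_eq_one hm (preserves_mul (tildeRe_preserves hm _) hN)
    (by rw [Matrix.det_mul, hd, det_tildeRe hm, mul_one])
  · rw [r5]; field_simp
  · rw [r4, r4, r5, r5]
    have : N 4 4 * ((N 5 5)⁻¹ * N 5 5) - N 4 5 * ((N 5 5)⁻¹ * N 5 4) =
        (N 5 5)⁻¹ * (N 4 4 * N 5 5 - N 4 5 * N 5 4) := by ring
    rw [this]
    positivity

end stabilizer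

/-- The image contains a neighbourhood of `1`, so it is an open and therefore closed subgroup, and
it contains the identity component. -/
lemma surjective_toSO0 {m : ℕ} (hm : m ≠ 0) : Function.Surjective (toSO0 hm) := by
  have hnhds : ((toSO hm).range : Set (SO m)) ∈ nhds 1 := by
    have hval : Continuous fun N : SO m => (N.1.1 : Matrix (Fin 6) (Fin 6) ℝ) :=
      continuous_subtype_val.comp continuous_subtype_val
    have hopen : IsOpen {N : SO m | 0 < N.1.1 5 5 ∧
        0 < N.1.1 4 4 * N.1.1 5 5 - N.1.1 4 5 * N.1.1 5 4} := by
      have hc := fun i j => hval.matrix_elem i j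
      exact (isOpen_lt continuous_const (hc 5 5)).inter (isOpen_lt continuous_const
        (((hc 4 4).mul (hc 5 5)).sub ((hc 4 5).mul (hc 5 4))))
    refine Filter.mem_of_superset (hopen.mem_nhds ?_) ?_
    · constructor <;> simp
    · rintro N ⟨h1, h2⟩
      obtain ⟨M, hM⟩ := inImage_of_pos hm N.2 N.1.2 h1 h2
      exact ⟨M, Subtype.ext (Subtype.ext hM)⟩
  have hclopen : IsClopen ((toSO hm).range : Set (SO m)) := by
    have hO := Subgroup.isOpen_of_mem_nhds _ hnhds
    exact ⟨Subgroup.isClosed_of_isOpen _ hO, hO⟩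
  intro N
  have : N.1 ∈ (toSO hm).range :=
    hclopen.connectedComponent_subset (one_mem _) N.2
  obtain ⟨M, hM⟩ := this
  exact ⟨M, Subtype.ext hM⟩

/-! ### The kernel -/

/-- The elementary alternating matrix `e_i ∧ e_j`. -/
def wedge (i j : I4) : Matrix I4 I4 ℂ := Matrix.single i j 1 - Matrix.single j i 1

lemma mul_wedge_mul_apply (M : Matrix I4 I4 ℂ) (i j k l : I4) :
    (M * wedge i j * Mᵀ) k l = M k i * M l j - M k j * M l i := by
  have h : ∀ i j : I4, (M * Matrix.single i j (1 : ℂ) * Mᵀ : Matrix I4 I4 ℂ) k l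
      = M k i * M l j := by
    intro i j
    rw [Matrix.mul_apply, Finset.sum_eq_single j]
    · simp
    · intro b _ hb
      rw [Matrix.mul_single_apply_of_ne _ _ _ _ _ hb]
      simp
    · simp
  rw [wedge, Matrix.mul_sub, Matrix.sub_mul, Matrix.sub_apply, h, h]

lemma exists_alt_eq {m : ℕ} (hm : m ≠ 0) {X : Matrix I4 I4 ℂ} (hX : Xᵀ = -X) :
    ∃ v, alt m v = X := by
  have h : ∀ i j, X j i = -X i j := fun i j => congrFun (congrFun hX i) j
  have h' : ∀ i, X i i = 0 := fun i => by
    have := h i i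
    linear_combination this / 2
  have e := ofCoord_coord hm
    !![X (.inl 0) (.inr 1), -X (.inl 0) (.inr 0); X (.inl 1) (.inr 1), -X (.inl 1) (.inr 0)]
  set z := coord m
    !![X (.inl 0) (.inr 1), -X (.inl 0) (.inr 0); X (.inl 1) (.inr 1), -X (.inl 1) (.inr 0)]
  refine ⟨![X (.inl 1) (.inl 0), z 0, z 1, z 2, z 3, X (.inr 0) (.inr 1)], ?_⟩
  have hz : (fun j => (![X (.inl 1) (.inl 0), z 0, z 1, z 2, z 3, X (.inr 0) (.inr 1)] :
      Fin 6 → ℂ) (mid j)) = z := by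
    ext j; fin_cases j <;> rfl
  rw [alt, hz, e]
  ext i j
  rcases i with i | i <;> rcases j with j | j <;> fin_cases i <;> fin_cases j <;>
    simp [altBlock, h', h (.inl 0) (.inl 1), h (.inr 0) (.inr 1), h (.inl 0) (.inr 0),
      h (.inl 0) (.inr 1), h (.inl 1) (.inr 0), h (.inl 1) (.inr 1)]

lemma wedge_transpose (i j : I4) : (wedge i j)ᵀ = -wedge i j := by
  simp [wedge]

/-- The hypothesis says that all `2 × 2` minors of `M` agree with those of the identity. This forces
`M` to be diagonal with `M i i * M j j = 1` for `i ≠ j`; four indices leave room for a third one,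
which makes the diagonal constant. -/
lemma eq_one_or_neg_one_of_congr {M : Matrix I4 I4 ℂ}
    (h : ∀ i j, M * wedge i j * Mᵀ = wedge i j) : M = 1 ∨ M = -1 := by
  have w : ∀ i j k l, M k i * M l j - M k j * M l i = wedge i j k l := by
    intro i j k l
    rw [← mul_wedge_mul_apply, h]
  have third : ∀ i k : I4, ∃ j, j ≠ i ∧ j ≠ k := by decide
  have off : ∀ i k, k ≠ i → M k i = 0 := by
    intro i k hk
    obtain ⟨j, hji, hjk⟩ := third i k
    have h1 := w i j i j
    have h2 := w i j k j
    have h3 := w i j k i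
    simp [wedge, hji, hji.symm, hjk, hk.symm] at h1 h2 h3
    -- Expansion of the vanishing `3 × 3` determinant with rows `i, j, k` and columns `i, i, j`
    -- along a repeated column.
    linear_combination -M k i * h1 + M i i * h2 - M j i * h3
  have diag : ∀ i j, i ≠ j → M i i * M j j = 1 := by
    intro i j hij
    have h1 := w i j i j
    rw [off i j hij.symm] at h1
    simpa [wedge, Matrix.single_apply, hij, hij.symm] using h1
  have all : ∀ i j, M i i = M j j := by
    intro i j
    by_cases hij : i = j
    · rw [hij]
    obtain ⟨k, hki, hkj⟩ := third i j
    have h1 := diag i k hki.symm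
    have h2 := diag j k hkj.symm
    exact mul_right_cancel₀ (right_ne_zero_of_mul_eq_one h1) (h1.trans h2.symm)
  have hsq : M (.inl 0) (.inl 0) * M (.inl 0) (.inl 0) = 1 := by
    conv_lhs => rw [all (.inl 0) (.inl 1)]
    rw [← diag (.inl 1) (.inl 0) (by decide), all (.inl 0) (.inl 1)]
  have hM : M = M (.inl 0) (.inl 0) • 1 := by
    ext i j
    by_cases hij : i = j
    · subst hij
      simp [all i (.inl 0)]
    · rw [off j i hij]
      simp [hij]
  rcases mul_self_eq_one_iff.mp hsq with h1 | h1
  · left; rw [hM, h1, one_smul]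
  · right; rw [hM, h1, neg_smul, one_smul]

lemma mem_ker_toSO0 {m : ℕ} (hm : m ≠ 0) (M : SU22) :
    M ∈ (toSO0 hm).ker ↔ mat4 M = 1 ∨ mat4 M = -1 := by
  have key : M ∈ (toSO0 hm).ker ↔ ∀ v, mat4 M * alt m v * (mat4 M)ᵀ = alt m v := by
    have e : M ∈ (toSO0 hm).ker ↔ tilde m M = 1 := by
      rw [MonoidHom.mem_ker, ← map_mat6_toSO0 hm]
      constructor
      · intro h
        rw [h]
        exact Matrix.map_one _ Complex.ofReal_zero Complex.ofReal_one
      · intro h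
        apply Subtype.ext
        apply Subtype.ext
        apply Subtype.ext
        apply ofReal_map_injective
        exact h.trans (Matrix.map_one _ Complex.ofReal_zero Complex.ofReal_one).symm
    rw [e]
    constructor
    · intro h v
      rw [mat4_mul_alt_mul hm, h, Matrix.one_mulVec]
    · intro h
      apply Matrix.ext_of_mulVec_single
      intro j
      apply alt_injective hm
      rw [← mat4_mul_alt_mul hm, h, Matrix.one_mulVec]
  rw [key]
  constructor
  · intro h
    apply eq_one_or_neg_one_of_congr
    intro i j
    obtain ⟨v, hv⟩ := exists_alt_eq hm (wedge_transpose i j)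
    rw [← hv, h]
  · rintro (h | h) v <;> simp [h]

/-! ### The field `ℚ(√-m)` and its ring of integers -/

lemma mem_K_iff (m : ℕ) (x : ℂ) : x ∈ K m ↔ ∃ a b : ℚ, x = a + b * sqrtNeg m := by
  have hsqrt : IsIntegral ℚ (sqrtNeg m) := by
    apply IsIntegral.of_pow two_pos
    rw [sq, sqrtNeg_mul_self]
    have : (-(m : ℂ)) = algebraMap ℚ ℂ (-(m : ℚ)) := by simp
    rw [this]
    exact isIntegral_algebraMap
  constructor
  · intro hx
    rw [← IntermediateField.mem_toSubalgebra,
      IntermediateField.adjoin_simple_toSubalgebra_of_isAlgebraic hsqrt.isAlgebraic] at hx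
    induction hx using Algebra.adjoin_induction with
    | mem x hx =>
      rw [Set.mem_singleton_iff] at hx
      exact ⟨0, 1, by simp [hx]⟩
    | algebraMap r => exact ⟨r, 0, by simp⟩
    | add x y _ _ hx hy =>
      obtain ⟨a, b, rfl⟩ := hx
      obtain ⟨c, d, rfl⟩ := hy
      exact ⟨a + c, b + d, by push_cast; ring⟩
    | mul x y _ _ hx hy =>
      obtain ⟨a, b, rfl⟩ := hx
      obtain ⟨c, d, rfl⟩ := hy
      exact ⟨a * c - b * d * m, a * d + b * c, by
        push_cast
        linear_combination (b * d : ℂ) * sqrtNeg_mul_self m⟩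
  · rintro ⟨a, b, rfl⟩
    have hs : sqrtNeg m ∈ K m := IntermediateField.mem_adjoin_simple_self ℚ _
    exact add_mem (SubfieldClass.ratCast_mem _ a) (mul_mem (SubfieldClass.ratCast_mem _ b) hs)

instance numberField_K (m : ℕ) : NumberField (K m) where
  to_finiteDimensional := by
    apply IntermediateField.adjoin.finiteDimensional
    apply IsIntegral.of_pow two_pos
    rw [sq, sqrtNeg_mul_self]
    have : (-(m : ℂ)) = algebraMap ℚ ℂ (-(m : ℚ)) := by simp
    rw [this]
    exact isIntegral_algebraMap

/-- The ring of integers of `ℚ(√-m)` as a subring of `ℂ`. -/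
def OO (m : ℕ) : Subring ℂ := (intEmb m).range

lemma intEmb_injective (m : ℕ) : Function.Injective (intEmb m) :=
  (algebraMap (K m) ℂ).injective.comp NumberField.RingOfIntegers.coe_injective

lemma mem_OO_iff_isIntegral (m : ℕ) (x : ℂ) : x ∈ OO m ↔ x ∈ K m ∧ IsIntegral ℤ x := by
  constructor
  · rintro ⟨y, rfl⟩
    refine ⟨(algebraMap (𝓞 (K m)) (K m) y).2, ?_⟩
    have := NumberField.RingOfIntegers.isIntegral_coe y
    exact this.map (algebraMap (K m) ℂ).toIntAlgHom
  · rintro ⟨hx, hi⟩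
    have : IsIntegral ℤ (⟨x, hx⟩ : K m) := by
      rw [← isIntegral_algHom_iff (algebraMap (K m) ℂ).toIntAlgHom (algebraMap (K m) ℂ).injective]
      exact hi
    exact ⟨⟨⟨x, hx⟩, this⟩, rfl⟩

lemma exists_int_of_isIntegral {q : ℚ} (h : IsIntegral ℤ (q : ℂ)) : ∃ n : ℤ, q = n := by
  have h' : IsIntegral ℤ q := by
    rw [← isIntegral_algHom_iff (algebraMap ℚ ℂ).toIntAlgHom (algebraMap ℚ ℂ).injective]
    exact h
  obtain ⟨n, hn⟩ := IsIntegrallyClosed.isIntegral_iff.mp h'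
  exact ⟨n, by rw [← hn]; simp⟩

/-- The square of the denominator of `c` is coprime to that of the numerator, so it divides the
squarefree number `m`. -/
lemma exists_int_of_squarefree_mul_sq {m : ℕ} (hm : Squarefree m) {c : ℚ} {n : ℤ}
    (h : (m : ℚ) * c ^ 2 = n) : ∃ a : ℤ, c = a := by
  have hden : (c.den : ℚ) ≠ 0 := by exact_mod_cast c.den_nz
  have h1 : (m : ℚ) * c.num ^ 2 = n * c.den ^ 2 := by
    rw [← h]
    conv_rhs => rw [← Rat.num_div_den c]
    rw [Rat.num_div_den c]
    have := Rat.num_div_den c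
    field_simp at this
    rw [this]
    ring
  have h2 : (m : ℤ) * c.num ^ 2 = n * (c.den : ℤ) ^ 2 := by exact_mod_cast h1
  have h3 : (c.den : ℤ) ^ 2 ∣ m := by
    have hc : IsCoprime ((c.den : ℤ) ^ 2) (c.num ^ 2) := by
      apply IsCoprime.pow
      rw [Int.isCoprime_iff_gcd_eq_one, Int.gcd_comm]
      exact c.reduced
    exact hc.dvd_of_dvd_mul_right ⟨n, by rw [h2]; ring⟩
  have h4 : c.den * c.den ∣ m := by
    rw [← sq]; exact_mod_cast h3
  have h5 : c.den = 1 := Nat.isUnit_iff.mp (hm _ h4)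
  exact ⟨c.num, ((Rat.den_eq_one_iff c).mp h5).symm⟩

lemma omega_sq (m : ℕ) : omega m * omega m =
    if m % 4 = 3 then omega m - ((m / 4 + 1 : ℕ) : ℂ) else -(m : ℂ) := by
  unfold omega
  split_ifs with h
  · have e : (m : ℂ) = 4 * ((m / 4 : ℕ) : ℂ) + 3 := by
      exact_mod_cast (by omega : m = 4 * (m / 4) + 3)
    have := sqrtNeg_mul_self m
    rw [e] at this
    push_cast
    linear_combination this / 4
  · exact sqrtNeg_mul_self m

lemma omega_mem_K (m : ℕ) : omega m ∈ K m := by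
  rw [mem_K_iff]
  unfold omega
  split_ifs
  · exact ⟨1 / 2, 1 / 2, by push_cast; ring⟩
  · exact ⟨0, 1, by simp⟩

lemma isIntegral_omega (m : ℕ) : IsIntegral ℤ (omega m) := by
  have h := omega_sq m
  split_ifs at h with h4
  · generalize m / 4 = c at h
    refine ⟨Polynomial.X ^ 2 - Polynomial.X + Polynomial.C ((c + 1 : ℕ) : ℤ), ?_, ?_⟩
    · monicity!
    · simp only [Polynomial.eval₂_add, Polynomial.eval₂_sub, Polynomial.eval₂_pow,
        Polynomial.eval₂_X, Polynomial.eval₂_C]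
      rw [sq, h]
      simp
  · apply IsIntegral.of_pow two_pos
    rw [sq, h]
    have : (-(m : ℂ)) = algebraMap ℤ ℂ (-(m : ℤ)) := by simp
    rw [this]
    exact isIntegral_algebraMap

lemma omega_mem_OO (m : ℕ) : omega m ∈ OO m :=
  (mem_OO_iff_isIntegral m _).mpr ⟨omega_mem_K m, isIntegral_omega m⟩

/-- For `x = p + q √-m` the trace `2p` and the norm `p² + m q²` are integers, and squarefreeness
makes `2q` an integer. The congruence `(2p)² + m (2q)² ≡ 0` modulo `4` then decides the parities. -/
lemma mem_OO_iff {m : ℕ} (hm : Squarefree m) (x : ℂ) :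
    x ∈ OO m ↔ ∃ a b : ℤ, x = a + b * omega m := by
  constructor
  · intro hx
    rw [mem_OO_iff_isIntegral, mem_K_iff] at hx
    obtain ⟨⟨p, q, rfl⟩, hi⟩ := hx
    have hi' : IsIntegral ℤ ((p : ℂ) - q * sqrtNeg m) := by
      have := hi.map (starRingEnd ℂ).toIntAlgHom
      simpa [conj_sqrtNeg, sub_eq_add_neg] using this
    obtain ⟨A, hA⟩ : ∃ A : ℤ, 2 * p = A := by
      apply exists_int_of_isIntegral
      have e : ((2 * p : ℚ) : ℂ) = (p + q * sqrtNeg m) + (p - q * sqrtNeg m) := by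
        push_cast; ring
      rw [e]
      exact hi.add hi'
    obtain ⟨n, hn⟩ : ∃ n : ℤ, p ^ 2 + m * q ^ 2 = n := by
      apply exists_int_of_isIntegral
      have e : ((p ^ 2 + m * q ^ 2 : ℚ) : ℂ) = (p + q * sqrtNeg m) * (p - q * sqrtNeg m) := by
        push_cast
        linear_combination (q ^ 2 : ℂ) * sqrtNeg_mul_self m
      rw [e]
      exact hi.mul hi'
    obtain ⟨B, hB⟩ : ∃ B : ℤ, 2 * q = B := by
      apply exists_int_of_squarefree_mul_sq hm (n := 4 * n - A ^ 2)
      push_cast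
      rw [← hn, ← hA]; ring
    have hAB : A ^ 2 + m * B ^ 2 = 4 * n := by
      have : (A : ℚ) ^ 2 + m * B ^ 2 = 4 * n := by rw [← hn, ← hA, ← hB]; ring
      exact_mod_cast this
    have hpc : (p : ℂ) = A / 2 := by
      have : p = A / 2 := by linarith
      rw [this]; push_cast; ring
    have hqc : (q : ℂ) = B / 2 := by
      have : q = B / 2 := by linarith
      rw [this]; push_cast; ring
    have h0 : m % 4 ≠ 0 := by
      intro h
      have := hm 2 (by simpa using Nat.dvd_of_mod_eq_zero h)
      simp at this
    unfold omega
    have hmodA : A % 4 = 0 ∨ A % 4 = 1 ∨ A % 4 = 2 ∨ A % 4 = 3 := by omega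
    have hmodB : B % 4 = 0 ∨ B % 4 = 1 ∨ B % 4 = 2 ∨ B % 4 = 3 := by omega
    have hz : (A % 4 * (A % 4) + (m % 4 : ℕ) * (B % 4 * (B % 4))) % 4 = 0 := by
      have : (A ^ 2 + m * B ^ 2) % 4 = 0 := by rw [hAB]; simp
      rw [sq, sq] at this
      simpa [Int.add_emod, Int.mul_emod] using this
    split_ifs with h3
    · have : 2 ∣ A - B := by
        rw [h3] at hz
        rcases hmodA with h | h | h | h <;> rcases hmodB with h' | h' | h' | h' <;>
          rw [h, h'] at hz <;> omega
      obtain ⟨c, hc⟩ := this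
      refine ⟨c, B, ?_⟩
      have : (A : ℂ) = B + 2 * c := by exact_mod_cast (by omega : A = B + 2 * c)
      rw [hpc, hqc, this]; ring
    · have hm4 : m % 4 = 1 ∨ m % 4 = 2 := by omega
      have : 2 ∣ A ∧ 2 ∣ B := by
        rcases hm4 with h4 | h4 <;> rw [h4] at hz <;>
        rcases hmodA with h | h | h | h <;> rcases hmodB with h' | h' | h' | h' <;>
          rw [h, h'] at hz <;> omega
      obtain ⟨⟨c, rfl⟩, ⟨d, rfl⟩⟩ := this
      refine ⟨c, d, ?_⟩
      rw [hpc, hqc]; push_cast; ring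
  · rintro ⟨a, b, rfl⟩
    exact add_mem (intCast_mem _ a) (mul_mem (intCast_mem _ b) (omega_mem_OO m))

lemma conj_mem_OO {m : ℕ} {x : ℂ} (hx : x ∈ OO m) : starRingEnd ℂ x ∈ OO m := by
  rw [mem_OO_iff_isIntegral, mem_K_iff] at *
  obtain ⟨⟨a, b, rfl⟩, hi⟩ := hx
  exact ⟨⟨a, -b, by simp [conj_sqrtNeg]⟩, hi.map (starRingEnd ℂ).toIntAlgHom⟩

lemma conj_mem_K {m : ℕ} {x : ℂ} (hx : x ∈ K m) : starRingEnd ℂ x ∈ K m := by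
  rw [mem_K_iff] at *
  obtain ⟨a, b, rfl⟩ := hx
  exact ⟨a, -b, by simp [conj_sqrtNeg]⟩

lemma sub_conj_of_mem_OO {m : ℕ} (hm : Squarefree m) {x : ℂ} (hx : x ∈ OO m) :
    ∃ a b : ℤ, x = a + b * omega m ∧ x - starRingEnd ℂ x = b * diffOmega m := by
  obtain ⟨a, b, rfl⟩ := (mem_OO_iff hm x).mp hx
  exact ⟨a, b, rfl, by simp [diffOmega]; ring⟩

lemma diffOmega_mem_OO (m : ℕ) : diffOmega m ∈ OO m :=
  sub_mem (omega_mem_OO m) (conj_mem_OO (omega_mem_OO m))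

lemma sqrtNeg_im {m : ℕ} (hm : m ≠ 0) : (sqrtNeg m).im ≠ 0 := by
  have : 0 < Real.sqrt m := Real.sqrt_pos.mpr (by positivity)
  simp [sqrtNeg]
  exact hm

lemma rat_of_real_mem_K {m : ℕ} (hm : m ≠ 0) {r : ℝ} (h : (r : ℂ) ∈ K m) : ∃ q : ℚ, r = q := by
  obtain ⟨a, b, e⟩ := (mem_K_iff m _).mp h
  have him := congrArg Complex.im e
  have hb : b = 0 := by
    simpa [sqrtNeg_im hm] using him
  refine ⟨a, ?_⟩
  rw [hb] at e
  have : (r : ℂ) = ((a : ℝ) : ℂ) := by simpa using e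
  exact_mod_cast this

lemma int_of_real_mem_OO {m : ℕ} (hm : Squarefree m) {r : ℝ} (h : (r : ℂ) ∈ OO m) :
    ∃ n : ℤ, r = n := by
  obtain ⟨a, b, e⟩ := (mem_OO_iff hm _).mp h
  have him := congrArg Complex.im e
  have hb : b = 0 := by
    simpa [omega_im_ne_zero hm.ne_zero] using him
  refine ⟨a, ?_⟩
  rw [hb] at e
  have : (r : ℂ) = ((a : ℝ) : ℂ) := by simpa using e
  exact_mod_cast this

/-- The first hypothesis gives membership in `K`, the second integrality. It serves for diagonal
entries that are first controlled only up to the factor two. -/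
lemma mem_OO_of_two_mul {m : ℕ} {x : ℂ} (h2 : 2 * x ∈ OO m) (hs : x ^ 2 ∈ OO m) : x ∈ OO m := by
  rw [mem_OO_iff_isIntegral] at *
  refine ⟨?_, IsIntegral.of_pow two_pos hs.2⟩
  have : x = 2⁻¹ * (2 * x) := by ring
  rw [this]
  exact mul_mem (inv_mem (ofNat_mem _ 2)) h2.1

/-! ### Integral and rational alternating matrices -/

lemma mem_matrix {R : Subring ℂ} {X : Matrix I4 I4 ℂ} : X ∈ R.matrix ↔ ∀ i j, X i j ∈ R := Iff.rfl

lemma smul_mem_matrix {R : Subring ℂ} {X : Matrix I4 I4 ℂ} {c : ℂ} (hc : c ∈ R)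
    (hX : X ∈ R.matrix) : c • X ∈ R.matrix :=
  mem_matrix.mpr fun i j => mul_mem hc (mem_matrix.mp hX i j)

lemma transpose_mem_matrix {R : Subring ℂ} {X : Matrix I4 I4 ℂ} (hX : X ∈ R.matrix) :
    Xᵀ ∈ R.matrix := fun i j => hX j i

lemma single_mem_matrix (R : Subring ℂ) (i j : I4) : Matrix.single i j (1 : ℂ) ∈ R.matrix := by
  intro k l
  rw [Matrix.single_apply]
  split_ifs
  exacts [one_mem R, zero_mem R]

lemma wedge_mem_matrix (R : Subring ℂ) (i j : I4) : wedge i j ∈ R.matrix :=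
  sub_mem (single_mem_matrix R i j) (single_mem_matrix R j i)

lemma alt_mem_matrix_iff {m : ℕ} (R : Subring ℂ) (v : Fin 6 → ℂ) : alt m v ∈ R.matrix ↔
    (v 0 ∈ R ∧ v 1 ∈ R ∧ v 4 ∈ R ∧ v 5 ∈ R ∧ v 2 + v 3 * omega m ∈ R ∧
      v 2 + v 3 * starRingEnd ℂ (omega m) ∈ R) := by
  rw [mem_matrix]
  constructor
  · intro h
    refine ⟨?_, ?_, ?_, ?_, ?_, ?_⟩
    · simpa [alt, altBlock] using h (.inl 1) (.inl 0)
    · simpa [alt, altBlock, ofCoord, mid] using h (.inl 0) (.inr 1)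
    · simpa [alt, altBlock, ofCoord, mid] using h (.inr 0) (.inl 1)
    · simpa [alt, altBlock] using h (.inr 0) (.inr 1)
    · simpa [alt, altBlock, ofCoord, mid] using h (.inr 0) (.inl 0)
    · simpa [alt, altBlock, ofCoord, mid] using h (.inl 1) (.inr 1)
  · rintro ⟨h0, h1, h4, h5, h2, h3⟩ i j
    have n2 := neg_mem h2
    have n3 := neg_mem h3
    rw [neg_add] at n2 n3
    rcases i with i | i <;> rcases j with j | j <;> fin_cases i <;> fin_cases j <;>
      simp [alt, altBlock, ofCoord, mid, add_comm, *]

/-- For real coefficients, `v 2 + v 3 ω ∈ 𝓞` determines both as integers, because `1` and `ω` are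
independent over `ℝ`. -/
lemma alt_mem_OO_iff {m : ℕ} (hm : Squarefree m) (v : Fin 6 → ℝ) :
    alt m (fun j => (v j : ℂ)) ∈ (OO m).matrix ↔ ∃ w : Fin 6 → ℤ, ∀ j, v j = w j := by
  rw [alt_mem_matrix_iff]
  constructor
  · rintro ⟨h0, h1, h4, h5, h2, -⟩
    obtain ⟨n0, e0⟩ := int_of_real_mem_OO hm h0
    obtain ⟨n1, e1⟩ := int_of_real_mem_OO hm h1
    obtain ⟨n4, e4⟩ := int_of_real_mem_OO hm h4
    obtain ⟨n5, e5⟩ := int_of_real_mem_OO hm h5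
    obtain ⟨a, b, e⟩ := (mem_OO_iff hm _).mp h2
    have him := congrArg Complex.im e
    have hre := congrArg Complex.re e
    simp [omega_im_ne_zero hm.ne_zero] at him
    simp [him] at hre
    refine ⟨![n0, n1, a, b, n4, n5], fun j => ?_⟩
    fin_cases j
    exacts [e0, e1, hre, him, e4, e5]
  · rintro ⟨w, h⟩
    simp only [h, Complex.ofReal_intCast]
    exact ⟨intCast_mem _ _, intCast_mem _ _, intCast_mem _ _, intCast_mem _ _,
      add_mem (intCast_mem _ _) (mul_mem (intCast_mem _ _) (omega_mem_OO m)),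
      add_mem (intCast_mem _ _) (mul_mem (intCast_mem _ _) (conj_mem_OO (omega_mem_OO m)))⟩

/-- The field `ℚ(√-m)` as a subring of `ℂ`. -/
def KK (m : ℕ) : Subring ℂ := (K m).toSubfield.toSubring

lemma OO_le_KK (m : ℕ) : OO m ≤ KK m := fun _ hx => ((mem_OO_iff_isIntegral m _).mp hx).1

lemma alt_mem_KK_iff {m : ℕ} (hm : m ≠ 0) (v : Fin 6 → ℝ) :
    alt m (fun j => (v j : ℂ)) ∈ (KK m).matrix ↔ ∃ w : Fin 6 → ℚ, ∀ j, v j = w j := by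
  have hw : omega m ∈ KK m := omega_mem_K m
  have hw' : starRingEnd ℂ (omega m) ∈ KK m := conj_mem_K (omega_mem_K m)
  rw [alt_mem_matrix_iff]
  constructor
  · rintro ⟨h0, h1, h4, h5, h2, h3⟩
    obtain ⟨n0, e0⟩ := rat_of_real_mem_K hm h0
    obtain ⟨n1, e1⟩ := rat_of_real_mem_K hm h1
    obtain ⟨n4, e4⟩ := rat_of_real_mem_K hm h4
    obtain ⟨n5, e5⟩ := rat_of_real_mem_K hm h5
    have hd : (v 3 : ℂ) ∈ K m := by
      have : (v 3 : ℂ) = (v 2 + v 3 * omega m - (v 2 + v 3 * starRingEnd ℂ (omega m))) *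
          (diffOmega m)⁻¹ := by
        have := diffOmega_ne_zero hm
        field_simp
        rw [diffOmega]; ring
      rw [this]
      exact mul_mem (sub_mem h2 h3) (inv_mem (OO_le_KK m (diffOmega_mem_OO m)))
    have hd' : (v 2 : ℂ) ∈ K m := by
      have : (v 2 : ℂ) = (v 2 + v 3 * omega m) - v 3 * omega m := by ring
      rw [this]
      exact sub_mem h2 (mul_mem hd hw)
    obtain ⟨n2, e2⟩ := rat_of_real_mem_K hm hd'
    obtain ⟨n3, e3⟩ := rat_of_real_mem_K hm hd
    refine ⟨![n0, n1, n2, n3, n4, n5], fun j => ?_⟩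
    fin_cases j
    exacts [e0, e1, e2, e3, e4, e5]
  · rintro ⟨w, h⟩
    have hq : ∀ q : ℚ, (q : ℂ) ∈ KK m := fun q => SubfieldClass.ratCast_mem (K m) q
    simp only [h, Complex.ofReal_ratCast]
    exact ⟨hq _, hq _, hq _, hq _, add_mem (hq _) (mul_mem (hq _) hw),
      add_mem (hq _) (mul_mem (hq _) hw')⟩

lemma alt_add (m : ℕ) (v w : Fin 6 → ℂ) : alt m (v + w) = alt m v + alt m w := by
  ext i j
  rcases i with i | i <;> rcases j with j | j <;> fin_cases i <;> fin_cases j <;>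
    simp [alt, altBlock, ofCoord, mid] <;> ring

lemma alt_neg (m : ℕ) (v : Fin 6 → ℂ) : alt m (-v) = -alt m v := by
  ext i j
  rcases i with i | i <;> rcases j with j | j <;> fin_cases i <;> fin_cases j <;>
    simp [alt, altBlock, ofCoord, mid] <;> ring

lemma alt_sub (m : ℕ) (v w : Fin 6 → ℂ) : alt m (v - w) = alt m v - alt m w := by
  rw [sub_eq_add_neg, alt_add, alt_neg, sub_eq_add_neg]

/-! ### The dual lattice and the discriminant kernel -/

/-- The inverse of the matrix `S₁`. -/
def S1inv (m : ℕ) : Matrix (Fin 6) (Fin 6) ℝ :=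
  let D := (2 * (omega m).im) ^ 2
  block6 0 0 1 0
    !![0, 0, 0, 1; 0, -2 * Complex.normSq (omega m) / D, 2 * (omega m).re / D, 0;
      0, 2 * (omega m).re / D, -2 / D, 0; 1, 0, 0, 0] 0 1 0 0

lemma S1_mul_S1inv {m : ℕ} (hm : m ≠ 0) : S1 m * S1inv m = 1 := by
  have h := normSq_omega_sub m
  have hD : (2 * (omega m).im) ^ 2 ≠ 0 := by
    have := omega_im_ne_zero hm
    positivity
  unfold S1inv
  dsimp only
  generalize (2 * (omega m).im) ^ 2 = D at *
  ext i j
  fin_cases i <;> fin_cases j <;>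
    simp [S1, S0, S, block6, Matrix.mul_apply, Fin.sum_univ_succ] <;> field_simp <;>
    first | linear_combination h | ring

lemma sq_two_im (m : ℕ) : ((2 * ((omega m).im : ℂ)) ^ 2) = -diffOmega m ^ 2 := by
  rw [diffOmega, Complex.sub_conj]
  push_cast
  rw [mul_pow _ Complex.I, Complex.I_sq]
  ring

/-- The columns of `S₁⁻¹` generate the dual lattice. Only the two middle ones carry the denominator,
and both reduce to `J / (ω - ω̄)` up to integral operations. -/
lemma alt_S1inv_two {m : ℕ} (hm : m ≠ 0) : alt m (fun k => (S1inv m k 2 : ℂ)) =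
    -(omega m) • (diffOmega m)⁻¹ • Matrix.J (Fin 2) ℂ - wedge (.inl 1) (.inr 1) := by
  have hd := diffOmega_ne_zero hm
  ext i j
  rcases i with i | i <;> rcases j with j | j <;> fin_cases i <;> fin_cases j <;>
    simp [S1inv, block6, alt, altBlock, ofCoord, mid, wedge, Matrix.J, two_re_omega,
      Complex.normSq_eq_conj_mul_self]
  all_goals rw [sq_two_im]; field_simp; rw [diffOmega]; ring

lemma alt_S1inv_three {m : ℕ} (hm : m ≠ 0) : alt m (fun k => (S1inv m k 3 : ℂ)) =
    (diffOmega m)⁻¹ • Matrix.J (Fin 2) ℂ := by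
  have hd := diffOmega_ne_zero hm
  ext i j
  rcases i with i | i <;> rcases j with j | j <;> fin_cases i <;> fin_cases j <;>
    simp [S1inv, block6, alt, altBlock, ofCoord, mid, Matrix.J, two_re_omega]
  all_goals rw [sq_two_im]; field_simp; rw [diffOmega]; ring

lemma alt_S1inv (m : ℕ) :
    alt m (fun k => (S1inv m k 0 : ℂ)) = wedge (.inr 0) (.inr 1) ∧
    alt m (fun k => (S1inv m k 1 : ℂ)) = -wedge (.inl 1) (.inr 0) ∧
    alt m (fun k => (S1inv m k 4 : ℂ)) = wedge (.inl 0) (.inr 1) ∧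
    alt m (fun k => (S1inv m k 5 : ℂ)) = -wedge (.inl 0) (.inl 1) := by
  refine ⟨?_, ?_, ?_, ?_⟩ <;> ext i j <;>
  rcases i with i | i <;> rcases j with j | j <;> fin_cases i <;> fin_cases j <;>
    simp [S1inv, block6, alt, altBlock, ofCoord, mid, wedge]

/-- The matrices `X` whose image `M X Mᵗʳ` is congruent to `X` modulo matrices over `R`. -/
def fixedMod (R : Subring ℂ) (M : Matrix I4 I4 ℂ) : AddSubgroup (Matrix I4 I4 ℂ) where
  carrier := {X | M * X * Mᵀ - X ∈ R.matrix}
  zero_mem' := by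
    have : M * 0 * Mᵀ - 0 = 0 := by simp
    change M * 0 * Mᵀ - 0 ∈ R.matrix
    rw [this]; exact zero_mem _
  add_mem' {X Y} hX hY := by
    change M * (X + Y) * Mᵀ - (X + Y) ∈ R.matrix
    have : M * (X + Y) * Mᵀ - (X + Y) = (M * X * Mᵀ - X) + (M * Y * Mᵀ - Y) := by noncomm_ring
    rw [this]; exact add_mem hX hY
  neg_mem' {X} hX := by
    change M * (-X) * Mᵀ - (-X) ∈ R.matrix
    have : M * (-X) * Mᵀ - (-X) = -(M * X * Mᵀ - X) := by noncomm_ring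
    rw [this]; exact neg_mem hX

lemma mem_fixedMod {R : Subring ℂ} {M X : Matrix I4 I4 ℂ} :
    X ∈ fixedMod R M ↔ M * X * Mᵀ - X ∈ R.matrix := Iff.rfl

lemma smul_mem_fixedMod {R : Subring ℂ} {M X : Matrix I4 I4 ℂ} {c : ℂ} (hc : c ∈ R)
    (hX : X ∈ fixedMod R M) : c • X ∈ fixedMod R M := by
  rw [mem_fixedMod] at *
  have : M * (c • X) * Mᵀ - (c • X) = c • (M * X * Mᵀ - X) := by
    rw [Matrix.mul_smul, Matrix.smul_mul, smul_sub]
  rw [this]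
  exact smul_mem_matrix hc hX

lemma wedge_self (i : I4) : wedge i i = 0 := sub_self _

lemma wedge_swap (i j : I4) : wedge j i = -wedge i j := (neg_sub _ _).symm

lemma wedge_mem_of_six {G : AddSubgroup (Matrix I4 I4 ℂ)}
    (h1 : wedge (.inl 0) (.inl 1) ∈ G) (h2 : wedge (.inl 0) (.inr 0) ∈ G)
    (h3 : wedge (.inl 0) (.inr 1) ∈ G) (h4 : wedge (.inl 1) (.inr 0) ∈ G)
    (h5 : wedge (.inl 1) (.inr 1) ∈ G) (h6 : wedge (.inr 0) (.inr 1) ∈ G) (i j : I4) :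
    wedge i j ∈ G := by
  have s : ∀ {i j}, wedge i j ∈ G → wedge j i ∈ G := by
    intro i j h
    rw [wedge_swap]
    exact neg_mem h
  have z : ∀ i, wedge i i ∈ G := fun i => by rw [wedge_self]; exact zero_mem _
  revert i j
  simp only [Sum.forall, Fin.forall_fin_two]
  exact ⟨⟨⟨⟨z _, h1⟩, h2, h3⟩, ⟨s h1, z _⟩, h4, h5⟩,
    ⟨⟨s h2, s h4⟩, z _, h6⟩, ⟨s h3, s h5⟩, s h6, z _⟩

lemma J_eq_wedge : Matrix.J (Fin 2) ℂ =
    -(wedge (.inl 0) (.inr 0)) - wedge (.inl 1) (.inr 1) := by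
  ext i j
  rcases i with i | i <;> rcases j with j | j <;> fin_cases i <;> fin_cases j <;>
    simp [wedge, Matrix.J]

lemma forall_alt_S1inv_mem_iff {m : ℕ} (h0 : m ≠ 0) {R : Subring ℂ} (hw : omega m ∈ R)
    (hd : diffOmega m ∈ R) (M : Matrix I4 I4 ℂ) :
    (∀ j, alt m (fun k => (S1inv m k j : ℂ)) ∈ fixedMod R M) ↔
      (∀ i j, wedge i j ∈ fixedMod R M) ∧
        (diffOmega m)⁻¹ • Matrix.J (Fin 2) ℂ ∈ fixedMod R M := by
  obtain ⟨a0, a1, a4, a5⟩ := alt_S1inv m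
  have a2 := alt_S1inv_two h0
  have a3 := alt_S1inv_three h0
  constructor
  · intro h
    have b0 := h 0
    have b1 := h 1
    have b2 := h 2
    have b3 := h 3
    have b4 := h 4
    have b5 := h 5
    rw [a0] at b0
    rw [a1, neg_mem_iff] at b1
    rw [a2] at b2
    rw [a3] at b3
    rw [a4] at b4
    rw [a5, neg_mem_iff] at b5
    refine ⟨?_, b3⟩
    have b6 : wedge (.inl 1) (.inr 1) ∈ fixedMod R M := by
      have := sub_mem (smul_mem_fixedMod (neg_mem hw) b3) b2
      simpa using this
    -- Multiplying column three by `ω - ω̄` gives `J`, minus the sum of two elementary bivectors;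
    -- one is known, so the other follows.
    have b7 : wedge (.inl 0) (.inr 0) ∈ fixedMod R M := by
      have := smul_mem_fixedMod hd b3
      rw [smul_smul, mul_inv_cancel₀ (diffOmega_ne_zero h0), one_smul, J_eq_wedge] at this
      have := neg_mem (add_mem this b6)
      simpa using this
    exact wedge_mem_of_six b5 b7 b4 b1 b6 b0
  · rintro ⟨hW, hJ⟩ j
    fin_cases j
    · exact a0 ▸ hW _ _
    · exact a1 ▸ neg_mem (hW _ _)
    · exact a2 ▸ sub_mem (smul_mem_fixedMod (neg_mem hw) hJ) (hW _ _)
    · exact a3 ▸ hJ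
    · exact a4 ▸ hW _ _
    · exact a5 ▸ neg_mem (hW _ _)

/-- Membership in the discriminant kernel in terms of alternating matrices. -/
lemma toSO0_mem_Sigma_iff {m : ℕ} (hm : Squarefree m) (M : SU22) :
    toSO0 hm.ne_zero M ∈ Sigma m ↔ (∀ i j, wedge i j ∈ fixedMod (OO m) (mat4 M)) ∧
      (diffOmega m)⁻¹ • Matrix.J (Fin 2) ℂ ∈ fixedMod (OO m) (mat4 M) := by
  have h0 := hm.ne_zero
  have key : toSO0 h0 M ∈ Sigma m ↔
      ∀ j, alt m (fun k => (S1inv m k j : ℂ)) ∈ fixedMod (OO m) (mat4 M) := by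
    -- Multiplication by `S₁⁻¹` on the right: the condition `N ∈ 1 + P S₁` says that `(N - 1) S₁⁻¹`
    -- is integral, which can be tested column by column.
    have h1 : toSO0 h0 M ∈ Sigma m ↔ ∃ P : Matrix (Fin 6) (Fin 6) ℤ,
        tildeRe m M * S1inv m - S1inv m = P.map (fun a : ℤ => (a : ℝ)) := by
      constructor
      · rintro ⟨P, hP⟩
        refine ⟨P, ?_⟩
        rw [← mat6_toSO0 h0, hP, Matrix.add_mul, Matrix.one_mul, Matrix.mul_assoc,
          S1_mul_S1inv h0, Matrix.mul_one, add_sub_cancel_left]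
      · rintro ⟨P, hP⟩
        refine ⟨P, ?_⟩
        rw [← hP, Matrix.sub_mul, Matrix.mul_assoc, mul_eq_one_comm.mp (S1_mul_S1inv h0),
          Matrix.mul_one, mat6_toSO0]
        abel
    have h2 : ∀ j, alt m (fun k => (S1inv m k j : ℂ)) ∈ fixedMod (OO m) (mat4 M) ↔
        ∃ w : Fin 6 → ℤ, ∀ k, (tildeRe m M * S1inv m - S1inv m) k j = w k := by
      intro j
      rw [mem_fixedMod, mat4_mul_alt_ofReal_mul h0, ← alt_sub, ← alt_mem_OO_iff hm]
      have : ((fun k => (((tildeRe m M *ᵥ fun l => S1inv m l j) k : ℝ) : ℂ)) -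
          fun k => (S1inv m k j : ℂ)) =
          fun k => (((tildeRe m M * S1inv m - S1inv m) k j : ℝ) : ℂ) := by
        ext k
        simp [Matrix.mul_apply, Matrix.mulVec, dotProduct]
      rw [this]
    rw [h1]
    simp_rw [h2]
    constructor
    · rintro ⟨P, hP⟩ j
      exact ⟨fun k => P k j, fun k => by rw [hP]; rfl⟩
    · intro h
      choose w hw using h
      exact ⟨Matrix.of fun k j => w j k, by ext k j; rw [hw]; rfl⟩
  rw [key, forall_alt_S1inv_mem_iff h0 (omega_mem_OO m) (diffOmega_mem_OO m)]

lemma J_mem_matrix (R : Subring ℂ) : Matrix.J (Fin 2) ℂ ∈ R.matrix := by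
  rw [J_eq_wedge]
  exact sub_mem (neg_mem (wedge_mem_matrix _ _ _)) (wedge_mem_matrix _ _ _)

/-- Replacing the subtracted `J` by `M J Mᴴ` allows `M J` to be factored out. The condition on `J /
(ω - ω̄)` becomes one on `(Mᵗʳ - Mᴴ) / (ω - ω̄)`, which is integral for integral `M` since `x - x̄ ∈
ℤ (ω - ω̄)`. -/
lemma mul_smul_J_mul_transpose_sub (c : ℂ) (M : SU22) :
    mat4 M * (c • Matrix.J (Fin 2) ℂ) * (mat4 M)ᵀ - c • Matrix.J (Fin 2) ℂ =
      mat4 M * Matrix.J (Fin 2) ℂ * (c • ((mat4 M)ᵀ - (mat4 M)ᴴ)) := by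
  conv_lhs => rw [← mat4_unitary' M]
  rw [mat4_unitary', Matrix.mul_smul, Matrix.smul_mul, Matrix.mul_smul, Matrix.mul_sub,
    mat4_unitary', smul_sub]

lemma toSO0_mem_Sigma_of_integral {m : ℕ} (hm : Squarefree m) {M : SU22}
    (hM : mat4 M ∈ (OO m).matrix) : toSO0 hm.ne_zero M ∈ Sigma m := by
  rw [toSO0_mem_Sigma_iff hm]
  refine ⟨fun i j => ?_, ?_⟩
  · rw [mem_fixedMod]
    exact sub_mem (mul_mem (mul_mem hM (wedge_mem_matrix _ i j)) (transpose_mem_matrix hM))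
      (wedge_mem_matrix _ i j)
  · rw [mem_fixedMod]
    have hd := diffOmega_ne_zero hm.ne_zero
    rw [mul_smul_J_mul_transpose_sub]
    refine mul_mem (mul_mem hM (J_mem_matrix _)) (mem_matrix.mpr fun i j => ?_)
    obtain ⟨a, b, -, h⟩ := sub_conj_of_mem_OO hm (mem_matrix.mp hM j i)
    have : ((diffOmega m)⁻¹ • ((mat4 M)ᵀ - (mat4 M)ᴴ)) i j = b := by
      change (diffOmega m)⁻¹ * (mat4 M j i - starRingEnd ℂ (mat4 M j i)) = b
      rw [h]
      field_simp
    rw [this]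
    exact intCast_mem _ b

/-! ### Integrality of the products `M_{ij} M̄_{kl}` -/

lemma third_index (i k : I4) : ∃ j, j ≠ i ∧ j ≠ k := by
  revert i k
  decide

lemma mul_wedge_add_apply (E : Matrix I4 I4 ℂ) (i j k l : I4) :
    (E * wedge i j + wedge i j * Eᵀ) k l =
      (if j = l then E k i else 0) - (if i = l then E k j else 0) +
      ((if i = k then E l j else 0) - (if j = k then E l i else 0)) := by
  have h1 : ∀ i j : I4, (E * Matrix.single i j (1 : ℂ) : Matrix I4 I4 ℂ) k l =
      if j = l then E k i else 0 := by
    intro i j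
    split_ifs with h
    · subst h; simp
    · rw [Matrix.mul_single_apply_of_ne _ _ _ _ _ (Ne.symm h)]
  have h2 : ∀ i j : I4, (Matrix.single i j (1 : ℂ) * Eᵀ : Matrix I4 I4 ℂ) k l =
      if i = k then E l j else 0 := by
    intro i j
    split_ifs with h
    · subst h; simp
    · rw [Matrix.single_mul_apply_of_ne _ _ _ _ _ (Ne.symm h)]
  rw [wedge, Matrix.mul_sub, Matrix.sub_mul, Matrix.add_apply, Matrix.sub_apply,
    Matrix.sub_apply, h1, h1, h2, h2]

/-- The derived action on bivectors exhibits the off-diagonal entries of `E` and the sums `E i i + E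
j j`, hence `2 E i i`. Because `E² = 0`, the square `(E i i)²` is a polynomial in off-diagonal
entries, and `hR` removes the factor two. -/
lemma mem_matrix_of_wedge {R : Subring ℂ} (hR : ∀ x, 2 * x ∈ R → x ^ 2 ∈ R → x ∈ R)
    {E : Matrix I4 I4 ℂ} (hE : E * E = 0)
    (h : ∀ i j, E * wedge i j + wedge i j * Eᵀ ∈ R.matrix) : E ∈ R.matrix := by
  have off : ∀ k i, k ≠ i → E k i ∈ R := by
    intro k i hki
    obtain ⟨j, hji, hjk⟩ := third_index i k
    have := mem_matrix.mp (h i j) k j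
    rw [mul_wedge_add_apply] at this
    simpa [hji.symm, hjk, hki.symm] using this
  have diag : ∀ i j, i ≠ j → E i i + E j j ∈ R := by
    intro i j hij
    have := mem_matrix.mp (h i j) i j
    rw [mul_wedge_add_apply] at this
    simpa [hij, hij.symm] using this
  rw [mem_matrix]
  intro i j
  by_cases hij : i = j
  · subst hij
    apply hR
    · obtain ⟨j, hji, -⟩ := third_index i i
      obtain ⟨k, hki, hkj⟩ := third_index i j
      have : 2 * E i i = (E i i + E j j) + (E i i + E k k) - (E k k + E j j) := by ring
      rw [this]
      exact sub_mem (add_mem (diag _ _ hji.symm) (diag _ _ hki.symm)) (diag _ _ hkj)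
    · have h0 : (E * E) i i = 0 := by rw [hE]; rfl
      rw [Matrix.mul_apply, ← Finset.add_sum_erase _ _ (Finset.mem_univ i)] at h0
      have : E i i ^ 2 = -∑ x ∈ Finset.univ.erase i, E i x * E x i := by
        linear_combination h0
      rw [this]
      refine neg_mem (sum_mem fun x hx => ?_)
      have hx := Finset.ne_of_mem_erase hx
      exact mul_mem (off _ _ hx.symm) (off _ _ hx)
  · exact off i j hij

lemma vecMulVec_mul_wedge_mul (a b : I4 → ℂ) (i j : I4) :
    Matrix.vecMulVec a b * wedge i j * (Matrix.vecMulVec a b)ᵀ = 0 := by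
  ext k l
  rw [mul_wedge_mul_apply]
  simp only [Matrix.vecMulVec_apply, Matrix.zero_apply]
  ring

lemma mat4_mul_inv (M : SU22) : mat4 M * mat4 M⁻¹ = 1 := by
  rw [← mat4_mul, mul_inv_cancel, mat4_one]

lemma mat4_inv_mul (M : SU22) : mat4 M⁻¹ * mat4 M = 1 := by
  rw [← mat4_mul, inv_mul_cancel, mat4_one]

/-- If a conjugate of `1 + v wᵗʳ` acts integrally on alternating matrices, then the conjugate of
`v wᵗʳ` is integral. -/
lemma conj_vecMulVec_mem {R : Subring ℂ} (hR : ∀ x, 2 * x ∈ R → x ^ 2 ∈ R → x ∈ R) (M T : SU22)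
    {v w : I4 → ℂ} (hvw : w ⬝ᵥ v = 0) (hT : mat4 T = 1 + Matrix.vecMulVec v w)
    (h : ∀ i j, wedge i j ∈ fixedMod R (mat4 (M * T * M⁻¹))) :
    mat4 M * Matrix.vecMulVec v w * mat4 M⁻¹ ∈ R.matrix := by
  have e : mat4 M * Matrix.vecMulVec v w * mat4 M⁻¹ =
      Matrix.vecMulVec (mat4 M *ᵥ v) (w ᵥ* mat4 M⁻¹) := by
    rw [Matrix.mul_vecMulVec, Matrix.vecMulVec_mul]
  have hconj : mat4 (M * T * M⁻¹) = 1 + mat4 M * Matrix.vecMulVec v w * mat4 M⁻¹ := by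
    rw [mat4_mul, mat4_mul, hT, Matrix.mul_add, Matrix.add_mul, Matrix.mul_one, mat4_mul_inv]
  apply mem_matrix_of_wedge hR
  -- Conjugation preserves the trace `w ⬝ᵥ v = 0` of the rank one matrix, so its square is zero.
  · rw [e, Matrix.vecMulVec_mul_vecMulVec, ← Matrix.dotProduct_mulVec, Matrix.mulVec_mulVec,
      mat4_inv_mul, Matrix.one_mulVec, hvw]
    simp
  · intro i j
    have := h i j
    rw [mem_fixedMod, hconj] at this
    -- A rank one matrix has no nonzero `2 × 2` minor; the quadratic term disappears and only the
    -- derived action remains.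
    have z : mat4 M * Matrix.vecMulVec v w * mat4 M⁻¹ * wedge i j *
        (mat4 M * Matrix.vecMulVec v w * mat4 M⁻¹)ᵀ = 0 := by
      rw [e]; exact vecMulVec_mul_wedge_mul _ _ i j
    generalize mat4 M * Matrix.vecMulVec v w * mat4 M⁻¹ = E at *
    have e2 : (1 + E) * wedge i j * (1 + E)ᵀ - wedge i j = E * wedge i j + wedge i j * Eᵀ := by
      rw [Matrix.transpose_add, Matrix.transpose_one]
      calc _ = E * wedge i j + wedge i j * Eᵀ + E * wedge i j * Eᵀ := by noncomm_ring
        _ = _ := by rw [z, add_zero]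
    rwa [e2] at this

/-- The matrices whose conjugate by `M` has entries in `R`. -/
def conjOver (R : Subring ℂ) (M : SU22) : Subring (Matrix I4 I4 ℂ) where
  carrier := {X | mat4 M * X * mat4 M⁻¹ ∈ R.matrix}
  zero_mem' := by
    change mat4 M * 0 * mat4 M⁻¹ ∈ R.matrix
    rw [Matrix.mul_zero, Matrix.zero_mul]; exact zero_mem _
  one_mem' := by
    change mat4 M * 1 * mat4 M⁻¹ ∈ R.matrix
    rw [Matrix.mul_one, mat4_mul_inv]; exact one_mem _
  add_mem' {X Y} hX hY := by
    change mat4 M * (X + Y) * mat4 M⁻¹ ∈ R.matrix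
    rw [Matrix.mul_add, Matrix.add_mul]; exact add_mem hX hY
  neg_mem' {X} hX := by
    change mat4 M * (-X) * mat4 M⁻¹ ∈ R.matrix
    rw [Matrix.mul_neg, Matrix.neg_mul]; exact neg_mem hX
  mul_mem' {X Y} hX hY := by
    change mat4 M * (X * Y) * mat4 M⁻¹ ∈ R.matrix
    have : mat4 M * (X * Y) * mat4 M⁻¹ =
        (mat4 M * X * mat4 M⁻¹) * (mat4 M * Y * mat4 M⁻¹) := by
      calc _ = mat4 M * X * (mat4 M⁻¹ * mat4 M) * Y * mat4 M⁻¹ := by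
            rw [mat4_inv_mul]; simp only [Matrix.mul_assoc, Matrix.one_mul]
        _ = _ := by simp only [Matrix.mul_assoc]
    rw [this]; exact mul_mem hX hY

/-- A subring of matrices containing five particular matrices contains all elementary ones. -/
lemma single_mem_of_five {A : Subring (Matrix I4 I4 ℂ)}
    (h1 : Matrix.single (.inl 0) (.inr 0) 1 ∈ A) (h2 : Matrix.single (.inr 0) (.inl 0) 1 ∈ A)
    (h3 : Matrix.single (.inl 1) (.inr 1) 1 ∈ A) (h4 : Matrix.single (.inr 1) (.inl 1) 1 ∈ A)
    (h5 : Matrix.vecMulVec (Sum.elim 1 0) (Sum.elim 0 1) ∈ A) (i j : I4) :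
    Matrix.single i j 1 ∈ A := by
  have mul : ∀ {i j k : I4}, Matrix.single i j (1 : ℂ) ∈ A → Matrix.single j k (1 : ℂ) ∈ A →
      Matrix.single i k (1 : ℂ) ∈ A := by
    intro i j k h h'
    have := A.mul_mem h h'
    rwa [Matrix.single_mul_single_same, one_mul] at this
  have l0 := mul h1 h2
  have r0 := mul h2 h1
  have l1 := mul h3 h4
  have r1 := mul h4 h3
  -- The fifth matrix has all ones in its upper right block; multiplying it by diagonal idempotents
  -- on both sides isolates one entry.
  have a : Matrix.single (.inl 0) (.inr 1) (1 : ℂ) ∈ A := by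
    have := A.mul_mem (A.mul_mem l0 h5) r1
    simpa [Matrix.single_mul_mul_single, Matrix.vecMulVec_apply] using this
  have b : Matrix.single (.inl 1) (.inr 0) (1 : ℂ) ∈ A := by
    have := A.mul_mem (A.mul_mem l1 h5) r0
    simpa [Matrix.single_mul_mul_single, Matrix.vecMulVec_apply] using this
  have c := mul a h4
  have d := mul b h2
  revert i j
  simp only [Sum.forall, Fin.forall_fin_two]
  exact ⟨⟨⟨⟨l0, c⟩, h1, a⟩, ⟨d, l1⟩, b, h3⟩,
    ⟨⟨h2, mul h2 c⟩, r0, mul h2 a⟩, ⟨mul h4 d, h4⟩, mul h4 b, r1⟩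

/-- If conjugation by `M` carries the integral elements of `SU(2,2)` to matrices acting integrally
on alternating matrices, then the products `M_{ij} \bar M_{kl}` are integral. -/
lemma mul_conj_mem_of_fixedMod {R : Subring ℂ} (hR : ∀ x, 2 * x ∈ R → x ^ 2 ∈ R → x ∈ R) (M : SU22)
    (h : ∀ T : SU22, (∀ i j, ∃ n : ℤ, mat4 T i j = n) →
      ∀ i j, wedge i j ∈ fixedMod R (mat4 (M * T * M⁻¹)))
    (i j k l : I4) : mat4 M i j * starRingEnd ℂ (mat4 M k l) ∈ R := by
  -- It suffices to use integral transvections `1 + v wᵗʳ` with `w ⬝ᵥ v = 0`; their rank one parts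
  -- generate all elementary matrices.
  have key : ∀ (T : SU22) (v w : I4 → ℤ), (w ⬝ᵥ v = 0) →
      mat4 T = 1 + Matrix.vecMulVec (fun i => (v i : ℂ)) (fun i => (w i : ℂ)) →
      Matrix.vecMulVec (fun i => (v i : ℂ)) (fun i => (w i : ℂ)) ∈ conjOver R M := by
    intro T v w hvw hT
    refine conj_vecMulVec_mem hR M T ?_ hT (h T fun i j => ?_)
    · have : ((w ⬝ᵥ v : ℤ) : ℂ) = 0 := by rw [hvw]; simp
      rw [← this]
      simp [dotProduct]
    · rw [hT]
      refine ⟨(1 : Matrix I4 I4 ℤ) i j + v i * w j, ?_⟩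
      rcases eq_or_ne i j with rfl | hij <;> simp [*, Matrix.vecMulVec_apply]
  have hs : ∀ i : Fin 2, (Matrix.single i i (1 : ℂ))ᴴ = Matrix.single i i 1 := by
    intro i; simp
  have hu : ∀ i : Fin 2, Matrix.single (Sum.inl i : I4) (Sum.inr i : I4) (1 : ℂ) ∈
      conjOver R M := by
    intro i
    have := key (upper _ (hs i)) (Pi.single (.inl i) 1) (Pi.single (.inr i) 1) (by simp) (by
      rw [mat4_upper]
      ext a b
      rcases a with a | a <;> rcases b with b | b <;> fin_cases i <;> fin_cases a <;>
        fin_cases b <;> simp [Matrix.vecMulVec_apply])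
    convert this using 1
    ext a b
    rcases a with a | a <;> rcases b with b | b <;> fin_cases i <;> fin_cases a <;>
        fin_cases b <;> simp [Matrix.vecMulVec_apply]
  have hl : ∀ i : Fin 2, Matrix.single (Sum.inr i : I4) (Sum.inl i : I4) (1 : ℂ) ∈
      conjOver R M := by
    intro i
    have := key (lower _ (hs i)) (Pi.single (.inr i) 1) (Pi.single (.inl i) 1) (by simp) (by
      rw [mat4_lower]
      ext a b
      rcases a with a | a <;> rcases b with b | b <;> fin_cases i <;> fin_cases a <;>
        fin_cases b <;> simp [Matrix.vecMulVec_apply])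
    convert this using 1
    ext a b
    rcases a with a | a <;> rcases b with b | b <;> fin_cases i <;> fin_cases a <;>
        fin_cases b <;> simp [Matrix.vecMulVec_apply]
  have ho : Matrix.vecMulVec (Sum.elim 1 0) (Sum.elim 0 1) ∈ conjOver R M := by
    have := key (upper (Matrix.of fun _ _ => 1) (by ext; simp)) (Sum.elim 1 0) (Sum.elim 0 1)
      (by simp [dotProduct]) (by
      rw [mat4_upper]
      ext a b
      rcases a with a | a <;> rcases b with b | b <;> simp [Matrix.vecMulVec_apply]
      · simp [Matrix.one_apply]
      · simp [Matrix.one_apply])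
    convert this using 1
    ext a b
    rcases a with a | a <;> rcases b with b | b <;> simp [Matrix.vecMulVec_apply]
  have all := single_mem_of_five (hu 0) (hl 0) (hu 1) (hl 1) ho
  have hJ : Matrix.J (Fin 2) ℂ ∈ conjOver R M := by
    rw [J_eq_wedge]
    exact sub_mem (neg_mem (sub_mem (all _ _) (all _ _))) (sub_mem (all _ _) (all _ _))
  -- Since `M⁻¹ = -J Mᴴ J`, integrality of `M (E_{jl} J) M⁻¹` is that of `M E_{jl} Mᴴ`, whose `(i,
  -- k)` entry is `M_{ij} M̄_{kl}`.
  have hmem : mat4 M * Matrix.single j l 1 * (mat4 M)ᴴ ∈ R.matrix := by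
    have h1 : mat4 M * (Matrix.single j l 1 * Matrix.J (Fin 2) ℂ) * mat4 M⁻¹ ∈ R.matrix :=
      (conjOver R M).mul_mem (all j l) hJ
    have h2 := neg_mem (mul_mem h1 (J_mem_matrix R))
    have e : -(mat4 M * (Matrix.single j l 1 * Matrix.J (Fin 2) ℂ) * mat4 M⁻¹ *
        Matrix.J (Fin 2) ℂ) = mat4 M * Matrix.single j l 1 * (mat4 M)ᴴ := by
      rw [mat4_inv]
      calc _ = mat4 M * Matrix.single j l 1 * (Matrix.J (Fin 2) ℂ * Matrix.J (Fin 2) ℂ) *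
            (mat4 M)ᴴ * (Matrix.J (Fin 2) ℂ * Matrix.J (Fin 2) ℂ) := by noncomm_ring
        _ = _ := by rw [J_mul_J]; noncomm_ring
    rwa [e] at h2
  have := mem_matrix.mp hmem i k
  rw [Matrix.mul_apply, Finset.sum_eq_single l] at this
  · simpa using this
  · intro b _ hb
    rw [Matrix.mul_single_apply_of_ne _ _ _ _ _ hb, zero_mul]
  · simp

/-! ### Conjugation of the discriminant kernel -/

lemma mem_matrix_intCast_iff {X : Matrix (Fin 6) (Fin 6) ℝ} :
    X ∈ (Int.castRingHom ℝ).range.matrix ↔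
      ∃ P : Matrix (Fin 6) (Fin 6) ℤ, X = P.map (fun a : ℤ => (a : ℝ)) := by
  constructor
  · intro h
    choose P hP using h
    exact ⟨Matrix.of P, by ext i j; exact (hP i j).symm⟩
  · rintro ⟨P, rfl⟩ i j
    exact ⟨P i j, rfl⟩

lemma mem_SigmaStar_iff {m : ℕ} {N : SO0 m} :
    N ∈ SigmaStar m ↔ mat6 N ∈ (Int.castRingHom ℝ).range.matrix :=
  mem_matrix_intCast_iff.symm

lemma mem_Sigma_iff {m : ℕ} {N : SO0 m} :
    N ∈ Sigma m ↔ ∃ P ∈ (Int.castRingHom ℝ).range.matrix, mat6 N = 1 + P * S1 m := by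
  constructor
  · rintro ⟨P, hP⟩
    exact ⟨_, mem_matrix_intCast_iff.mpr ⟨P, rfl⟩, hP⟩
  · rintro ⟨X, hX, h⟩
    obtain ⟨P, rfl⟩ := mem_matrix_intCast_iff.mp hX
    exact ⟨P, h⟩

lemma mem_SO0Q_iff {m : ℕ} {N : SO0 m} :
    N ∈ SO0Q m ↔ mat6 N ∈ (Rat.castHom ℝ).range.matrix := by
  constructor
  · rintro ⟨P, h⟩ i j
    exact ⟨P i j, by rw [h]; rfl⟩
  · intro h
    choose P hP using h
    exact ⟨Matrix.of P, by ext i j; exact (hP i j).symm⟩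

lemma S1_integral {m : ℕ} (hm : Squarefree m) : S1 m ∈ (Int.castRingHom ℝ).range.matrix := by
  have hw := omega_mem_OO m
  obtain ⟨a, ha⟩ := int_of_real_mem_OO (r := 2 * (omega m).re) hm (by
    rw [← Complex.add_conj]
    exact add_mem hw (conj_mem_OO hw))
  obtain ⟨b, hb⟩ := int_of_real_mem_OO (r := Complex.normSq (omega m)) hm (by
    rw [Complex.normSq_eq_conj_mul_self]
    exact mul_mem (conj_mem_OO hw) hw)
  refine mem_matrix_intCast_iff.mpr ⟨!![0, 0, 0, 0, 0, 1; 0, 0, 0, 0, 1, 0; 0, 0, -2, -a, 0, 0;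
    0, 0, -a, -(2 * b), 0, 0; 0, 1, 0, 0, 0, 0; 1, 0, 0, 0, 0, 0], ?_⟩
  ext i j
  fin_cases i <;> fin_cases j <;> simp [S1, S0, S, block6, ha, hb]

lemma rat_of_int {X : Matrix (Fin 6) (Fin 6) ℝ} (h : X ∈ (Int.castRingHom ℝ).range.matrix) :
    X ∈ (Rat.castHom ℝ).range.matrix := by
  intro i j
  obtain ⟨n, hn⟩ := h i j
  exact ⟨n, by rw [← hn]; simp⟩

lemma Sigma_subset_SigmaStar {m : ℕ} (hm : Squarefree m) : Sigma m ⊆ SigmaStar m := by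
  intro N hN
  obtain ⟨P, hP, h⟩ := mem_Sigma_iff.mp hN
  rw [mem_SigmaStar_iff, h]
  exact add_mem (one_mem _) (mul_mem hP (S1_integral hm))

lemma SigmaStar_subset_SO0Q (m : ℕ) : SigmaStar m ⊆ SO0Q m := by
  intro N hN
  rw [mem_SigmaStar_iff] at hN
  exact mem_SO0Q_iff.mpr (rat_of_int hN)

lemma mat6_mul {m : ℕ} (N T : SO0 m) : mat6 (N * T) = mat6 N * mat6 T := rfl

lemma mat6_mul_inv {m : ℕ} (N : SO0 m) : mat6 N * mat6 N⁻¹ = 1 := by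
  rw [← mat6_mul, mul_inv_cancel]; rfl

lemma S1_mul_inv {m : ℕ} (N : SO0 m) : S1 m * mat6 N⁻¹ = (mat6 N)ᵀ * S1 m := by
  have h : (mat6 N)ᵀ * S1 m * mat6 N = S1 m := N.1.2
  calc _ = (mat6 N)ᵀ * S1 m * mat6 N * mat6 N⁻¹ := by rw [h]
    _ = _ := by rw [Matrix.mul_assoc, mat6_mul_inv, Matrix.mul_one]

/-- By `S₁ N⁻¹ = Nᵗʳ S₁`, conjugation replaces `P` by `N P Nᵗʳ`. An integral `N` therefore
normalises the discriminant kernel, and a rational one sends it to rational matrices. -/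
lemma mat6_conj {m : ℕ} (N T : SO0 m) {P : Matrix (Fin 6) (Fin 6) ℝ}
    (hT : mat6 T = 1 + P * S1 m) :
    mat6 (N * T * N⁻¹) = 1 + mat6 N * P * (mat6 N)ᵀ * S1 m := by
  rw [mat6_mul, mat6_mul, hT, Matrix.mul_add, Matrix.add_mul, Matrix.mul_one, mat6_mul_inv,
    Matrix.mul_assoc _ (mat6 N)ᵀ, ← S1_mul_inv]
  simp only [Matrix.mul_assoc]

lemma conj_mem_Sigma {m : ℕ} {N T : SO0 m} (hN : N ∈ SigmaStar m) (hT : T ∈ Sigma m) :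
    N * T * N⁻¹ ∈ Sigma m := by
  rw [mem_SigmaStar_iff] at hN
  obtain ⟨P, hP, h⟩ := mem_Sigma_iff.mp hT
  exact mem_Sigma_iff.mpr ⟨_, mul_mem (mul_mem hN hP) (fun i j => hN j i), mat6_conj N T h⟩

lemma conj_mem_SO0Q {m : ℕ} (hm : Squarefree m) {N T : SO0 m} (hN : N ∈ SO0Q m)
    (hT : T ∈ Sigma m) : N * T * N⁻¹ ∈ SO0Q m := by
  rw [mem_SO0Q_iff] at *
  obtain ⟨P, hP, h⟩ := mem_Sigma_iff.mp hT
  rw [mat6_conj N T h]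
  exact add_mem (one_mem _) (mul_mem (mul_mem (mul_mem hN (rat_of_int hP)) (fun i j => hN j i))
    (rat_of_int (S1_integral hm)))

lemma diffOmega_mem_KK (m : ℕ) : diffOmega m ∈ KK m := OO_le_KK m (diffOmega_mem_OO m)

/-- Over the field `K` the denominators are harmless: all the test matrices are `K`-rational, so the
congruence only says that their images are `K`-rational. -/
lemma fixedMod_of_mem_SO0Q {m : ℕ} (h0 : m ≠ 0) {M : SU22} (hM : toSO0 h0 M ∈ SO0Q m) (i j : I4) :
    wedge i j ∈ fixedMod (KK m) (mat4 M) := by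
  have hw : omega m ∈ KK m := OO_le_KK m (omega_mem_OO m)
  have hdinv : (diffOmega m)⁻¹ ∈ KK m := (K m).inv_mem (diffOmega_mem_KK m)
  have h1 : ∀ j, alt m (fun k => (S1inv m k j : ℂ)) ∈ (KK m).matrix := by
    -- At the zero matrix, membership in `fixedMod` is plain membership in the matrices over `K`.
    have := (forall_alt_S1inv_mem_iff h0 hw (diffOmega_mem_KK m) 0).mpr
      ⟨fun i j => by
        rw [mem_fixedMod, Matrix.zero_mul, Matrix.zero_mul, zero_sub, neg_mem_iff]
        exact wedge_mem_matrix _ _ _, by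
        rw [mem_fixedMod, Matrix.zero_mul, Matrix.zero_mul, zero_sub, neg_mem_iff]
        exact smul_mem_matrix hdinv (J_mem_matrix _)⟩
    intro j
    have := this j
    rwa [mem_fixedMod, Matrix.zero_mul, Matrix.zero_mul, zero_sub, neg_mem_iff] at this
  refine ((forall_alt_S1inv_mem_iff h0 hw (diffOmega_mem_KK m) (mat4 M)).mp (fun j => ?_)).1 i j
  rw [mem_fixedMod, mat4_mul_alt_ofReal_mul h0]
  refine sub_mem ?_ (h1 j)
  obtain ⟨w, hw⟩ := (alt_mem_KK_iff h0 _).mp (h1 j)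
  rw [alt_mem_KK_iff h0]
  obtain ⟨P, hP⟩ := hM
  rw [mat6_toSO0] at hP
  refine ⟨P *ᵥ w, fun k => ?_⟩
  rw [hP]
  simp [Matrix.mulVec, dotProduct, hw]

lemma integral_of_int {m : ℕ} {T : SU22} (hT : ∀ i j, ∃ n : ℤ, mat4 T i j = n) :
    mat4 T ∈ (OO m).matrix := by
  intro i j
  obtain ⟨n, hn⟩ := hT i j
  rw [hn]
  exact intCast_mem (OO m) n

/-- Integral elements map into the discriminant kernel, and an integral `M̃` normalises that kernel,
so the conjugates again act integrally. -/
lemma mul_conj_mem_OO {m : ℕ} (hm : Squarefree m) {M : SU22}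
    (hM : toSO0 hm.ne_zero M ∈ SigmaStar m) (i j k l : I4) :
    mat4 M i j * starRingEnd ℂ (mat4 M k l) ∈ OO m := by
  refine mul_conj_mem_of_fixedMod (fun x => mem_OO_of_two_mul) M (fun T hT => ?_) i j k l
  refine ((toSO0_mem_Sigma_iff hm _).mp ?_).1
  rw [map_mul, map_mul, map_inv]
  exact conj_mem_Sigma hM (toSO0_mem_Sigma_of_integral hm (integral_of_int hT))

lemma mul_conj_mem_K {m : ℕ} (hm : Squarefree m) {M : SU22}
    (hM : toSO0 hm.ne_zero M ∈ SO0Q m) (i j k l : I4) :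
    mat4 M i j * starRingEnd ℂ (mat4 M k l) ∈ K m := by
  refine mul_conj_mem_of_fixedMod (R := KK m) (fun x h2 _ => ?_) M (fun T hT => ?_) i j k l
  · have : x = 2⁻¹ * (2 * x) := by ring
    rw [this]
    exact mul_mem ((K m).inv_mem (ofNat_mem (K m) 2)) h2
  · refine fixedMod_of_mem_SO0Q hm.ne_zero ?_
    rw [map_mul, map_mul, map_inv]
    exact conj_mem_SO0Q hm hM (toSO0_mem_Sigma_of_integral hm (integral_of_int hT))

/-! ### Images of the arithmetic sets: the easy inclusions -/

lemma mem_SigmaStar_of_forall {m : ℕ} (hm : Squarefree m) {M : SU22}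
    (h : ∀ X ∈ (OO m).matrix, mat4 M * X * (mat4 M)ᵀ ∈ (OO m).matrix) :
    toSO0 hm.ne_zero M ∈ SigmaStar m := by
  have h1 : ∀ j, ∃ w : Fin 6 → ℤ, ∀ k, tildeRe m M k j = w k := by
    intro j
    have := h _ ((alt_mem_OO_iff hm (Pi.single j 1)).mpr
      ⟨Pi.single j 1, fun k => by simp [Pi.single_apply]⟩)
    rw [mat4_mul_alt_ofReal_mul hm.ne_zero, alt_mem_OO_iff hm] at this
    simpa using this
  choose w hw using h1
  exact ⟨Matrix.of fun k j => w j k, by ext k j; exact hw j k⟩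

lemma mem_SO0Q_of_forall {m : ℕ} (h0 : m ≠ 0) {M : SU22}
    (h : ∀ X ∈ (KK m).matrix, mat4 M * X * (mat4 M)ᵀ ∈ (KK m).matrix) :
    toSO0 h0 M ∈ SO0Q m := by
  have h1 : ∀ j, ∃ w : Fin 6 → ℚ, ∀ k, tildeRe m M k j = w k := by
    intro j
    have := h _ ((alt_mem_KK_iff h0 (Pi.single j 1)).mpr
      ⟨Pi.single j 1, fun k => by simp only [Pi.single_apply]; split_ifs <;> simp⟩)
    rw [mat4_mul_alt_ofReal_mul h0, alt_mem_KK_iff h0] at this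
    simpa using this
  choose w hw using h1
  exact ⟨Matrix.of fun k j => w j k, by ext k j; exact hw j k⟩

lemma toSO0_mem_SO0Q {m : ℕ} (h0 : m ≠ 0) {M : SU22} (hM : M ∈ GK m) : toSO0 h0 M ∈ SO0Q m := by
  obtain ⟨k, L, hk, h⟩ := hM
  have hL : L.map (intEmb m) ∈ (KK m).matrix := fun i j => OO_le_KK m ⟨L i j, rfl⟩
  refine mem_SO0Q_of_forall h0 fun X hX => ?_
  have e : mat4 M * X * (mat4 M)ᵀ = (k : ℂ)⁻¹ • (L.map (intEmb m) * X * (L.map (intEmb m))ᵀ) := by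
    have : (((Real.sqrt k : ℝ) : ℂ)⁻¹) * ((Real.sqrt k : ℝ) : ℂ)⁻¹ = (k : ℂ)⁻¹ := by
      rw [← mul_inv, ← Complex.ofReal_mul, Real.mul_self_sqrt (by positivity)]
      simp
    rw [h, Matrix.transpose_smul, Matrix.smul_mul, Matrix.smul_mul, Matrix.mul_smul, smul_smul,
      this]
  rw [e]
  exact smul_mem_matrix ((K m).inv_mem (natCast_mem (K m) k))
    (mul_mem (mul_mem hL hX) (transpose_mem_matrix hL))

/-- The entries of `L Y Lᵗʳ` lie in `I(L)² = (u²)`, so dividing by `u²` keeps them integral. -/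
lemma toSO0_mem_SigmaStar {m : ℕ} (hm : Squarefree m) {M : SU22} (hM : M ∈ DeltaStar m) :
    toSO0 hm.ne_zero M ∈ SigmaStar m := by
  obtain ⟨u, L, w, hu, h, hw, hI⟩ := hM
  refine mem_SigmaStar_of_forall hm fun X hX => mem_matrix.mpr fun i j => ?_
  have e : mat4 M * X * (mat4 M)ᵀ = (u ^ 2)⁻¹ • (L.map (intEmb m) * X * (L.map (intEmb m))ᵀ) := by
    rw [h, Matrix.transpose_smul, Matrix.smul_mul, Matrix.smul_mul, Matrix.mul_smul, smul_smul]
    congr 1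
    rw [sq, mul_inv]
  obtain ⟨Y, rfl⟩ : ∃ Y : Matrix I4 I4 (𝓞 (K m)), X = Y.map (intEmb m) := by
    choose Y hY using hX
    exact ⟨Matrix.of Y, by ext i j; exact (hY i j).symm⟩
  have hmem : ∀ i j, L i j ∈ entryIdeal L := fun i j => Ideal.subset_span ⟨i, j, rfl⟩
  have h1 : (L * Y * Lᵀ) i j ∈ Ideal.span {w} := by
    rw [hI, sq, Matrix.mul_apply]
    refine sum_mem fun k _ => Ideal.mul_mem_mul ?_ (hmem j k)
    rw [Matrix.mul_apply]
    exact sum_mem fun l _ => Ideal.mul_mem_right _ _ (hmem i l)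
  obtain ⟨c, hc⟩ := Ideal.mem_span_singleton.mp h1
  refine ⟨c, ?_⟩
  rw [e, ← Matrix.transpose_map, ← Matrix.map_mul, ← Matrix.map_mul, Matrix.smul_apply,
    Matrix.map_apply, hc, map_mul, hw, smul_eq_mul, inv_mul_cancel_left₀ (pow_ne_zero 2 hu)]

/-! ### Recovering the factor `√k` -/

lemma sqrtNeg_mem_K (m : ℕ) : sqrtNeg m ∈ K m :=
  IntermediateField.subset_adjoin ℚ _ rfl

/-- A complex number with square and absolute square in `K` is the product of an element of `K`
and the square root of a rational number. -/
lemma exists_eq_mul_sqrt {m : ℕ} (hm : m ≠ 0) {z : ℂ} (hz : z ≠ 0) (h2 : z ^ 2 ∈ K m)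
    (hn : z * starRingEnd ℂ z ∈ K m) :
    ∃ κ ∈ K m, κ ≠ 0 ∧ ∃ q : ℚ, 0 < q ∧ z = κ * ((Real.sqrt q : ℝ) : ℂ) := by
  obtain ⟨κ, hκ, x, hx⟩ : ∃ κ ∈ K m, ∃ x : ℝ, z = κ * x := by
    by_cases hre : z.re = 0
    -- A purely imaginary number is a real multiple of `√-m`.
    · refine ⟨sqrtNeg m, sqrtNeg_mem_K m, z.im / Real.sqrt m, ?_⟩
      have : Real.sqrt m ≠ 0 := by positivity
      have : ((Real.sqrt m : ℝ) : ℂ) ≠ 0 := by exact_mod_cast this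
      rw [sqrtNeg]
      push_cast
      field_simp
      conv_lhs => rw [← Complex.re_add_im z, hre]
      simp [mul_comm]
    · have hz' : starRingEnd ℂ z ≠ 0 := by simpa using hz
      -- Here `κ = z / Re z`, which lies in `K` because `1 + z̄ / z = 2 Re z / z` and `z̄ / z =
      -- conj(z²) / (z z̄)`.
      refine ⟨2 * (1 + starRingEnd ℂ (z ^ 2) * (z * starRingEnd ℂ z)⁻¹)⁻¹, ?_, z.re, ?_⟩
      · refine mul_mem (ofNat_mem (K m) 2) ((K m).inv_mem (add_mem (one_mem _)
          (mul_mem (conj_mem_K h2) ((K m).inv_mem hn))))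
      · have h1 : 1 + starRingEnd ℂ (z ^ 2) * (z * starRingEnd ℂ z)⁻¹ = 2 * z.re / z := by
          have := Complex.add_conj z
          push_cast at this
          rw [← this, map_pow]
          field_simp
        have : (z.re : ℂ) ≠ 0 := by exact_mod_cast hre
        rw [h1]
        field_simp
  have hκ0 : κ ≠ 0 := by rintro rfl; simp [hx] at hz
  have hx0 : x ≠ 0 := by rintro rfl; simp [hx] at hz
  obtain ⟨q, hq⟩ := rat_of_real_mem_K hm (r := x ^ 2) (by
    have : ((x ^ 2 : ℝ) : ℂ) = z ^ 2 * (κ ^ 2)⁻¹ := by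
      rw [hx]; push_cast; field_simp
    rw [this]
    exact mul_mem h2 ((K m).inv_mem (pow_mem hκ 2)))
  have hq0 : 0 < q := by
    have : (0 : ℝ) < q := by rw [← hq]; positivity
    exact_mod_cast this
  rcases le_total 0 x with h | h
  · exact ⟨κ, hκ, hκ0, q, hq0, by rw [← hq, Real.sqrt_sq h, hx]⟩
  · refine ⟨-κ, neg_mem hκ, neg_ne_zero.mpr hκ0, q, hq0, ?_⟩
    rw [← hq, Real.sqrt_sq_eq_abs, abs_of_nonpos h, hx]
    simp

/-- The action of an invertible matrix on bivectors is injective. -/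
lemma exists_minor_ne_zero (M : SU22) : ∃ i j k l,
    mat4 M k i * mat4 M l j - mat4 M k j * mat4 M l i ≠ 0 := by
  by_contra! h
  have h0 : mat4 M * wedge (.inl 0) (.inl 1) * (mat4 M)ᵀ = 0 := by
    ext k l
    rw [mul_wedge_mul_apply]
    exact h _ _ _ _
  have h1 : (wedge (.inl 0) (.inl 1) : Matrix I4 I4 ℂ) = 0 := by
    have e : (mat4 M)ᵀ * (mat4 M⁻¹)ᵀ = 1 := by
      rw [← Matrix.transpose_mul, mat4_inv_mul, Matrix.transpose_one]
    calc wedge (.inl 0) (.inl 1) = mat4 M⁻¹ * mat4 M * wedge (.inl 0) (.inl 1) *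
          ((mat4 M)ᵀ * (mat4 M⁻¹)ᵀ) := by
          rw [e, mat4_inv_mul, Matrix.one_mul, Matrix.mul_one]
      _ = mat4 M⁻¹ * (mat4 M * wedge (.inl 0) (.inl 1) * (mat4 M)ᵀ) * (mat4 M⁻¹)ᵀ := by
          simp only [Matrix.mul_assoc]
      _ = 0 := by rw [h0]; simp
  have := congrFun (congrFun h1 (.inl 0)) (.inl 1)
  simp [wedge] at this

lemma exists_entry_ne_zero (M : SU22) : ∃ i j, mat4 M i j ≠ 0 := by
  by_contra! h
  obtain ⟨i, j, k, l, hne⟩ := exists_minor_ne_zero M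
  simp [h] at hne

lemma exists_nat_mul_mem_OO {m : ℕ} {Y : Matrix I4 I4 ℂ} (hY : Y ∈ (KK m).matrix) :
    ∃ n : ℕ, 0 < n ∧ ∀ i j, (n : ℂ) * Y i j ∈ OO m := by
  obtain ⟨y, hy, h⟩ := exists_integral_multiples ℤ (K := ℚ) (L := K m)
    (Finset.univ.image fun p : I4 × I4 => (⟨Y p.1 p.2, hY p.1 p.2⟩ : K m))
  refine ⟨y.natAbs, Int.natAbs_pos.mpr hy, fun i j => ?_⟩
  have h1 : ((y : ℂ)) * Y i j ∈ OO m := by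
    rw [mem_OO_iff_isIntegral]
    refine ⟨mul_mem (intCast_mem (K m) y) (hY i j), ?_⟩
    have := (h _ (Finset.mem_image_of_mem _ (Finset.mem_univ (i, j)))).map
      (algebraMap (K m) ℂ).toIntAlgHom
    simpa using this
  rcases Int.natAbs_eq y with e | e
  · rw [e] at h1
    simpa using h1
  · rw [e] at h1
    simpa using h1

/-- Let `p` be the conjugate of a nonzero entry, so that `p M` has entries in `K`. Comparing a
nonzero minor of `M`, which lies in `K`, with that of `p M` shows `p² ∈ K`. Hence `p = κ √q`, so `√q
M` is defined over `K`, and clearing denominators finishes. -/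
lemma mem_GK_of_mem_SO0Q {m : ℕ} (hm : Squarefree m) {M : SU22}
    (hM : toSO0 hm.ne_zero M ∈ SO0Q m) : M ∈ GK m := by
  have h0 := hm.ne_zero
  obtain ⟨a, b, hp⟩ := exists_entry_ne_zero M
  obtain ⟨i, j, k, l, hminor⟩ := exists_minor_ne_zero M
  have hX := mul_conj_mem_K hm hM
  set p := starRingEnd ℂ (mat4 M a b) with hpdef
  have hp0 : p ≠ 0 := by simpa [hpdef] using hp
  have hminorK : mat4 M k i * mat4 M l j - mat4 M k j * mat4 M l i ∈ K m := by
    have := mem_matrix.mp (mem_fixedMod.mp (fixedMod_of_mem_SO0Q h0 hM i j)) k l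
    rw [Matrix.sub_apply, mul_wedge_mul_apply] at this
    have h := add_mem this (mem_matrix.mp (wedge_mem_matrix (KK m) i j) k l)
    rwa [sub_add_cancel] at h
  have hp2 : p ^ 2 ∈ K m := by
    have : p ^ 2 = ((mat4 M k i * p) * (mat4 M l j * p) - (mat4 M k j * p) * (mat4 M l i * p)) *
        (mat4 M k i * mat4 M l j - mat4 M k j * mat4 M l i)⁻¹ := by
      rw [eq_mul_inv_iff_mul_eq₀ hminor]; ring
    rw [this]
    exact mul_mem (sub_mem (mul_mem (hX _ _ _ _) (hX _ _ _ _))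
      (mul_mem (hX _ _ _ _) (hX _ _ _ _))) ((K m).inv_mem hminorK)
  obtain ⟨κ, hκ, hκ0, q, hq, hpκ⟩ := exists_eq_mul_sqrt h0 hp0 hp2 (by
    rw [hpdef, Complex.conj_conj, mul_comm]; exact hX a b a b)
  obtain ⟨n, hn, hY⟩ := exists_nat_mul_mem_OO (m := m) (Y := fun i j => mat4 M i j * p * κ⁻¹)
    fun i j => (K m).mul_mem (hX i j a b) ((K m).inv_mem hκ)
  have hqs : ((Real.sqrt q : ℝ) : ℂ) ≠ 0 := by
    have : (0 : ℝ) < q := by exact_mod_cast hq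
    have := Real.sqrt_pos.mpr this
    exact_mod_cast this.ne'
  have hYeq : ∀ i j, mat4 M i j * p * κ⁻¹ = ((Real.sqrt q : ℝ) : ℂ) * mat4 M i j := by
    intro i j
    rw [hpκ]
    field_simp
  have hY' : ∀ i j, ∃ x : 𝓞 (K m), intEmb m x =
      (q.den * n : ℕ) * (((Real.sqrt q : ℝ) : ℂ) * mat4 M i j) := by
    intro i j
    have := mul_mem (natCast_mem (OO m) q.den) (hY i j)
    rw [hYeq] at this
    obtain ⟨x, hx⟩ := this
    exact ⟨x, by rw [hx]; push_cast; ring⟩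
  choose L hL using hY'
  -- This `k` equals `(q.den * n)² q`, so `√k = q.den * n * √q` is exactly the factor that made the
  -- entries integral.
  refine ⟨q.num.natAbs * q.den * n ^ 2, Matrix.of L, ?_, ?_⟩
  · have := Int.natAbs_pos.mpr (Rat.num_ne_zero.mpr hq.ne')
    have := q.den_pos
    positivity
  · have hk : Real.sqrt ((q.num.natAbs * q.den * n ^ 2 : ℕ) : ℝ) =
        (q.den * n : ℕ) * Real.sqrt q := by
      have hnum : ((q.num.natAbs : ℕ) : ℝ) = q * q.den := by
        have h1 : ((q.num.natAbs : ℕ) : ℚ) = q.num := by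
          have : ((q.num.natAbs : ℤ)) = q.num := Int.natAbs_of_nonneg (Rat.num_nonneg.mpr hq.le)
          rw [← this]; simp
        have h2 : ((q.num.natAbs : ℕ) : ℚ) = q * q.den := by rw [h1, Rat.mul_den_eq_num]
        exact_mod_cast h2
      have : ((q.num.natAbs * q.den * n ^ 2 : ℕ) : ℝ) = ((q.den * n : ℕ) : ℝ) ^ 2 * q := by
        push_cast
        rw [hnum]; ring
      rw [this, Real.sqrt_mul (by positivity), Real.sqrt_sq (by positivity)]
    have hne : ((q.den * n : ℕ) : ℂ) ≠ 0 := by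
      have := q.den_pos
      exact_mod_cast (by positivity : q.den * n ≠ 0)
    ext i j
    rw [hk, Matrix.smul_apply, Matrix.map_apply, Matrix.of_apply, hL, smul_eq_mul]
    rw [Complex.ofReal_mul, Complex.ofReal_natCast]
    field_simp

/-! ### The ideal of entries and the extended modular group -/

lemma mem_entryIdeal {m : ℕ} (L : Matrix I4 I4 (𝓞 (K m))) (i j : I4) : L i j ∈ entryIdeal L :=
  Ideal.subset_span ⟨i, j, rfl⟩

lemma det_mem_entryIdeal_pow {m : ℕ} (L : Matrix I4 I4 (𝓞 (K m))) :
    L.det ∈ entryIdeal L ^ 4 := by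
  rw [Matrix.det_apply]
  refine sum_mem fun σ _ => ?_
  rw [Units.smul_def, zsmul_eq_mul]
  refine Ideal.mul_mem_left _ _ ?_
  have h : ∏ i, L (σ i) i ∈ ∏ _i : I4, entryIdeal L :=
    Ideal.prod_mem_prod fun i _ => mem_entryIdeal L (σ i) i
  simpa using h

/-- `I⁴` divides `(k²) = I² I'²`. Cancelling `I²` and using unique factorisation of ideals, `I`
divides `I'`. -/
lemma le_of_mul_eq_span_of_sq_mem {R : Type*} [CommRing R] [IsDedekindDomain R]
    {I I' : Ideal R} {k : R} (hk : k ≠ 0) (h : I * I' = Ideal.span {k}) (h4 : k ^ 2 ∈ I ^ 4) :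
    I' ≤ I := by
  have h0 : I * I' ≠ 0 := by
    rw [h]
    simpa using hk
  have hI : I ≠ 0 := left_ne_zero_of_mul h0
  have h1 : I ^ 2 * I ^ 2 ∣ I ^ 2 * I' ^ 2 := by
    rw [← mul_pow I I', h, Ideal.span_singleton_pow, ← pow_add]
    exact Ideal.dvd_span_singleton.mpr h4
  have h2 : I ^ 2 ∣ I' ^ 2 := (mul_dvd_mul_iff_left (pow_ne_zero 2 hI)).mp h1
  exact Ideal.le_of_dvd ((UniqueFactorizationMonoid.pow_dvd_pow_iff_dvd two_ne_zero).mp h2)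

/-- The conjugate of an integral matrix. -/
lemma exists_conj_matrix {m : ℕ} (L : Matrix I4 I4 (𝓞 (K m))) : ∃ L' : Matrix I4 I4 (𝓞 (K m)),
    ∀ i j, intEmb m (L' i j) = starRingEnd ℂ (intEmb m (L i j)) := by
  have : ∀ i j, ∃ x : 𝓞 (K m), intEmb m x = starRingEnd ℂ (intEmb m (L i j)) :=
    fun i j => conj_mem_OO ⟨L i j, rfl⟩
  choose L' h using this
  exact ⟨L', h⟩

lemma det_eq_of_mat4_eq {m k : ℕ} {M : SU22} {L : Matrix I4 I4 (𝓞 (K m))} (hk : 0 < k)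
    (h : mat4 M = ((Real.sqrt k : ℝ) : ℂ)⁻¹ • L.map (intEmb m)) : L.det = (k : 𝓞 (K m)) ^ 2 := by
  apply intEmb_injective m
  have hs : ((Real.sqrt k : ℝ) : ℂ) ≠ 0 := by
    exact_mod_cast (Real.sqrt_pos.mpr (by exact_mod_cast hk)).ne'
  have hsq : ((Real.sqrt k : ℝ) : ℂ) ^ 2 = k := by
    rw [← Complex.ofReal_pow, Real.sq_sqrt (by positivity)]; simp
  have e := mat4_det M
  rw [h, Matrix.det_smul] at e
  rw [RingHom.map_det, map_pow, map_natCast, ← hsq]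
  simp only [Fintype.card_sum, Fintype.card_fin, inv_pow] at e
  change (L.map (intEmb m)).det = _
  field_simp at e
  rw [e]
  ring

/-- Products of entries of `L` and `L̄` are `k M_{ij} M̄_{kl}`, so `I(L) I(L̄) ⊆ (k)`; conversely `L
J L̄ᵗʳ = k J` puts `k` in the product. As `det L = det L̄ = k²` lies in both fourth powers, each
ideal contains the other. -/
lemma exists_entryIdeal_sq_eq {m : ℕ} (hm : Squarefree m) {M : SU22}
    (hM : toSO0 hm.ne_zero M ∈ SigmaStar m) :
    ∃ (k : ℕ) (L L' : Matrix I4 I4 (𝓞 (K m))), 0 < k ∧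
      mat4 M = ((Real.sqrt k : ℝ) : ℂ)⁻¹ • L.map (intEmb m) ∧
      (∀ i j, intEmb m (L' i j) = starRingEnd ℂ (intEmb m (L i j))) ∧
      Ideal.span {(k : 𝓞 (K m))} = entryIdeal L ^ 2 ∧ entryIdeal L' = entryIdeal L := by
  obtain ⟨k, L, hk, h⟩ := mem_GK_of_mem_SO0Q hm (SigmaStar_subset_SO0Q m hM)
  obtain ⟨L', hL'⟩ := exists_conj_matrix L
  have hs : ((Real.sqrt k : ℝ) : ℂ) ≠ 0 := by
    exact_mod_cast (Real.sqrt_pos.mpr (by exact_mod_cast hk)).ne'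
  have hsq : ((Real.sqrt k : ℝ) : ℂ) * ((Real.sqrt k : ℝ) : ℂ) = k := by
    rw [← Complex.ofReal_mul, Real.mul_self_sqrt (by positivity)]; simp
  have hk0 : (k : 𝓞 (K m)) ≠ 0 := by exact_mod_cast hk.ne'
  have hL : ∀ i j, intEmb m (L i j) = ((Real.sqrt k : ℝ) : ℂ) * mat4 M i j := by
    intro i j
    rw [h, Matrix.smul_apply, Matrix.map_apply, smul_eq_mul, mul_inv_cancel_left₀ hs]
  have hL2 : ∀ i j, intEmb m (L' i j) = ((Real.sqrt k : ℝ) : ℂ) * starRingEnd ℂ (mat4 M i j) := by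
    intro i j
    rw [hL', hL, map_mul, Complex.conj_ofReal]
  have hprod : ∀ i j k' l, intEmb m (L i j * L' k' l) =
      k * (mat4 M i j * starRingEnd ℂ (mat4 M k' l)) := by
    intro i j k' l
    rw [map_mul, hL, hL2, ← hsq]
    ring
  have hmul : entryIdeal L * entryIdeal L' = Ideal.span {(k : 𝓞 (K m))} := by
    apply le_antisymm
    · rw [entryIdeal, entryIdeal, Ideal.span_mul_span, Ideal.span_le]
      rintro _ ⟨_, ⟨i, j, rfl⟩, _, ⟨i', j', rfl⟩, rfl⟩
      rw [SetLike.mem_coe, Ideal.mem_span_singleton]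
      obtain ⟨x, hx⟩ := mul_conj_mem_OO hm hM i j i' j'
      refine ⟨x, intEmb_injective m ?_⟩
      rw [hprod, map_mul, hx, map_natCast]
    · rw [Ideal.span_singleton_le_iff_mem]
      have e : (k : 𝓞 (K m)) = (L * Matrix.J (Fin 2) (𝓞 (K m)) * L'ᵀ) (.inr 0) (.inl 0) := by
        apply intEmb_injective m
        have hJ : (Matrix.J (Fin 2) (𝓞 (K m))).map (intEmb m) = Matrix.J (Fin 2) ℂ := by
          rw [Matrix.J, Matrix.J, Matrix.fromBlocks_map]
          congr 1 <;> ext i j <;> fin_cases i <;> fin_cases j <;> simp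
        have h1 : (L * Matrix.J (Fin 2) (𝓞 (K m)) * L'ᵀ).map (intEmb m) =
            (k : ℂ) • Matrix.J (Fin 2) ℂ := by
          have e1 : L.map (intEmb m) = ((Real.sqrt k : ℝ) : ℂ) • mat4 M := by
            ext i j; exact hL i j
          have e2 : L'ᵀ.map (intEmb m) = ((Real.sqrt k : ℝ) : ℂ) • (mat4 M)ᴴ := by
            ext i j; exact hL2 j i
          rw [Matrix.map_mul, Matrix.map_mul, hJ, e1, e2, Matrix.smul_mul, Matrix.smul_mul,
            Matrix.mul_smul, smul_smul, hsq, mat4_unitary']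
        have h2 := congrFun (congrFun h1 (.inr 0)) (.inl 0)
        rw [Matrix.map_apply] at h2
        rw [h2]
        simp [Matrix.J]
      rw [e, Matrix.mul_apply]
      refine sum_mem fun l _ => Ideal.mul_mem_mul ?_ (mem_entryIdeal L' _ _)
      rw [Matrix.mul_apply]
      exact sum_mem fun l _ => Ideal.mul_mem_right _ _ (mem_entryIdeal L _ _)
  have hdet := det_eq_of_mat4_eq hk h
  have hdet' : L'.det = (k : 𝓞 (K m)) ^ 2 := by
    apply intEmb_injective m
    have e : L'.map (intEmb m) = (L.map (intEmb m)).map (starRingEnd ℂ) := by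
      ext i j; exact hL' i j
    have h1 : intEmb m L'.det = starRingEnd ℂ (intEmb m L.det) := by
      rw [RingHom.map_det, RingHom.map_det, RingHom.map_det]
      exact congrArg Matrix.det e
    rw [h1, hdet]
    simp
  have heq : entryIdeal L' = entryIdeal L := by
    apply le_antisymm
    · exact le_of_mul_eq_span_of_sq_mem hk0 hmul (hdet ▸ det_mem_entryIdeal_pow L)
    · exact le_of_mul_eq_span_of_sq_mem hk0 (by rw [mul_comm, hmul])
        (hdet' ▸ det_mem_entryIdeal_pow L')
  exact ⟨k, L, L', hk, h, hL', by rw [← hmul, heq, sq], heq⟩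

lemma mem_DeltaStar_of_mem_SigmaStar {m : ℕ} (hm : Squarefree m) {M : SU22}
    (hM : toSO0 hm.ne_zero M ∈ SigmaStar m) : M ∈ DeltaStar m := by
  obtain ⟨k, L, -, hk, h, -, hI, -⟩ := exists_entryIdeal_sq_eq hm hM
  refine ⟨_, L, k, ?_, h, ?_, hI⟩
  · exact_mod_cast (Real.sqrt_pos.mpr (by exact_mod_cast hk)).ne'
  · rw [map_natCast, ← Complex.ofReal_pow, Real.sq_sqrt (by positivity)]; simp

/-! ### The discriminant kernel comes from integral matrices -/

lemma mem_Gamma2_iff {m : ℕ} {M : SU22} : M ∈ Gamma2 m ↔ mat4 M ∈ (OO m).matrix := by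
  constructor
  · rintro ⟨L, h⟩ i j
    rw [h]
    exact ⟨L i j, rfl⟩
  · intro h
    choose L hL using h
    exact ⟨Matrix.of L, by ext i j; exact (hL i j).symm⟩

lemma int_dvd_of_dvd {m : ℕ} (hm : Squarefree m) {a b : ℤ} (h : (a : 𝓞 (K m)) ∣ b) : a ∣ b := by
  obtain ⟨c, hc⟩ := h
  by_cases ha : a = 0
  · subst ha
    have : b = 0 := by simpa using hc
    rw [this]
  have h1 : (b : ℂ) = a * intEmb m c := by
    rw [← map_intCast (intEmb m), hc, map_mul, map_intCast]
  have ha' : (a : ℂ) ≠ 0 := by exact_mod_cast ha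
  obtain ⟨n, hn⟩ := int_of_real_mem_OO (r := (b : ℝ) / a) hm ⟨c, by
    push_cast
    rw [h1]; field_simp⟩
  refine ⟨n, ?_⟩
  have ha'' : (a : ℝ) ≠ 0 := by exact_mod_cast ha
  field_simp at hn
  exact_mod_cast hn

/-- An ideal generated by elements `a + bω` whose rational coordinates it contains is generated by
an integer. -/
lemma exists_int_span_eq {m : ℕ} {I : Ideal (𝓞 (K m))} {s : Set (𝓞 (K m))} (hI : I = Ideal.span s)
    {w : 𝓞 (K m)} (h : ∀ x ∈ s, ∃ a b : ℤ, x = a + b * w ∧ (b : 𝓞 (K m)) ∈ I) :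
    ∃ r : ℤ, I = Ideal.span {(r : 𝓞 (K m))} := by
  -- The generator is that of `I ∩ ℤ`; the hypothesis puts both coordinates of each generator of `I`
  -- into this intersection.
  have hp := IsPrincipalIdealRing.principal (I.comap (Int.castRingHom (𝓞 (K m))))
  obtain ⟨r, hr⟩ := hp
  have hmem : ∀ n : ℤ, (n : 𝓞 (K m)) ∈ I ↔ r ∣ n := by
    intro n
    rw [← Ideal.mem_span_singleton]
    change Int.castRingHom _ n ∈ I ↔ n ∈ Submodule.span ℤ {r}
    rw [← Ideal.mem_comap, hr]
  refine ⟨r, le_antisymm ?_ ?_⟩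
  · conv_lhs => rw [hI]
    rw [Ideal.span_le]
    intro x hx
    obtain ⟨a, b, e, hb⟩ := h x hx
    have ha : (a : 𝓞 (K m)) ∈ I := by
      have : (a : 𝓞 (K m)) = x - b * w := by rw [e]; ring
      rw [this]
      exact sub_mem (hI ▸ Ideal.subset_span hx) (Ideal.mul_mem_right _ _ hb)
    obtain ⟨a', rfl⟩ := (hmem a).mp ha
    obtain ⟨b', rfl⟩ := (hmem b).mp hb
    rw [SetLike.mem_coe, Ideal.mem_span_singleton, e]
    exact ⟨a' + b' * w, by push_cast; ring⟩
  · rw [Ideal.span_singleton_le_iff_mem]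
    exact (hmem r).mpr dvd_rfl

/-- The twisted form of `J / (ω - ω̄) ∈ fixedMod`: the matrix `(Mᵗʳ - M̄ᵗʳ) / (ω - ω̄)` is an
integral multiple of `M̄ᵗʳ`. -/
lemma exists_sub_conj_eq {m : ℕ} {M : SU22}
    (h : (diffOmega m)⁻¹ • Matrix.J (Fin 2) ℂ ∈ fixedMod (OO m) (mat4 M)) :
    ∃ X ∈ (OO m).matrix, (diffOmega m)⁻¹ • ((mat4 M)ᵀ - (mat4 M)ᴴ) = (mat4 M)ᴴ * X := by
  rw [mem_fixedMod] at h
  refine ⟨_, neg_mem (mul_mem (J_mem_matrix _) h), ?_⟩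
  rw [mul_smul_J_mul_transpose_sub]
  generalize (diffOmega m)⁻¹ • ((mat4 M)ᵀ - (mat4 M)ᴴ) = Y
  have h2 : -((mat4 M)ᴴ * Matrix.J (Fin 2) ℂ * mat4 M * Matrix.J (Fin 2) ℂ) = 1 := by
    rw [mat4_unitary, J_mul_J, neg_neg]
  calc Y = -((mat4 M)ᴴ * Matrix.J (Fin 2) ℂ * mat4 M * Matrix.J (Fin 2) ℂ) * Y := by
        rw [h2, Matrix.one_mul]
    _ = _ := by simp only [Matrix.mul_neg, Matrix.neg_mul, Matrix.mul_assoc]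

/-- An entry `a + b ω` of `L` has `b = (x - x̄) / (ω - ω̄)`, which the discriminant condition places
in `I(L̄) = I(L)`. So `I(L) = (r)` with `r ∈ ℤ`, whence `k = r²` and `√k = ± r` divides every entry
of `L`. -/
lemma mem_Gamma2_of_mem_Sigma {m : ℕ} (hm : Squarefree m) {M : SU22}
    (hM : toSO0 hm.ne_zero M ∈ Sigma m) : M ∈ Gamma2 m := by
  obtain ⟨k, L, L', hk, h, hL', hI, heq⟩ :=
    exists_entryIdeal_sq_eq hm (Sigma_subset_SigmaStar hm hM)
  obtain ⟨X, hX, hXe⟩ := exists_sub_conj_eq ((toSO0_mem_Sigma_iff hm M).mp hM).2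
  obtain ⟨Y, rfl⟩ : ∃ Y : Matrix I4 I4 (𝓞 (K m)), X = Y.map (intEmb m) := by
    choose Y hY using hX
    exact ⟨Matrix.of Y, by ext i j; exact (hY i j).symm⟩
  obtain ⟨w, hw⟩ := omega_mem_OO m
  have hs : ((Real.sqrt k : ℝ) : ℂ) ≠ 0 := by
    exact_mod_cast (Real.sqrt_pos.mpr (by exact_mod_cast hk)).ne'
  have hL : ∀ i j, intEmb m (L i j) = ((Real.sqrt k : ℝ) : ℂ) * mat4 M i j := by
    intro i j
    rw [h, Matrix.smul_apply, Matrix.map_apply, smul_eq_mul, mul_inv_cancel_left₀ hs]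
  have hd := diffOmega_ne_zero hm.ne_zero
  have hdiff : ∀ i j, (diffOmega m)⁻¹ * (intEmb m (L i j) - starRingEnd ℂ (intEmb m (L i j))) =
      intEmb m ((L'ᵀ * Y) j i) := by
    intro i j
    have e := congrFun (congrFun hXe j) i
    have e2 : intEmb m ((L'ᵀ * Y) j i) = ((Real.sqrt k : ℝ) : ℂ) *
        ((mat4 M)ᴴ * Y.map (intEmb m)) j i := by
      rw [Matrix.mul_apply, Matrix.mul_apply, map_sum, Finset.mul_sum]
      refine Finset.sum_congr rfl fun l _ => ?_
      rw [map_mul, Matrix.transpose_apply, hL', hL, map_mul, Complex.conj_ofReal,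
        Matrix.conjTranspose_apply, Matrix.map_apply, mul_assoc]
      rfl
    rw [e2, ← e, hL, map_mul, Complex.conj_ofReal]
    simp only [Matrix.smul_apply, Matrix.sub_apply, Matrix.transpose_apply,
      Matrix.conjTranspose_apply, smul_eq_mul]
    change _ = _ * (_ * (_ - starRingEnd ℂ _))
    ring
  obtain ⟨r, hr⟩ := exists_int_span_eq (I := entryIdeal L) (w := w) rfl (by
    rintro _ ⟨i, j, rfl⟩
    obtain ⟨a, b, e1, e2⟩ := sub_conj_of_mem_OO hm ⟨L i j, rfl⟩
    refine ⟨a, b, intEmb_injective m ?_, ?_⟩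
    · rw [map_add, map_mul, map_intCast, map_intCast, hw, e1]
    · have : (b : 𝓞 (K m)) = (L'ᵀ * Y) j i := by
        apply intEmb_injective m
        rw [← hdiff, e2, map_intCast]
        field_simp
      rw [this, ← heq, Matrix.mul_apply]
      exact sum_mem fun l _ => Ideal.mul_mem_right _ _ (mem_entryIdeal L' l j))
  have hkr : (k : ℤ) = r ^ 2 := by
    rw [hr, Ideal.span_singleton_pow, Ideal.span_singleton_eq_span_singleton] at hI
    -- Equality of the ideals `(k)` and `(r²)` of `𝓞` gives divisibility both ways in `ℤ`, and both
    -- integers are nonnegative.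
    refine Int.dvd_antisymm (by positivity) (by positivity) (int_dvd_of_dvd hm ?_)
      (int_dvd_of_dvd hm ?_)
    · push_cast; exact hI.dvd
    · push_cast; exact hI.symm.dvd
  have hr0 : (r : ℂ) ≠ 0 := by
    rintro h0
    have : r = 0 := by exact_mod_cast h0
    rw [this] at hkr
    omega
  have hsqrt : ((Real.sqrt k : ℝ) : ℂ) = r ∨ ((Real.sqrt k : ℝ) : ℂ) = -r := by
    have : ((Real.sqrt k : ℝ) : ℂ) ^ 2 = (r : ℂ) ^ 2 := by
      rw [← Complex.ofReal_pow, Real.sq_sqrt (by positivity)]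
      exact_mod_cast hkr
    exact sq_eq_sq_iff_eq_or_eq_neg.mp this
  refine mem_Gamma2_iff.mpr fun i j => ?_
  have hx : L i j ∈ Ideal.span {(r : 𝓞 (K m))} := hr ▸ mem_entryIdeal L i j
  obtain ⟨x, hx⟩ := Ideal.mem_span_singleton.mp hx
  have e := hL i j
  rw [hx, map_mul, map_intCast] at e
  rcases hsqrt with h' | h' <;> rw [h'] at e
  · exact ⟨x, mul_left_cancel₀ hr0 e⟩
  · exact ⟨-x, mul_left_cancel₀ hr0 (by rw [map_neg]; linear_combination -e)⟩

end HermMod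

end

theorem theorem3 (m : ℕ) (hm : Squarefree m) :
    ∃ φ : HermMod.SU22 →* HermMod.SO0 m,
      (∀ M : HermMod.SU22,
        (HermMod.mat6 (φ M)).map (fun x : ℝ => (x : ℂ)) = HermMod.tilde m M) ∧
      (∀ M : HermMod.SU22, ∀ Z ∈ HermMod.H2,
        (HermMod.blkC M * Z + HermMod.blkD M).det ≠ 0 ∧
        (HermMod.blkC M * Z + HermMod.blkD M).det = HermMod.factorO (φ M) (HermMod.coord m Z) ∧
        HermMod.coord m (HermMod.actH M Z) = HermMod.actO (φ M) (HermMod.coord m Z)) ∧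
      Function.Surjective φ ∧
      (∀ M : HermMod.SU22, M ∈ φ.ker ↔ HermMod.mat4 M = 1 ∨ HermMod.mat4 M = -1) ∧
      φ '' HermMod.GK m = HermMod.SO0Q m ∧
      φ '' HermMod.DeltaStar m = HermMod.SigmaStar m ∧
      φ '' HermMod.Gamma2 m = HermMod.Sigma m := by
  have hsurj := HermMod.surjective_toSO0 hm.ne_zero
  refine ⟨HermMod.toSO0 hm.ne_zero, HermMod.map_mat6_toSO0 hm.ne_zero, fun M Z hZ =>
    ⟨HermMod.det_ne_zero_of_mem_H2 M hZ, HermMod.factorO_toSO0 hm.ne_zero M Z,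
      HermMod.coord_actH hm.ne_zero M Z⟩, hsurj,
    HermMod.mem_ker_toSO0 hm.ne_zero, ?_, ?_, ?_⟩
  · refine Set.Subset.antisymm ?_ fun N hN => ?_
    · rintro _ ⟨M, hM, rfl⟩
      exact HermMod.toSO0_mem_SO0Q hm.ne_zero hM
    · obtain ⟨M, rfl⟩ := hsurj N
      exact ⟨M, HermMod.mem_GK_of_mem_SO0Q hm hN, rfl⟩
  · refine Set.Subset.antisymm ?_ fun N hN => ?_
    · rintro _ ⟨M, hM, rfl⟩
      exact HermMod.toSO0_mem_SigmaStar hm hM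
    · obtain ⟨M, rfl⟩ := hsurj N
      exact ⟨M, HermMod.mem_DeltaStar_of_mem_SigmaStar hm hN, rfl⟩
  · refine Set.Subset.antisymm ?_ fun N hN => ?_
    · rintro _ ⟨M, hM, rfl⟩
      exact HermMod.toSO0_mem_Sigma_of_integral hm (HermMod.mem_Gamma2_iff.mp hM)
    · obtain ⟨M, rfl⟩ := hsurj N
      exact ⟨M, HermMod.mem_Gamma2_of_mem_Sigma hm hN, rfl⟩
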